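/- **Setting.** Let $n,p\to\infty$ along a sequence (all quantities below may depend on the index of the sequence, except the constants declared as such; $K\ge 0$ is a fixed known integer, $K\le p$). One observes $$\mathbf y_t=\boldsymbol\mu+\sqrt p\,\xi_t\,\boldsymbol\Sigma_0^{1/2}\mathbf u_t,\qquad t=1,\dots,n,$$ where $\boldsymbol\mu\in\mathbb R^p$, $\boldsymbol\Sigma_0$ is a positive semidefinite $p\times p$ matrix with $\operatorname{tr}\boldsymbol\Sigma_0=p$, the scalars $\xi_t\ge 0$ are i.i.d., the vectors $\mathbf u_t$ are i.i.d. uniform on the unit sphere of $\mathbb R^p$, and $(\xi_t)$ is independent of $(\mathbf u_t)$. Write $\boldsymbol\Sigma_0=\boldsymbol\Gamma\,\mathrm{diag}(\lambda_{0;1},\dots,\lambda_{0;p})\,\boldsymbol\Gamma^T$ with $\boldsymbol\Gamma$ orthogonal and $\lambda_{0;1}\ge\dots\ge\lambda_{0;p}$; let $\boldsymbol\Gamma_K$ be the first $K$ columns of $\boldsymbol\Gamma$ and $\boldsymbol\Lambda_{0K}=\mathrm{diag}(\lambda_{0;1},\dots,\lambda_{0;K})$. Assume that there are constants $0<\varepsilon<2$,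 $c,C,\delta,\gamma>0$ such that 1. $E\,\xi_t^{2+\varepsilon}<C$ and $P(|\xi_t|>c)=1$; 2. $c<(\boldsymbol\Sigma_0)_{ii}<C$ for all $i$; 3. $\delta p\le\lambda_{0;i}\le p/\delta$ for $i\le K$, and $\delta\le\lambda_{0;i}\le 1/\delta$ for $K<i\le p$; 4. $(\log p)^{2+\gamma}=o(n)$ and $\log n=O(\log p)$. **IPSN pilot estimators.** (I) For $H>0$ with $H\to\infty$ and $H=O(\sqrt{n/\log p})$, let $\Psi_H(x)=\min(H,\max(-H,x))$, and let $\widehat{\boldsymbol\mu}$ be any solution of $\sum_{t=1}^n\Psi_H(y_{i,t}-\widehat\mu_i)=0$, $1\le i\le p$. (II) Let $\widehat{\mathbf P}_I$ be any $(p-K)\times p$ matrix with $\widehat{\mathbf P}_I\widehat{\mathbf P}_I^T=\mathbf I$ whose rows are orthogonal to (a choice of) the $K$ leading eigenvectors of the spatial Kendall's tau matrix $\frac{2}{n(n-1)}\sum_{i<j}(\mathbf y_i-\mathbf y_j)(\mathbf y_i-\mathbf y_j)^T/\|\mathbf y_i-\mathbf y_j\|_2^2$, and put $\widehat{\mathbf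 X}_t=\sqrt p\,(\mathbf y_t-\widehat{\boldsymbol\mu})/\|\widehat{\mathbf P}_I(\mathbf y_t-\widehat{\boldsymbol\mu})\|_2$. (III) Let $\widehat{\boldsymbol\Sigma}_0=\frac{\widehat\eta}{n}\sum_{t=1}^n\widehat{\mathbf X}_t\widehat{\mathbf X}_t^T$ with $\widehat\eta=p/\operatorname{tr}\big(\frac1n\sum_t\widehat{\mathbf X}_t\widehat{\mathbf X}_t^T\big)$, and let $\widehat{\boldsymbol\Lambda}_{0K}$ (diagonal, decreasing) and $\widehat{\boldsymbol\Gamma}_K$ be the $K$ leading eigenvalues and corresponding orthonormal eigenvectors of $\widehat{\boldsymbol\Sigma}_0$. **Theorem.** With $\|\mathbf A\|_{\max}=\max_{i,j}|A_{ij}|$, $$\|\widehat{\boldsymbol\Sigma}_0-\boldsymbol\Sigma_0\|_{\max}=O_p\Big(\sqrt{\tfrac{\log p}{p}}+\sqrt{\tfrac{\log p}{n}}\Big),\qquad \|\widehat{\boldsymbol\Lambda}_{0K}\boldsymbol\Lambda_{0K}^{-1}-\mathbf I\|_{\max}=O_p\Big(\sqrt{\tfrac{\log p}{p}}+\sqrt{\tfrac{\log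 p}{n}}\Big),$$ and there are (random) orthogonal $K\times K$ matrices $\mathbf Q$ with $$\|\widehat{\boldsymbol\Gamma}_K-\boldsymbol\Gamma_K\mathbf Q\|_{\max}=O_p\Big(\sqrt{\tfrac{\log p}{p^2}}+\sqrt{\tfrac{\log p}{np}}\Big).$$ If moreover the leading eigenvalues are separated, i.e. for some constant $\delta'>0$ one has $\lambda_{0;i}-\lambda_{0;j}\ge\delta' p$ for all $1\le i<j\le K$, then $\mathbf Q$ can be taken diagonal with entries $\pm1$; that is, $\|\widehat{\boldsymbol\Gamma}_K-\boldsymbol\Gamma_K\|_{\max}$ has this rate once the signs of the eigenvectors are matched. -/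

import Mathlib

open MeasureTheory ProbabilityTheory Filter Topology Asymptotics
open scoped Matrix

noncomputable section

namespace IPSN

/-- Stochastic boundedness `X_m = O_p(r_m)` along a sequence of probability spaces.
For sets that are not measurable, `P m` is the outer measure. -/
def IsBigOp {Ω : ℕ → Type*} [∀ m, MeasurableSpace (Ω m)] (P : ∀ m, Measure (Ω m))
    (X : ∀ m, Ω m → ℝ) (r : ℕ → ℝ) : Prop :=
  ∀ η : ℝ, 0 < η → ∃ M : ℝ, 0 < M ∧
    ∀ᶠ m in atTop, P m {ω | M * r m < |X m ω|} ≤ ENNReal.ofReal η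

/-- The entrywise maximum norm. -/
def maxNorm {a b : ℕ} (A : Matrix (Fin a) (Fin b) ℝ) : ℝ :=
  ⨆ ij : Fin a × Fin b, |A ij.1 ij.2|

/-- The Euclidean norm of a coordinate vector. -/
def l2norm {a : ℕ} (v : Fin a → ℝ) : ℝ := √(∑ i, v i ^ 2)

open scoped MatrixOrder Matrix.Norms.L2Operator in
/-- The positive semidefinite square root of a positive semidefinite matrix. -/
def matrixSqrt {p : ℕ} (A : Matrix (Fin p) (Fin p) ℝ) : Matrix (Fin p) (Fin p) ℝ :=
  CFC.sqrt A

/-- The uniform distribution on the unit sphere of `ℝ^p`: normalized surface measure. -/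
def sphereUniform (p : ℕ) : Measure (EuclideanSpace ℝ (Fin p)) :=
  ((volume : Measure (EuclideanSpace ℝ (Fin p))).toSphere Set.univ)⁻¹ •
    ((volume : Measure (EuclideanSpace ℝ (Fin p))).toSphere.map Subtype.val)

/-- The random inputs of the elliptical model: nonnegative i.i.d. scalars `ξ_t`, i.i.d.
directions `u_t`, uniform on the unit sphere, the two families being independent. -/
structure IsEllipticalDesign {Ω : Type*} [MeasurableSpace Ω] (P : Measure Ω) {n p : ℕ}
    (ξ : Fin n → Ω → ℝ) (u : Fin n → Ω → EuclideanSpace ℝ (Fin p)) : Prop where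
  measurable_xi : ∀ t, Measurable (ξ t)
  measurable_u : ∀ t, Measurable (u t)
  nonneg_xi : ∀ t, ∀ᵐ ω ∂P, 0 ≤ ξ t ω
  indep_xi : iIndepFun ξ P
  ident_xi : ∀ s t, IdentDistrib (ξ s) (ξ t) P P
  indep_u : iIndepFun u P
  law_u : ∀ t, P.map (u t) = sphereUniform p
  indep_xi_u : IndepFun (fun ω t => ξ t ω) (fun ω t => u t ω) P

/-- The observations `y_t = μ + √p ξ_t Σ₀^{1/2} u_t` of one outcome. -/
def ellipticalObs {n p : ℕ} (μ : Fin p → ℝ) (Sig0 : Matrix (Fin p) (Fin p) ℝ)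
    (ξ : Fin n → ℝ) (u : Fin n → EuclideanSpace ℝ (Fin p)) : Fin n → Fin p → ℝ :=
  fun t => μ + (√(p : ℝ) * ξ t) • (matrixSqrt Sig0 *ᵥ (u t).ofLp)

/-- `A = Γ diag(lam) Γᵀ` with `Γ` orthogonal and the eigenvalues in decreasing order. -/
structure IsEigenDecomp {p : ℕ} (A Γ : Matrix (Fin p) (Fin p) ℝ) (lam : Fin p → ℝ) : Prop where
  orth : Γᵀ * Γ = 1
  anti : Antitone lam
  eq : A = Γ * Matrix.diagonal lam * Γᵀ

/-- The first `K` columns of a matrix. -/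
def leadCols {p K : ℕ} (hK : K ≤ p) (Γ : Matrix (Fin p) (Fin p) ℝ) :
    Matrix (Fin p) (Fin K) ℝ :=
  Γ.submatrix id (Fin.castLE hK)

/-- The diagonal matrix of the first `K` entries. -/
def leadDiag {p K : ℕ} (hK : K ≤ p) (lam : Fin p → ℝ) : Matrix (Fin K) (Fin K) ℝ :=
  Matrix.diagonal fun k => lam (Fin.castLE hK k)

/-- The Huber function. -/
def huberPsi (H x : ℝ) : ℝ := min H (max (-H) x)

/-- The spatial Kendall's tau matrix. -/
def kendallTau {n p : ℕ} (y : Fin n → Fin p → ℝ) : Matrix (Fin p) (Fin p) ℝ :=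
  (2 / ((n : ℝ) * ((n : ℝ) - 1))) •
    ∑ i, ∑ j ∈ Finset.Ioi i,
      (1 / l2norm (y i - y j) ^ 2) • Matrix.vecMulVec (y i - y j) (y i - y j)

/-- The self-normalized variable `√p (y - m) / ‖Pr (y - m)‖₂`. -/
def selfNormalized {p q : ℕ} (Pr : Matrix (Fin q) (Fin p) ℝ) (m y : Fin p → ℝ) : Fin p → ℝ :=
  (√(p : ℝ) / l2norm (Pr *ᵥ (y - m))) • (y - m)

/-- The sample second moment matrix `n⁻¹ ∑ X_t X_tᵀ`. -/
def secondMoment {n p : ℕ} (X : Fin n → Fin p → ℝ) : Matrix (Fin p) (Fin p) ℝ :=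
  (1 / (n : ℝ)) • ∑ t, Matrix.vecMulVec (X t) (X t)

/-- The second moment matrix rescaled to have trace `p`. -/
def traceNormalized {n p : ℕ} (X : Fin n → Fin p → ℝ) : Matrix (Fin p) (Fin p) ℝ :=
  ((p : ℝ) / (secondMoment X).trace) • secondMoment X

/-- The idiosyncratic-projected self-normalized (IPSN) pilot estimators computed from the
sample `y` with `K` factors and Huber parameter `H`: a Huber location `muHat`, a projection
`Pr` off the leading `K` eigenvectors of spatial Kendall's tau, the pilot scatter matrix
`SigHat`, and an eigendecomposition `(GamHat, lamHat)` of it. -/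
structure IsPilot {n p : ℕ} (K : ℕ) (hK : K ≤ p) (H : ℝ) (y : Fin n → Fin p → ℝ)
    (muHat : Fin p → ℝ) (Pr : Matrix (Fin (p - K)) (Fin p) ℝ)
    (SigHat GamHat : Matrix (Fin p) (Fin p) ℝ) (lamHat : Fin p → ℝ) : Prop where
  huber : ∀ i, ∑ t, huberPsi H (y t i - muHat i) = 0
  proj_orth : Pr * Prᵀ = 1
  proj_null : ∃ (G : Matrix (Fin p) (Fin p) ℝ) (L : Fin p → ℝ),
    IsEigenDecomp (kendallTau y) G L ∧ Pr * leadCols hK G = 0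
  scatter : SigHat = traceNormalized fun t => selfNormalized Pr muHat (y t)
  eigen : IsEigenDecomp SigHat GamHat lamHat

end IPSN

end

/-!
The idea is to work in the eigenbasis of `Σ₀`. With `w_t = Γᵀ u_t`, again uniform on the sphere, the
observations are `y_t = μ + ξ_t a_t`, where coordinate `i` of the noise is `a_t i = √p ⟨b_i, w_t⟩`
and the loadings satisfy `⟨b_i, b_j⟩ = (Σ₀) i j` (`ellipticalObs_eq`, `inner_loading`). The radii are
independent of the directions, so events in the directions are bounded with the radii held fixed
(`measure_joint_le`); moments of the radii enter only through a bound on `∑ ξ_t²`.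

Exponential moments on the sphere are bounded by Gaussian ones
(`lintegral_exp_diag_sphereUniform`): a Gaussian vector has an independent radius of mean square `p`,
and Jensen's inequality removes that radius. Chernoff bounds then control uniformly the coordinates
of `w_t`, the squared length of the idiosyncratic part of `a_t`, which concentrates at `p κ`, and the
entries of `n⁻¹ ∑ a_t a_tᵀ - Σ₀` (`measure_coord_sq_gt_le`, `measure_quadratic_gt_le`,
`measure_secondMoment_gt_le`). The Huber score changes sign within `O(√(log p / n))` of `μ` in every
coordinate (`measure_huber_sign_le`).

Spatial Kendall's tau needs no moments. In the eigenbasis it is a U-statistic whose kernel has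
Frobenius norm at most one, so its Frobenius distance to its mean is `O(n^{-1/2})`
(`measure_kendallSum_gt_le`). Reflection symmetry makes the mean diagonal, and fourth moments of
rotation-invariant laws show that its first `K` entries are bounded below while the others are
`O(1 / p)` (`le_kendallMean`, `kendallMean_le`). A sin-theta argument bounds the angle between the
estimated and the true leading eigenspace by `O(n^{-1/2})` (`sum_trailing_sq_le`). Hence projecting
a centred observation off the estimated eigenspace has nearly the same effect on its length as
removing its true leading part (`abs_l2norm_proj_sub_le`), and the self-normalized vectors are
`κ^{-1/2} a_t` up to a uniform relative error. The unknown `κ` disappears in the trace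
normalization (`abs_traceNormalized_sub_le`), which yields the entrywise rate `R` of the pilot matrix
(`measure_scatter_gt_le`, `isBigOp_scatter`).

The other rates are deterministic consequences. An entrywise error `s` changes eigenvalues by at most
`s p` (`eigenvalue_sub_le`), which is a relative error `O(s)` for eigenvalues of order `p`. For the
eigenvectors, the eigenvalue equation gives `Γ̂_K = Γ_K B + O(R / √p)` entrywise, with
`B = Λ_K Γ_Kᵀ Γ̂_K Λ̂_K⁻¹` (`abs_leadCols_sub_mul_le`). Comparing Gram matrices, `B` is nearly
orthogonal, hence within `O(R)` of its polar factor (`exists_orthogonal_near`); as the entries of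
`Γ_K` are `O(p^{-1/2})`, this costs another `O(R / √p)`. When the leading eigenvalues are separated,
the off-diagonal entries of `B` are `O(R)` and the polar factor may be replaced by the signs of the
diagonal (`abs_sub_diagonal_sign_le`).
-/

namespace IPSN
/-! ### The uniform distribution on the sphere -/

section Sphere

variable {p : ℕ}

/-- Integration in polar coordinates. -/
theorem lintegral_polar (hp : 0 < p) {F : EuclideanSpace ℝ (Fin p) → ENNReal} (hF : Measurable F) :
    ∫⁻ x, F x = ∫⁻ θ, ∫⁻ r, F ((r : ℝ) • (θ : EuclideanSpace ℝ (Fin p)))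
      ∂(Measure.volumeIoiPow (p - 1))
      ∂(volume : Measure (EuclideanSpace ℝ (Fin p))).toSphere := by
  have : Nonempty (Fin p) := ⟨⟨0, hp⟩⟩
  have hm : Measurable fun z : Metric.sphere (0 : EuclideanSpace ℝ (Fin p)) 1 ×
      Set.Ioi (0 : ℝ) => F ((z.2 : ℝ) • (z.1 : EuclideanSpace ℝ (Fin p))) :=
    hF.comp (by fun_prop)
  have h := (volume : Measure (EuclideanSpace ℝ (Fin p))).measurePreserving_homeomorphUnitSphereProd
  rw [finrank_euclideanSpace, Fintype.card_fin] at h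
  have h0 : ∫⁻ x, F x = ∫⁻ x in {(0 : EuclideanSpace ℝ (Fin p))}ᶜ, F x := by
    rw [restrict_compl_singleton]
  rw [← lintegral_prod _ hm.aemeasurable, ← h.lintegral_comp hm, h0,
    ← lintegral_subtype_comap (measurableSet_singleton _).compl]
  refine lintegral_congr fun x => ?_
  congr 1
  have hx : ‖(x : EuclideanSpace ℝ (Fin p))‖ ≠ 0 := norm_ne_zero_iff.2 x.2
  simp [smul_smul, hx]

theorem lintegral_volumeIoiPow (k : ℕ) {g : ℝ → ℝ} (hg : Measurable g) :
    ∫⁻ r, ENNReal.ofReal (g r) ∂(Measure.volumeIoiPow k) =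
      ∫⁻ r in Set.Ioi (0 : ℝ), ENNReal.ofReal (r ^ k * g r) := by
  rw [Measure.volumeIoiPow, lintegral_withDensity_eq_lintegral_mul _ (by fun_prop) (by fun_prop),
    ← lintegral_subtype_comap measurableSet_Ioi (fun r => ENNReal.ofReal (r ^ k * g r))]
  refine lintegral_congr fun r => ?_
  have : (0 : ℝ) ≤ r.1 ^ k := pow_nonneg (le_of_lt r.2) _
  simp [ENNReal.ofReal_mul this]

theorem integrableOn_pow_mul_exp_neg_sq (k : ℕ) :
    IntegrableOn (fun r : ℝ => r ^ k * Real.exp (-r ^ 2 / 2)) (Set.Ioi 0) := by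
  have h := integrable_rpow_mul_exp_neg_mul_sq (b := 1 / 2) (by norm_num)
    (s := (k : ℝ)) (by have : (0 : ℝ) ≤ k := k.cast_nonneg
                       linarith)
  refine h.integrableOn.congr_fun (fun r _ => ?_) measurableSet_Ioi
  simp only [Real.rpow_natCast]
  ring_nf

theorem integral_pow_mul_exp_neg_sq (k : ℕ) :
    ∫ r in Set.Ioi (0 : ℝ), r ^ k * Real.exp (-r ^ 2 / 2) =
      (1 / 2 : ℝ) ^ (-((k : ℝ) + 1) / 2) * (1 / 2) * Real.Gamma (((k : ℝ) + 1) / 2) := by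
  have h := integral_rpow_mul_exp_neg_mul_rpow (p := 2) (b := 1 / 2) (q := (k : ℝ)) (by norm_num)
    (by have : (0 : ℝ) ≤ k := k.cast_nonneg
        linarith) (by norm_num)
  rw [← h]
  refine setIntegral_congr_fun measurableSet_Ioi (fun r _ => ?_)
  simp only [Real.rpow_natCast, Real.rpow_two]
  ring_nf

theorem integral_pow_add_two_mul_exp_neg_sq (k : ℕ) :
    ∫ r in Set.Ioi (0 : ℝ), r ^ (k + 2) * Real.exp (-r ^ 2 / 2) =
      (k + 1) * ∫ r in Set.Ioi (0 : ℝ), r ^ k * Real.exp (-r ^ 2 / 2) := by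
  have hk : (0 : ℝ) < ((k : ℝ) + 1) / 2 := by positivity
  rw [integral_pow_mul_exp_neg_sq, integral_pow_mul_exp_neg_sq]
  have h1 : (((k + 2 : ℕ) : ℝ) + 1) / 2 = ((k : ℝ) + 1) / 2 + 1 := by push_cast; ring
  have h2 : -(((k + 2 : ℕ) : ℝ) + 1) / 2 = -((k : ℝ) + 1) / 2 - 1 := by push_cast; ring
  rw [h1, h2, Real.Gamma_add_one hk.ne', Real.rpow_sub_one (by norm_num)]
  ring

/-- The radial part of a standard Gaussian vector has mean square `p`, so Jensen's inequality
for `exp` bounds its exponential moments below. -/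
theorem le_lintegral_radial (hp : 0 < p) (q : ℝ) :
    ENNReal.ofReal (Real.exp (p * q)) *
        ∫⁻ r, ENNReal.ofReal (Real.exp (-(r : ℝ) ^ 2 / 2)) ∂(Measure.volumeIoiPow (p - 1)) ≤
      ∫⁻ r, ENNReal.ofReal (Real.exp ((r : ℝ) ^ 2 * q) * Real.exp (-(r : ℝ) ^ 2 / 2))
        ∂(Measure.volumeIoiPow (p - 1)) := by
  obtain ⟨k, rfl⟩ : ∃ k, p = k + 1 := ⟨p - 1, by omega⟩
  rw [Nat.add_sub_cancel, lintegral_volumeIoiPow k (g := fun r => Real.exp (-r ^ 2 / 2))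
      (by fun_prop),
    lintegral_volumeIoiPow k (g := fun r => Real.exp (r ^ 2 * q) * Real.exp (-r ^ 2 / 2))
      (by fun_prop)]
  by_cases hint : IntegrableOn
      (fun r : ℝ => r ^ k * (Real.exp (r ^ 2 * q) * Real.exp (-r ^ 2 / 2))) (Set.Ioi 0)
  swap
  · have htop : ∫⁻ r in Set.Ioi (0 : ℝ),
        ENNReal.ofReal (r ^ k * (Real.exp (r ^ 2 * q) * Real.exp (-r ^ 2 / 2))) = ⊤ := by
      by_contra hne
      refine hint ⟨by fun_prop, ?_⟩
      rw [hasFiniteIntegral_iff_ofReal]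
      · exact lt_top_iff_ne_top.2 hne
      · filter_upwards [self_mem_ae_restrict measurableSet_Ioi] with r hr
        have : (0 : ℝ) < r := hr
        positivity
    rw [htop]
    exact le_top
  have h0 := integrableOn_pow_mul_exp_neg_sq k
  have h2 := integrableOn_pow_mul_exp_neg_sq (k + 2)
  have hpos : ∀ᵐ r ∂(volume.restrict (Set.Ioi (0 : ℝ))), 0 < r := self_mem_ae_restrict measurableSet_Ioi
  rw [← ofReal_integral_eq_lintegral_ofReal h0 (by
      filter_upwards [hpos] with r hr
      simp only [Pi.zero_apply]
      positivity),
    ← ofReal_integral_eq_lintegral_ofReal hint (by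
      filter_upwards [hpos] with r hr
      simp only [Pi.zero_apply]
      positivity), ← ENNReal.ofReal_mul (Real.exp_nonneg _)]
  refine ENNReal.ofReal_le_ofReal ?_
  set J := ∫ r in Set.Ioi (0 : ℝ), r ^ k * Real.exp (-r ^ 2 / 2) with hJ
  set e := Real.exp ((k + 1 : ℕ) * q) with he
  calc e * J = ∫ r in Set.Ioi (0 : ℝ), (e * (1 - (k + 1) * q) * (r ^ k * Real.exp (-r ^ 2 / 2)) +
        e * q * (r ^ (k + 2) * Real.exp (-r ^ 2 / 2))) := by
        rw [integral_add (h0.const_mul _) (h2.const_mul _), integral_const_mul, integral_const_mul,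
          integral_pow_add_two_mul_exp_neg_sq, ← hJ]
        ring
    _ ≤ _ := by
        refine integral_mono_ae ((h0.const_mul _).add (h2.const_mul _)) hint ?_
        filter_upwards [hpos] with r hr
        have h3 := Real.add_one_le_exp (r ^ 2 * q - (k + 1 : ℕ) * q)
        have h4 : Real.exp (r ^ 2 * q) = e * Real.exp (r ^ 2 * q - (k + 1 : ℕ) * q) := by
          rw [he, ← Real.exp_add]; ring_nf
        rw [h4]
        have h5 : 0 ≤ e * (r ^ k * Real.exp (-r ^ 2 / 2)) := by positivity
        have h6 := mul_le_mul_of_nonneg_left h3 h5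
        push_cast at h6 ⊢
        calc _ = e * (r ^ k * Real.exp (-r ^ 2 / 2)) * (r ^ 2 * q - (↑k + 1) * q + 1) := by ring
          _ ≤ _ := h6
          _ = _ := by ring

/-- The total mass of the unnormalized standard Gaussian density, and more generally the integral
of the exponential of a diagonal quadratic form against it. -/
theorem lintegral_exp_diag {c : Fin p → ℝ} (hc : ∀ k, c k < 1 / 2) :
    ∫⁻ x : EuclideanSpace ℝ (Fin p),
        ENNReal.ofReal (Real.exp (∑ k, c k * x k ^ 2) * Real.exp (-‖x‖ ^ 2 / 2)) =
      ENNReal.ofReal (∏ k, √(Real.pi / (1 / 2 - c k))) := by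
  have hint : ∀ k, Integrable fun x : ℝ => Real.exp (-(1 / 2 - c k) * x ^ 2) := fun k =>
    integrable_exp_neg_mul_sq (by linarith [hc k])
  have h1 : ∀ x : EuclideanSpace ℝ (Fin p),
      Real.exp (∑ k, c k * x k ^ 2) * Real.exp (-‖x‖ ^ 2 / 2) =
        ∏ k, Real.exp (-(1 / 2 - c k) * (x.ofLp k) ^ 2) := by
    intro x
    rw [EuclideanSpace.norm_sq_eq, ← Real.exp_add, ← Real.exp_sum, neg_div, Finset.sum_div,
      ← sub_eq_add_neg, ← Finset.sum_sub_distrib]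
    congr 1
    refine Finset.sum_congr rfl fun k _ => ?_
    rw [Real.norm_eq_abs, sq_abs]
    ring
  simp_rw [h1]
  rw [(PiLp.volume_preserving_ofLp (Fin p)).lintegral_comp
    (f := fun x : Fin p → ℝ => ENNReal.ofReal (∏ k, Real.exp (-(1 / 2 - c k) * (x k) ^ 2)))
    (by fun_prop), ← ofReal_integral_eq_lintegral_ofReal]
  · rw [integral_fintype_prod_volume_eq_prod (f := fun k x => Real.exp (-(1 / 2 - c k) * x ^ 2))]
    simp_rw [integral_gaussian]
  · exact Integrable.fintype_prod (f := fun k x => Real.exp (-(1 / 2 - c k) * x ^ 2)) hint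
  · exact ae_of_all _ fun x => Finset.prod_nonneg fun k _ => Real.exp_nonneg _

theorem gaussianMass_ne_zero_top (p : ℕ) :
    ∫⁻ x : EuclideanSpace ℝ (Fin p), ENNReal.ofReal (Real.exp (-‖x‖ ^ 2 / 2)) =
      ENNReal.ofReal (∏ _k : Fin p, √(Real.pi / (1 / 2))) := by
  have h := lintegral_exp_diag (p := p) (c := fun _ => 0) (by norm_num)
  simpa using h

theorem prod_sqrt_pos (p : ℕ) : 0 < ∏ _k : Fin p, √(Real.pi / (1 / 2)) :=
  Finset.prod_pos fun _ _ => Real.sqrt_pos.2 (by positivity)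

theorem toSphere_univ_ne_zero (hp : 0 < p) :
    (volume : Measure (EuclideanSpace ℝ (Fin p))).toSphere Set.univ ≠ 0 := by
  have : Nonempty (Fin p) := ⟨⟨0, hp⟩⟩
  rw [Ne, Measure.measure_univ_eq_zero]
  exact Measure.toSphere_ne_zero _

theorem isProbabilityMeasure_sphereUniform (hp : 0 < p) :
    IsProbabilityMeasure (sphereUniform p) := by
  refine ⟨?_⟩
  rw [sphereUniform, Measure.smul_apply, Measure.map_apply measurable_subtype_coe .univ,
    Set.preimage_univ, smul_eq_mul]
  exact ENNReal.inv_mul_cancel (toSphere_univ_ne_zero hp) (measure_ne_top _ _)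

theorem ae_norm_sphereUniform (p : ℕ) : ∀ᵐ x ∂(sphereUniform p), ‖x‖ = 1 := by
  refine Measure.ae_smul_measure ?_ _
  rw [ae_map_iff measurable_subtype_coe.aemeasurable
    (measurableSet_eq_fun measurable_norm measurable_const)]
  exact ae_of_all _ fun x => by simp

theorem lintegral_sphereUniform {f : EuclideanSpace ℝ (Fin p) → ENNReal} (hf : Measurable f) :
    ∫⁻ x, f x ∂(sphereUniform p) =
      ((volume : Measure (EuclideanSpace ℝ (Fin p))).toSphere Set.univ)⁻¹ *
        ∫⁻ θ, f θ ∂(volume : Measure (EuclideanSpace ℝ (Fin p))).toSphere := by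
  rw [sphereUniform, lintegral_smul_measure, lintegral_map hf measurable_subtype_coe, smul_eq_mul]

theorem lintegral_sphereUniform_mul (hp : 0 < p) {f : EuclideanSpace ℝ (Fin p) → ENNReal}
    (hf : Measurable f) (Z : ENNReal) :
    (∫⁻ x, f x ∂(sphereUniform p)) *
      ((volume : Measure (EuclideanSpace ℝ (Fin p))).toSphere Set.univ * Z) =
      ∫⁻ θ, f θ * Z ∂(volume : Measure (EuclideanSpace ℝ (Fin p))).toSphere := by
  rw [lintegral_sphereUniform hf]
  calc _ = ((volume : Measure (EuclideanSpace ℝ (Fin p))).toSphere Set.univ)⁻¹ *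
        (volume : Measure (EuclideanSpace ℝ (Fin p))).toSphere Set.univ *
        ((∫⁻ θ, f θ ∂(volume : Measure (EuclideanSpace ℝ (Fin p))).toSphere) * Z) := by ring
    _ = _ := by
        rw [ENNReal.inv_mul_cancel (toSphere_univ_ne_zero hp) (measure_ne_top _ _), one_mul,
          lintegral_mul_const Z (f := fun θ : Metric.sphere (0 : EuclideanSpace ℝ (Fin p)) 1 => f θ)
            (hf.comp measurable_subtype_coe)]

theorem toSphere_mul_radial (hp : 0 < p) :
    (volume : Measure (EuclideanSpace ℝ (Fin p))).toSphere Set.univ *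
      ∫⁻ r, ENNReal.ofReal (Real.exp (-(r : ℝ) ^ 2 / 2)) ∂(Measure.volumeIoiPow (p - 1)) =
      ENNReal.ofReal (∏ _k : Fin p, √(Real.pi / (1 / 2))) := by
  rw [← gaussianMass_ne_zero_top, lintegral_polar hp (by fun_prop)]
  have : ∀ (θ : Metric.sphere (0 : EuclideanSpace ℝ (Fin p)) 1) (r : Set.Ioi (0 : ℝ)),
      ‖(r : ℝ) • (θ : EuclideanSpace ℝ (Fin p))‖ ^ 2 = (r : ℝ) ^ 2 := by
    intro θ r
    simp [norm_smul]
  simp_rw [this, lintegral_const]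
  rw [mul_comm]

/-- Exponential moments of diagonal quadratic forms on the sphere of radius `√p` are bounded by
those of the standard Gaussian vector. -/
theorem lintegral_exp_diag_sphereUniform (hp : 0 < p) {c : Fin p → ℝ} (hc : ∀ k, c k < 1 / 2) :
    ∫⁻ x, ENNReal.ofReal (Real.exp (p * ∑ k, c k * x k ^ 2)) ∂(sphereUniform p) ≤
      ENNReal.ofReal (∏ k, (√(1 - 2 * c k))⁻¹) := by
  have h : _ ≤ ∫⁻ x : EuclideanSpace ℝ (Fin p),
      ENNReal.ofReal (Real.exp (∑ k, c k * x k ^ 2) * Real.exp (-‖x‖ ^ 2 / 2)) :=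
    (lintegral_sphereUniform_mul hp
      (f := fun x => ENNReal.ofReal (Real.exp (p * ∑ k, c k * x k ^ 2))) (by fun_prop)
      (∫⁻ r, ENNReal.ofReal (Real.exp (-(r : ℝ) ^ 2 / 2))
        ∂(Measure.volumeIoiPow (p - 1)))).trans_le (by
      rw [lintegral_polar hp (by fun_prop)]
      refine lintegral_mono fun θ => ?_
      refine (le_lintegral_radial hp _).trans (le_of_eq (lintegral_congr fun r => ?_))
      have hθ : ‖(θ : EuclideanSpace ℝ (Fin p))‖ = 1 := by simp
      rw [norm_smul, hθ, mul_one, Real.norm_eq_abs, sq_abs, Finset.mul_sum]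
      congr 3
      refine Finset.sum_congr rfl fun k _ => ?_
      simp only [PiLp.smul_apply, smul_eq_mul]
      ring)
  rw [toSphere_mul_radial hp, lintegral_exp_diag hc] at h
  have h0 := prod_sqrt_pos p
  rw [← ENNReal.le_div_iff_mul_le (Or.inl (ENNReal.ofReal_pos.2 h0).ne') (Or.inl ENNReal.ofReal_ne_top),
    ← ENNReal.ofReal_div_of_pos h0, ← Finset.prod_div_distrib] at h
  refine h.trans (le_of_eq ?_)
  congr 1
  refine Finset.prod_congr rfl fun k _ => ?_
  have h1 : 0 < 1 - 2 * c k := by linarith [hc k]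
  rw [← Real.sqrt_div' _ (by positivity), ← Real.sqrt_inv]
  congr 1
  have h2 : 1 / 2 - c k ≠ 0 := by linarith [hc k]
  have h3 : 1 - c k * 2 ≠ 0 := by linarith [hc k]
  have := Real.pi_pos.ne'
  field_simp

/-- The uniform law on the sphere is the law of the direction of a Gaussian vector. -/
theorem lintegral_sphereUniform_eq (hp : 0 < p) {f : EuclideanSpace ℝ (Fin p) → ENNReal}
    (hf : Measurable f) :
    (∫⁻ x, f x ∂(sphereUniform p)) * ENNReal.ofReal (∏ _k : Fin p, √(Real.pi / (1 / 2))) =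
      ∫⁻ x : EuclideanSpace ℝ (Fin p),
        f (‖x‖⁻¹ • x) * ENNReal.ofReal (Real.exp (-‖x‖ ^ 2 / 2)) := by
  rw [← toSphere_mul_radial hp, lintegral_sphereUniform_mul hp hf, lintegral_polar hp]
  · refine lintegral_congr fun θ => ?_
    rw [← lintegral_const_mul _ (by fun_prop)]
    refine lintegral_congr fun r => ?_
    have hr : (0 : ℝ) < r := r.2
    have hθ : ‖(θ : EuclideanSpace ℝ (Fin p))‖ = 1 := by simp
    rw [norm_smul, hθ, mul_one, Real.norm_eq_abs, sq_abs, abs_of_pos hr, smul_smul,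
      inv_mul_cancel₀ hr.ne', one_smul]
  · exact (hf.comp (by fun_prop)).mul (by fun_prop)

theorem map_sphereUniform (hp : 0 < p)
    (O : EuclideanSpace ℝ (Fin p) ≃ₗᵢ[ℝ] EuclideanSpace ℝ (Fin p)) :
    (sphereUniform p).map O = sphereUniform p := by
  have h0 := prod_sqrt_pos p
  refine Measure.ext_of_lintegral _ fun f hf => ?_
  have hO : Measurable O := O.continuous.measurable
  rw [lintegral_map hf hO]
  have h : (∫⁻ x, f (O x) ∂(sphereUniform p)) *
      ENNReal.ofReal (∏ _k : Fin p, √(Real.pi / (1 / 2))) = (∫⁻ x, f x ∂(sphereUniform p)) *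
      ENNReal.ofReal (∏ _k : Fin p, √(Real.pi / (1 / 2))) := by
    rw [lintegral_sphereUniform_eq hp hf, lintegral_sphereUniform_eq hp (f := fun x => f (O x)) (hf.comp hO),
      ← O.measurePreserving.lintegral_comp (f := fun x : EuclideanSpace ℝ (Fin p) =>
        f (‖x‖⁻¹ • x) * ENNReal.ofReal (Real.exp (-‖x‖ ^ 2 / 2)))
        ((hf.comp (by fun_prop)).mul (by fun_prop))]
    refine lintegral_congr fun x => ?_
    simp
  exact (ENNReal.mul_left_inj (ENNReal.ofReal_pos.2 h0).ne' ENNReal.ofReal_ne_top).1 h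

theorem integrable_sphereUniform (hp : 0 < p) {f : EuclideanSpace ℝ (Fin p) → ℝ}
    (hf : Continuous f) : Integrable f (sphereUniform p) := by
  refine Integrable.smul_measure ?_ (ENNReal.inv_ne_top.2 (toSphere_univ_ne_zero hp))
  rw [integrable_map_measure hf.aestronglyMeasurable measurable_subtype_coe.aemeasurable]
  have hc : Continuous (f ∘ (Subtype.val : Metric.sphere (0 : EuclideanSpace ℝ (Fin p)) 1 → _)) :=
    hf.comp continuous_subtype_val
  exact hc.integrable_of_hasCompactSupport (HasCompactSupport.of_compactSpace _)

end Sphere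

/-! ### Rotation-invariant measures -/

section RotationInvariant

variable {p : ℕ}

/-- Invariance of a measure on `ℝ^p` under all linear isometries. -/
def IsRotationInvariant (ν : Measure (EuclideanSpace ℝ (Fin p))) : Prop :=
  ∀ O : EuclideanSpace ℝ (Fin p) ≃ₗᵢ[ℝ] EuclideanSpace ℝ (Fin p), ν.map O = ν

theorem isRotationInvariant_sphereUniform (hp : 0 < p) : IsRotationInvariant (sphereUniform p) :=
  map_sphereUniform hp

variable {ν : Measure (EuclideanSpace ℝ (Fin p))}

theorem IsRotationInvariant.integral_comp (h : IsRotationInvariant ν)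
    (O : EuclideanSpace ℝ (Fin p) ≃ₗᵢ[ℝ] EuclideanSpace ℝ (Fin p))
    (f : EuclideanSpace ℝ (Fin p) → ℝ) : ∫ x, f (O x) ∂ν = ∫ x, f x ∂ν := by
  conv_rhs => rw [← h O]
  exact (O.toHomeomorph.measurableEmbedding.integral_map f).symm

theorem IsRotationInvariant.lintegral_comp (h : IsRotationInvariant ν)
    (O : EuclideanSpace ℝ (Fin p) ≃ₗᵢ[ℝ] EuclideanSpace ℝ (Fin p))
    (f : EuclideanSpace ℝ (Fin p) → ENNReal) : ∫⁻ x, f (O x) ∂ν = ∫⁻ x, f x ∂ν := by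
  conv_rhs => rw [← h O]
  exact (O.toHomeomorph.measurableEmbedding.lintegral_map f).symm

/-- A reflection carries `a` to any vector `b` of the same length. -/
theorem exists_isometry_inner {a b : EuclideanSpace ℝ (Fin p)} (hab : ‖a‖ = ‖b‖) :
    ∃ O : EuclideanSpace ℝ (Fin p) ≃ₗᵢ[ℝ] EuclideanSpace ℝ (Fin p),
      ∀ x, inner ℝ b (O x) = inner ℝ a x := by
  obtain ⟨O, hO⟩ : ∃ O : EuclideanSpace ℝ (Fin p) ≃ₗᵢ[ℝ] EuclideanSpace ℝ (Fin p), O a = b :=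
    ⟨_, Submodule.reflection_sub hab⟩
  exact ⟨O, fun x => by rw [← hO, O.inner_map_map]⟩

theorem IsRotationInvariant.integral_inner (h : IsRotationInvariant ν)
    {a b : EuclideanSpace ℝ (Fin p)} (hab : ‖a‖ = ‖b‖) (f : ℝ → ℝ) :
    ∫ x, f (inner ℝ a x) ∂ν = ∫ x, f (inner ℝ b x) ∂ν := by
  obtain ⟨O, hO⟩ := exists_isometry_inner hab
  simp_rw [← hO]
  exact h.integral_comp O fun x => f (inner ℝ b x)

theorem IsRotationInvariant.lintegral_inner (h : IsRotationInvariant ν)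
    {a b : EuclideanSpace ℝ (Fin p)} (hab : ‖a‖ = ‖b‖) (f : ℝ → ENNReal) :
    ∫⁻ x, f (inner ℝ a x) ∂ν = ∫⁻ x, f (inner ℝ b x) ∂ν := by
  obtain ⟨O, hO⟩ := exists_isometry_inner hab
  simp_rw [← hO]
  exact h.lintegral_comp O fun x => f (inner ℝ b x)

theorem inner_single (k : Fin p) (c : ℝ) (x : EuclideanSpace ℝ (Fin p)) :
    inner ℝ (EuclideanSpace.single k c) x = c * x k := by
  simp [EuclideanSpace.inner_single_left]

theorem integrable_of_ae_norm_le_one [IsFiniteMeasure ν] (h1 : ∀ᵐ x ∂ν, ‖x‖ ≤ 1)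
    {f : EuclideanSpace ℝ (Fin p) → ℝ} (hf : Continuous f) : Integrable f ν := by
  obtain ⟨C, hC⟩ := (isCompact_closedBall (0 : EuclideanSpace ℝ (Fin p)) 1).exists_bound_of_continuousOn
    hf.continuousOn
  refine Integrable.of_bound hf.aestronglyMeasurable C ?_
  filter_upwards [h1] with x hx
  exact hC x (by simpa using hx)

theorem IsRotationInvariant.integral_coord_sq (h : IsRotationInvariant ν) (i j : Fin p) (m : ℕ) :
    ∫ x, (x i) ^ m ∂ν = ∫ x, (x j) ^ m ∂ν := by
  have := h.integral_inner (a := EuclideanSpace.single i (1 : ℝ))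
    (b := EuclideanSpace.single j 1) (by simp) (fun t => t ^ m)
  simpa [inner_single] using this

variable [IsFiniteMeasure ν]

theorem IsRotationInvariant.integral_sq (h : IsRotationInvariant ν) (h1 : ∀ᵐ x ∂ν, ‖x‖ ≤ 1)
    (hp : 0 < p) (b : EuclideanSpace ℝ (Fin p)) :
    ∫ x, (inner ℝ b x) ^ 2 ∂ν = ‖b‖ ^ 2 * ((∫ x, ‖x‖ ^ 2 ∂ν) / p) := by
  set k : Fin p := ⟨0, hp⟩
  have e1 : ∫ x, (inner ℝ b x) ^ 2 ∂ν = ‖b‖ ^ 2 * ∫ x, (x k) ^ 2 ∂ν := by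
    rw [h.integral_inner (b := EuclideanSpace.single k ‖b‖) (by simp) (fun t => t ^ 2),
      ← integral_const_mul]
    simp_rw [inner_single, mul_pow]
  have e2 : ∫ x, ‖x‖ ^ 2 ∂ν = p * ∫ x, (x k) ^ 2 ∂ν := by
    simp_rw [EuclideanSpace.norm_sq_eq, Real.norm_eq_abs, sq_abs]
    rw [integral_finsetSum _ fun i _ => integrable_of_ae_norm_le_one h1 (by fun_prop),
      Finset.sum_congr rfl fun i _ => h.integral_coord_sq i k 2]
    simp
  have hp' : (p : ℝ) ≠ 0 := by positivity
  rw [e1, e2]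
  field_simp

theorem IsRotationInvariant.integral_mul (h : IsRotationInvariant ν) (h1 : ∀ᵐ x ∂ν, ‖x‖ ≤ 1)
    (hp : 0 < p) (a b : EuclideanSpace ℝ (Fin p)) :
    ∫ x, inner ℝ a x * inner ℝ b x ∂ν = inner ℝ a b * ((∫ x, ‖x‖ ^ 2 ∂ν) / p) := by
  have e : ∀ x : EuclideanSpace ℝ (Fin p), inner ℝ a x * inner ℝ b x =
      (1 / 4) * (inner ℝ (a + b) x) ^ 2 - (1 / 4) * (inner ℝ (a - b) x) ^ 2 := by
    intro x
    rw [inner_add_left, inner_sub_left]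
    ring
  simp_rw [e]
  rw [integral_sub (integrable_of_ae_norm_le_one h1 (by fun_prop))
    (integrable_of_ae_norm_le_one h1 (by fun_prop)), integral_const_mul, integral_const_mul,
    h.integral_sq h1 hp, h.integral_sq h1 hp, @norm_add_sq_real, @norm_sub_sq_real]
  ring

/-- Rotating by 45 degrees in a coordinate plane shows that, as for a Gaussian vector, fourth
moments are three times the mixed moments. -/
theorem IsRotationInvariant.integral_coord_sq_mul_sq (h : IsRotationInvariant ν)
    (h1 : ∀ᵐ x ∂ν, ‖x‖ ≤ 1) {i j : Fin p} (hij : i ≠ j) :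
    ∫ x, (x i) ^ 4 ∂ν = 3 * ∫ x, (x i) ^ 2 * (x j) ^ 2 ∂ν := by
  have hn : ∀ s : ℝ, s ^ 2 = 1 → ‖(EuclideanSpace.single i (1 : ℝ) + EuclideanSpace.single j s)‖ =
      ‖(EuclideanSpace.single i √2 : EuclideanSpace ℝ (Fin p))‖ := by
    intro s hs
    have : ‖(EuclideanSpace.single i (1 : ℝ) + EuclideanSpace.single j s)‖ ^ 2 =
      ‖(EuclideanSpace.single i √2 : EuclideanSpace ℝ (Fin p))‖ ^ 2 := by
      rw [@norm_add_sq_real, inner_single]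
      simp [hij, sq_abs, hs]
      norm_num
    exact (sq_eq_sq₀ (norm_nonneg _) (norm_nonneg _)).1 this
  have e : ∀ s : ℝ, s ^ 2 = 1 → ∫ x, (x i + s * x j) ^ 4 ∂ν = 4 * ∫ x, (x i) ^ 4 ∂ν := by
    intro s hs
    have := h.integral_inner (hn s hs) (fun t => t ^ 4)
    simp only [inner_add_left, inner_single, one_mul, mul_pow] at this
    rw [this, integral_const_mul]
    have : √2 ^ 4 = (4 : ℝ) := by
      rw [show √2 ^ 4 = (√2 ^ 2) ^ 2 by ring, Real.sq_sqrt (by norm_num)]; norm_num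
    rw [this]
  have e1 := e 1 (by norm_num)
  have e2 := e (-1) (by norm_num)
  have e3 : ∫ x, (x i + 1 * x j) ^ 4 ∂ν + ∫ x, (x i + -1 * x j) ^ 4 ∂ν =
      2 * ∫ x, (x i) ^ 4 ∂ν + 12 * ∫ x, (x i) ^ 2 * (x j) ^ 2 ∂ν + 2 * ∫ x, (x j) ^ 4 ∂ν := by
    rw [← integral_add (integrable_of_ae_norm_le_one h1 (by fun_prop))
      (integrable_of_ae_norm_le_one h1 (by fun_prop)), ← integral_const_mul, ← integral_const_mul,
      ← integral_const_mul, ← integral_add (integrable_of_ae_norm_le_one h1 (by fun_prop))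
      (integrable_of_ae_norm_le_one h1 (by fun_prop)),
      ← integral_add (integrable_of_ae_norm_le_one h1 (by fun_prop))
      (integrable_of_ae_norm_le_one h1 (by fun_prop))]
    congr 1
    funext x
    ring
  rw [e1, e2, h.integral_coord_sq j i 4] at e3
  linarith

/-- All mixed moments `E x_i² x_j²` are determined by the fourth moment of one coordinate, and their
sum is the fourth moment of the norm, at most one. -/
theorem IsRotationInvariant.integral_sq_mul_sq_le [IsProbabilityMeasure ν]
    (h : IsRotationInvariant ν) (h1 : ∀ᵐ x ∂ν, ‖x‖ ≤ 1) (i j : Fin p) :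
    ∫ x, (x i) ^ 2 * (x j) ^ 2 ∂ν ≤ 3 / p ^ 2 := by
  have hp : 0 < p := i.pos
  have hp1 : (1 : ℝ) ≤ p := by exact_mod_cast hp
  set m := ∫ x, (x i) ^ 4 ∂ν with hm
  have hm0 : 0 ≤ m := integral_nonneg fun x => by positivity
  have hij : ∀ k l : Fin p, ∫ x, (x k) ^ 2 * (x l) ^ 2 ∂ν = if k = l then m else m / 3 := by
    intro k l
    split_ifs with hkl
    · subst hkl
      rw [hm, h.integral_coord_sq i k 4]
      congr 1
      funext x
      ring
    · have := h.integral_coord_sq_mul_sq h1 hkl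
      rw [h.integral_coord_sq k i 4, ← hm] at this
      linarith
  have hsum : ∫ x, ‖x‖ ^ 4 ∂ν = p * m + p * (p - 1) * (m / 3) := by
    have : ∀ x : EuclideanSpace ℝ (Fin p), ‖x‖ ^ 4 = ∑ k, ∑ l, (x k) ^ 2 * (x l) ^ 2 := by
      intro x
      rw [← Finset.sum_mul_sum, show ‖x‖ ^ 4 = ‖x‖ ^ 2 * ‖x‖ ^ 2 by ring, EuclideanSpace.norm_sq_eq]
      simp only [Real.norm_eq_abs, sq_abs]
    simp_rw [this]
    have hk : ∀ k, ∫ x, ∑ l, (x k) ^ 2 * (x l) ^ 2 ∂ν = ∑ l, if k = l then m else m / 3 := by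
      intro k
      rw [integral_finsetSum _ fun i _ => integrable_of_ae_norm_le_one h1 (by fun_prop)]
      exact Finset.sum_congr rfl fun l _ => hij k l
    rw [integral_finsetSum _ fun i _ => integrable_of_ae_norm_le_one h1 (by fun_prop)]
    simp_rw [hk]
    have : ∀ k : Fin p, ∑ l, (if k = l then m else m / 3) = m + (p - 1) * (m / 3) := by
      intro k
      have : ∀ l, (if k = l then m else m / 3) = (if k = l then m - m / 3 else 0) + m / 3 := by
        intro l
        split_ifs <;> ring
      simp_rw [this, Finset.sum_add_distrib]
      simp
      ring
    simp_rw [this]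
    simp
    ring
  have hle : ∫ x, ‖x‖ ^ 4 ∂ν ≤ 1 := by
    calc _ ≤ ∫ x, (1 : ℝ) ∂ν := integral_mono_ae
          (integrable_of_ae_norm_le_one h1 (by fun_prop)) (integrable_const _) (by
            filter_upwards [h1] with x hx
            exact pow_le_one₀ (norm_nonneg _) hx)
      _ = 1 := by simp
  have hm2 : m ≤ 3 / p ^ 2 := by
    rw [le_div_iff₀ (by positivity)]
    nlinarith
  rw [hij]
  split_ifs
  · exact hm2
  · linarith

/-- Changing the sign of one coordinate. -/
noncomputable def coordFlip (k : Fin p) : EuclideanSpace ℝ (Fin p) ≃ₗᵢ[ℝ] EuclideanSpace ℝ (Fin p) :=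
  LinearIsometryEquiv.piLpCongrRight 2 fun i =>
    if i = k then LinearIsometryEquiv.neg ℝ else LinearIsometryEquiv.refl ℝ ℝ

theorem coordFlip_apply (k i : Fin p) (x : EuclideanSpace ℝ (Fin p)) :
    coordFlip k x i = if i = k then -x i else x i := by
  rw [coordFlip, LinearIsometryEquiv.piLpCongrRight_apply]
  split_ifs with h <;> simp [h]

end RotationInvariant

section SphereMoments

variable {p : ℕ}

theorem integral_mul_sphereUniform (hp : 0 < p) (a b : EuclideanSpace ℝ (Fin p)) :
    ∫ x, inner ℝ a x * inner ℝ b x ∂(sphereUniform p) = inner ℝ a b / p := by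
  have := isProbabilityMeasure_sphereUniform hp
  have h1 := ae_norm_sphereUniform p
  rw [(isRotationInvariant_sphereUniform hp).integral_mul (h1.mono fun x hx => hx.le) hp,
    integral_congr_ae (g := fun _ => (1 : ℝ)) (h1.mono fun x hx => by simp [hx])]
  simp [div_eq_mul_inv]

/-- Linear functionals of a uniform vector on the sphere of radius `√p` are subgaussian. -/
theorem lintegral_exp_sq_sphereUniform (hp : 0 < p) {C : ℝ} (hC : 0 < C)
    {b : EuclideanSpace ℝ (Fin p)} (hb : ‖b‖ ^ 2 ≤ C) :
    ∫⁻ x, ENNReal.ofReal (Real.exp (p * (inner ℝ b x) ^ 2 / (4 * C))) ∂(sphereUniform p) ≤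
      ENNReal.ofReal √2 := by
  set k : Fin p := ⟨0, hp⟩
  have hc : ‖b‖ ^ 2 / (4 * C) ≤ 1 / 4 := by
    rw [div_le_div_iff₀ (by positivity) (by norm_num)]
    linarith
  have h := lintegral_exp_diag_sphereUniform hp (c := fun i => if i = k then ‖b‖ ^ 2 / (4 * C) else 0)
    (by intro i
        split_ifs <;> linarith)
  rw [(isRotationInvariant_sphereUniform hp).lintegral_inner
    (b := EuclideanSpace.single k ‖b‖) (by simp)
    (fun t => ENNReal.ofReal (Real.exp (p * t ^ 2 / (4 * C))))]
  refine (le_of_eq (lintegral_congr fun x => ?_)).trans (h.trans (ENNReal.ofReal_le_ofReal ?_))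
  · rw [inner_single]
    congr 2
    simp
    ring
  · rw [Finset.prod_eq_single k (fun i _ hi => by simp [hi]) (by simp), if_pos rfl, ← Real.sqrt_inv]
    refine Real.sqrt_le_sqrt ?_
    rw [inv_le_comm₀ (by linarith) (by norm_num)]
    linarith

theorem inv_sqrt_one_sub_le {x : ℝ} (hx : |x| ≤ 1 / 4) :
    (√(1 - 2 * x))⁻¹ ≤ Real.exp (x + 4 * x ^ 2) := by
  have h := abs_le.1 hx
  have h0 : 0 < 1 - 2 * x := by linarith
  have hl := Real.one_sub_inv_le_log_of_pos h0
  rw [← Real.exp_log (inv_pos.2 (Real.sqrt_pos.2 h0)), Real.exp_le_exp, Real.log_inv,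
    Real.log_sqrt h0.le]
  have : -2 * x - 8 * x ^ 2 ≤ 1 - (1 - 2 * x)⁻¹ := by
    rw [le_sub_comm, inv_le_iff_one_le_mul₀ h0]
    nlinarith [sq_nonneg x, mul_nonneg (sq_nonneg x) (by linarith : 0 ≤ 1 - 4 * x)]
  linarith

/-- Diagonal quadratic forms with zero trace, on the sphere of radius `√p`, have a subgaussian
moment generating function at scale `B √p` near zero. -/
theorem lintegral_exp_quadratic_sphereUniform (hp : 0 < p) {b : Fin p → ℝ} {B τ : ℝ}
    (hb : ∀ k, |b k| ≤ B) (hsum : ∑ k, b k = 0) (hτ : |τ| * B ≤ 1 / 4) :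
    ∫⁻ x, ENNReal.ofReal (Real.exp (τ * (p * ∑ k, b k * x k ^ 2))) ∂(sphereUniform p) ≤
      ENNReal.ofReal (Real.exp (4 * τ ^ 2 * B ^ 2 * p)) := by
  have hc : ∀ k, |τ * b k| ≤ 1 / 4 := fun k => by
    rw [abs_mul]
    exact (mul_le_mul_of_nonneg_left (hb k) (abs_nonneg _)).trans hτ
  have h := lintegral_exp_diag_sphereUniform hp (c := fun k => τ * b k)
    (fun k => by linarith [(abs_le.1 (hc k)).2])
  refine (le_of_eq (lintegral_congr fun x => ?_)).trans (h.trans (ENNReal.ofReal_le_ofReal ?_))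
  · congr 2
    simp_rw [Finset.mul_sum]
    refine Finset.sum_congr rfl fun k _ => ?_
    ring
  · refine (Finset.prod_le_prod (fun k _ => by positivity) fun k _ =>
      inv_sqrt_one_sub_le (hc k)).trans ?_
    rw [← Real.exp_sum, Real.exp_le_exp, Finset.sum_add_distrib, ← Finset.mul_sum, hsum, mul_zero,
      zero_add]
    calc ∑ k, 4 * (τ * b k) ^ 2 ≤ ∑ _k : Fin p, 4 * τ ^ 2 * B ^ 2 := by
          refine Finset.sum_le_sum fun k _ => ?_
          have := sq_le_sq' (by linarith [(abs_le.1 (hb k)).1]) (abs_le.1 (hb k)).2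
          nlinarith [sq_nonneg τ]
      _ = _ := by simp; ring

end SphereMoments

/-! ### Exponential inequalities -/

section Chernoff

variable {Ω : Type*} [MeasurableSpace Ω] {P : Measure Ω}

theorem measure_ge_le_of_lintegral_exp {f : Ω → ℝ} (hf : Measurable f) {A : ℝ}
    (h : ∫⁻ ω, ENNReal.ofReal (Real.exp (f ω)) ∂P ≤ ENNReal.ofReal A) (s : ℝ) :
    P {ω | s ≤ f ω} ≤ ENNReal.ofReal (A * Real.exp (-s)) := by
  have hsub : {ω | s ≤ f ω} =
      {ω | ENNReal.ofReal (Real.exp s) ≤ ENNReal.ofReal (Real.exp (f ω))} := by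
    ext ω
    simp [ENNReal.ofReal_le_ofReal_iff (Real.exp_nonneg _)]
  rw [hsub]
  refine (meas_ge_le_lintegral_div (by fun_prop)
    (by simpa using Real.exp_pos s) ENNReal.ofReal_ne_top).trans ?_
  refine (ENNReal.div_le_div_right h _).trans (le_of_eq ?_)
  rw [← ENNReal.ofReal_div_of_pos (Real.exp_pos s), Real.exp_neg, div_eq_mul_inv]

theorem measure_sum_ge_le {n : ℕ} {X : Fin n → Ω → ℝ} (hind : iIndepFun X P)
    (hm : ∀ t, Measurable (X t)) {b : Fin n → ℝ}
    (h : ∀ t, ∫⁻ ω, ENNReal.ofReal (Real.exp (X t ω)) ∂P ≤ ENNReal.ofReal (Real.exp (b t)))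
    (s : ℝ) :
    P {ω | s ≤ ∑ t, X t ω} ≤ ENNReal.ofReal (Real.exp (∑ t, b t - s)) := by
  have hprod : ∫⁻ ω, ENNReal.ofReal (Real.exp (∑ t, X t ω)) ∂P ≤
      ENNReal.ofReal (Real.exp (∑ t, b t)) := by
    have e : ∀ ω, ENNReal.ofReal (Real.exp (∑ t, X t ω)) =
        ∏ t, (fun x => ENNReal.ofReal (Real.exp x)) (X t ω) := fun ω => by
      rw [Real.exp_sum, ENNReal.ofReal_prod_of_nonneg fun _ _ => Real.exp_nonneg _]
    simp_rw [e]
    rw [lintegral_prod_eq_prod_lintegral_of_indepFun Finset.univ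
      (fun t ω => (fun x => ENNReal.ofReal (Real.exp x)) (X t ω))
      (hind.comp (fun _ x => ENNReal.ofReal (Real.exp x)) fun _ => by fun_prop)
      (fun t => by fun_prop)]
    rw [Real.exp_sum, ENNReal.ofReal_prod_of_nonneg fun _ _ => Real.exp_nonneg _]
    exact Finset.prod_le_prod' fun t _ => h t
  refine (measure_ge_le_of_lintegral_exp (by fun_prop) hprod s).trans (le_of_eq ?_)
  rw [← Real.exp_add, sub_eq_add_neg]

theorem exp_le_one_add_add_sq {x : ℝ} (hx : |x| ≤ 1) : Real.exp x ≤ 1 + x + x ^ 2 := by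
  have := (abs_le.1 (Real.abs_exp_sub_one_sub_id_le hx)).2
  linarith

/-- A second-order bound on `exp` that does not require `x` to be small. -/
theorem exp_le_one_add_add_sq_mul_exp (x : ℝ) :
    Real.exp x ≤ 1 + x + x ^ 2 * Real.exp |x| := by
  have h1 : 1 ≤ Real.exp |x| := Real.one_le_exp (abs_nonneg x)
  rcases le_total |x| 1 with hx | hx
  · nlinarith [exp_le_one_add_add_sq hx, sq_nonneg x]
  · have hx2 : 1 ≤ x ^ 2 := by rw [← sq_abs]; nlinarith
    have hxx : |x| ≤ x ^ 2 := by rw [← sq_abs]; nlinarith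
    rcases le_total 0 x with h0 | h0
    · rw [abs_of_nonneg h0] at h1 ⊢
      nlinarith
    · have : Real.exp x ≤ 1 := Real.exp_le_one_iff.2 h0
      rw [abs_of_nonpos h0] at hxx h1 ⊢
      nlinarith

/-- After centring, a variable with an exponential moment has a subgaussian moment generating
function near zero. -/
theorem lintegral_exp_centred_le [IsProbabilityMeasure P] {Y : Ω → ℝ} (hY : Measurable Y)
    (h : ∫⁻ ω, ENNReal.ofReal (Real.exp |Y ω|) ∂P ≤ ENNReal.ofReal 2) {τ : ℝ} (hτ : |τ| ≤ 1 / 2) :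
    ∫⁻ ω, ENNReal.ofReal (Real.exp (τ * (Y ω - ∫ ω, Y ω ∂P))) ∂P ≤
      ENNReal.ofReal (Real.exp (16 * τ ^ 2)) := by
  have hint : Integrable (fun ω => Real.exp |Y ω|) P := by
    refine ⟨by fun_prop, ?_⟩
    rw [hasFiniteIntegral_iff_ofReal (ae_of_all _ fun ω => Real.exp_nonneg _)]
    exact h.trans_lt ENNReal.ofReal_lt_top
  have hle : ∫ ω, Real.exp |Y ω| ∂P ≤ 2 := by
    rw [← ofReal_integral_eq_lintegral_ofReal hint (ae_of_all _ fun ω => Real.exp_nonneg _)] at h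
    exact (ENNReal.ofReal_le_ofReal_iff (by norm_num)).1 h
  have hYint : Integrable Y P := by
    refine hint.mono' hY.aestronglyMeasurable (ae_of_all _ fun ω => ?_)
    rw [Real.norm_eq_abs]
    linarith [Real.add_one_le_exp |Y ω|]
  set m := ∫ ω, Y ω ∂P with hm
  have hbound : ∀ ω, Real.exp (τ * Y ω) ≤ 1 + τ * Y ω + τ ^ 2 * (8 * Real.exp |Y ω|) := by
    intro ω
    refine (exp_le_one_add_add_sq_mul_exp _).trans ?_
    have h1 : Real.exp |τ * Y ω| ≤ Real.exp (|Y ω| / 2) := by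
      rw [Real.exp_le_exp, abs_mul]
      nlinarith [abs_nonneg (Y ω)]
    have h2 : (Y ω) ^ 2 ≤ 8 * Real.exp (|Y ω| / 2) := by
      have := Real.quadratic_le_exp_of_nonneg (x := |Y ω| / 2) (by positivity)
      have h3 := sq_abs (Y ω)
      nlinarith [abs_nonneg (Y ω)]
    have h4 : Real.exp |Y ω| = Real.exp (|Y ω| / 2) * Real.exp (|Y ω| / 2) := by
      rw [← Real.exp_add]; ring_nf
    have h5 : (τ * Y ω) ^ 2 * Real.exp |τ * Y ω| ≤ τ ^ 2 * (8 * Real.exp |Y ω|) := by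
      rw [mul_pow, mul_assoc, h4]
      refine mul_le_mul_of_nonneg_left ?_ (sq_nonneg τ)
      calc _ ≤ (8 * Real.exp (|Y ω| / 2)) * Real.exp (|Y ω| / 2) :=
            mul_le_mul h2 h1 (Real.exp_nonneg _) (by positivity)
        _ = _ := by ring
    linarith
  have hb1 : Integrable (fun ω => 1 + τ * Y ω + τ ^ 2 * (8 * Real.exp |Y ω|)) P :=
    ((integrable_const _).add (hYint.const_mul _)).add ((hint.const_mul _).const_mul _)
  have hτint : Integrable (fun ω => Real.exp (τ * Y ω)) P := by
    refine hb1.mono' (by fun_prop) (ae_of_all _ fun ω => ?_)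
    rw [Real.norm_eq_abs, Real.abs_exp]
    exact hbound ω
  have h1 : ∫ ω, Real.exp (τ * Y ω) ∂P ≤ Real.exp (τ * m + 16 * τ ^ 2) := by
    calc _ ≤ ∫ ω, (1 + τ * Y ω + τ ^ 2 * (8 * Real.exp |Y ω|)) ∂P :=
          integral_mono hτint hb1 hbound
      _ = 1 + τ * m + τ ^ 2 * (8 * ∫ ω, Real.exp |Y ω| ∂P) := by
          have hi : Integrable (fun ω => 1 + τ * Y ω) P :=
            (integrable_const _).add (hYint.const_mul _)
          rw [integral_add hi ((hint.const_mul _).const_mul _), integral_add (integrable_const _)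
            (hYint.const_mul _), integral_const_mul, integral_const_mul, integral_const_mul]
          simp [hm]
      _ ≤ (τ * m + 16 * τ ^ 2) + 1 := by nlinarith [sq_nonneg τ]
      _ ≤ _ := Real.add_one_le_exp _
  have e : ∀ ω, Real.exp (τ * (Y ω - m)) = Real.exp (τ * Y ω) * Real.exp (-(τ * m)) := fun ω => by
    rw [← Real.exp_add]; ring_nf
  simp_rw [e]
  rw [← ofReal_integral_eq_lintegral_ofReal (hτint.mul_const _)
    (ae_of_all _ fun ω => by positivity), integral_mul_const]
  refine ENNReal.ofReal_le_ofReal ?_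
  calc _ ≤ Real.exp (τ * m + 16 * τ ^ 2) * Real.exp (-(τ * m)) :=
        mul_le_mul_of_nonneg_right h1 (Real.exp_nonneg _)
    _ = _ := by rw [← Real.exp_add]; ring_nf

end Chernoff

/-! ### Concentration for independent uniform directions -/

section Concentration

variable {Ω : Type*} [MeasurableSpace Ω] {P : Measure Ω} {n p : ℕ}
  {w : Fin n → Ω → EuclideanSpace ℝ (Fin p)}

theorem measure_preimage_eq (hm : ∀ t, Measurable (w t)) (hw : ∀ t, P.map (w t) = sphereUniform p)
    (t : Fin n) {S : Set (EuclideanSpace ℝ (Fin p))} (hS : MeasurableSet S) :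
    P {ω | w t ω ∈ S} = sphereUniform p S := by
  rw [← hw t, Measure.map_apply (hm t) hS]
  rfl

theorem measure_exists_le {ι : Type*} [Fintype ι] {A : ι → Ω → Prop} {c : ℝ}
    (h : ∀ i, P {ω | A i ω} ≤ ENNReal.ofReal c) :
    P {ω | ∃ i, A i ω} ≤ ENNReal.ofReal (Fintype.card ι * c) := by
  have : {ω | ∃ i, A i ω} = ⋃ i, {ω | A i ω} := by ext; simp
  rw [this]
  refine (measure_iUnion_fintype_le P _).trans ((Finset.sum_le_sum fun i _ => h i).trans ?_)
  simp [ENNReal.ofReal_mul]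

/-- All coordinates of all directions are of order `√(s / p)`, up to a union bound over `n p` tails. -/
theorem measure_coord_sq_gt_le (hp : 0 < p) (hm : ∀ t, Measurable (w t))
    (hw : ∀ t, P.map (w t) = sphereUniform p) (s : ℝ) :
    P {ω | ∃ tk : Fin n × Fin p, s < p * (w tk.1 ω tk.2) ^ 2} ≤
      ENNReal.ofReal (n * p * (√2 * Real.exp (-(s / 4)))) := by
  refine (measure_exists_le (c := √2 * Real.exp (-(s / 4))) fun tk => ?_).trans (by simp)
  have hS : MeasurableSet {x : EuclideanSpace ℝ (Fin p) | s < p * (x tk.2) ^ 2} :=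
    measurableSet_lt (by fun_prop) (by fun_prop)
  refine (measure_preimage_eq hm hw tk.1 hS).trans_le ?_
  have h := lintegral_exp_sq_sphereUniform hp (C := 1) one_pos
    (b := EuclideanSpace.single tk.2 1) (by simp)
  simp only [inner_single, one_mul] at h
  refine (measure_mono fun x hx => ?_).trans
    (measure_ge_le_of_lintegral_exp (by fun_prop) h (s / 4))
  simp only [Set.mem_ofPred_eq] at hx ⊢
  linarith

/-- A diagonal form with zero trace is small on every direction. The condition `s ≤ 2 B` keeps the
optimal Chernoff parameter in the range where the exponential moment bound holds. -/
theorem measure_quadratic_gt_le (hp : 0 < p) (hm : ∀ t, Measurable (w t))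
    (hw : ∀ t, P.map (w t) = sphereUniform p) {b : Fin p → ℝ} {B s : ℝ} (hB : 0 < B)
    (hb : ∀ k, |b k| ≤ B) (hsum : ∑ k, b k = 0) (hs : 0 ≤ s) (hsB : s ≤ 2 * B) :
    P {ω | ∃ t, s < |∑ k, b k * (w t ω k) ^ 2|} ≤
      ENNReal.ofReal (n * (2 * Real.exp (-(s ^ 2 * p / (16 * B ^ 2))))) := by
  refine (measure_exists_le (c := 2 * Real.exp (-(s ^ 2 * p / (16 * B ^ 2)))) fun t => ?_).trans
    (by simp)
  have hS : MeasurableSet {x : EuclideanSpace ℝ (Fin p) | s < |∑ k, b k * (x k) ^ 2|} :=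
    measurableSet_lt (by fun_prop) (by fun_prop)
  refine (measure_preimage_eq hm hw t hS).trans_le ?_
  have key : ∀ ε : ℝ, |ε| = 1 → sphereUniform p
      {x | s ≤ ε * ∑ k, b k * (x k) ^ 2} ≤
        ENNReal.ofReal (Real.exp (-(s ^ 2 * p / (16 * B ^ 2)))) := by
    intro ε hε
    have hε2 : ε ^ 2 = 1 := by rw [← sq_abs, hε, one_pow]
    have h := lintegral_exp_quadratic_sphereUniform hp (τ := ε * (s / (8 * B ^ 2))) hb hsum (by
      rw [abs_mul, hε, one_mul, abs_of_nonneg (by positivity), div_mul_eq_mul_div,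
        div_le_div_iff₀ (by positivity) (by norm_num)]
      nlinarith)
    refine (measure_mono fun x hx => ?_).trans
      ((measure_ge_le_of_lintegral_exp (by fun_prop) h (s / (8 * B ^ 2) * p * s)).trans
        (le_of_eq ?_))
    · simp only [Set.mem_ofPred_eq] at hx ⊢
      calc _ ≤ s / (8 * B ^ 2) * p * (ε * ∑ k, b k * (x k) ^ 2) :=
            mul_le_mul_of_nonneg_left hx (by positivity)
        _ = _ := by ring
    · rw [← Real.exp_add, mul_pow, hε2]
      congr 2
      field_simp
      ring
  calc _ ≤ sphereUniform p ({x | s ≤ 1 * ∑ k, b k * (x k) ^ 2} ∪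
        {x | s ≤ (-1) * ∑ k, b k * (x k) ^ 2}) := by
        refine measure_mono fun x hx => ?_
        simp only [Set.mem_union, Set.mem_ofPred_eq, one_mul, neg_mul] at hx ⊢
        rcases lt_abs.1 hx with h | h
        · exact Or.inl h.le
        · exact Or.inr h.le
    _ ≤ _ := (measure_union_le _ _).trans (add_le_add (key 1 (by norm_num)) (key (-1) (by norm_num)))
    _ = _ := by
        rw [← ENNReal.ofReal_add (Real.exp_nonneg _) (Real.exp_nonneg _)]
        ring_nf

/-- Entrywise concentration of the second moment matrix of the linear functionals `⟨b i, w t⟩`. -/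
theorem measure_secondMoment_gt_le (hp : 0 < p) (hn : 0 < n) (hm : ∀ t, Measurable (w t))
    (hw : ∀ t, P.map (w t) = sphereUniform p) (hind : iIndepFun w P) {d : ℕ}
    {b : Fin d → EuclideanSpace ℝ (Fin p)} {C s : ℝ} (hC : 0 < C)
    (hb : ∀ i, ‖b i‖ ^ 2 ≤ C) (hs : 0 ≤ s) (hsC : s ≤ 64 * C) :
    P {ω | ∃ ij : Fin d × Fin d, s < |1 / (n : ℝ) * ∑ t, p * (inner ℝ (b ij.1) (w t ω) *
        inner ℝ (b ij.2) (w t ω)) - inner ℝ (b ij.1) (b ij.2)|} ≤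
      ENNReal.ofReal (d * d * (2 * Real.exp (-(n * s ^ 2 / (1024 * C ^ 2))))) := by
  have hprob := isProbabilityMeasure_sphereUniform hp
  refine (measure_exists_le (c := 2 * Real.exp (-(n * s ^ 2 / (1024 * C ^ 2)))) fun ij => ?_).trans
    (by simp)
  obtain ⟨i, j⟩ := ij
  have hp' : (p : ℝ) ≠ 0 := by positivity
  have hn' : (0 : ℝ) < n := by positivity
  set Y : EuclideanSpace ℝ (Fin p) → ℝ :=
    fun x => p * (inner ℝ (b i) x * inner ℝ (b j) x) / (4 * C) with hY
  have hYm : Measurable Y := by fun_prop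
  have hmean : ∫ x, Y x ∂(sphereUniform p) = inner ℝ (b i) (b j) / (4 * C) := by
    rw [hY, integral_div, integral_const_mul, integral_mul_sphereUniform hp]
    field_simp
  have hexp : ∫⁻ x, ENNReal.ofReal (Real.exp |Y x|) ∂(sphereUniform p) ≤ ENNReal.ofReal 2 := by
    have hle : ∀ x, ENNReal.ofReal (Real.exp |Y x|) ≤
        ENNReal.ofReal (1 / 2) * ENNReal.ofReal (Real.exp (p * (inner ℝ (b i) x) ^ 2 / (4 * C))) +
        ENNReal.ofReal (1 / 2) *
          ENNReal.ofReal (Real.exp (p * (inner ℝ (b j) x) ^ 2 / (4 * C))) := by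
      intro x
      rw [← ENNReal.ofReal_mul (by norm_num), ← ENNReal.ofReal_mul (by norm_num),
        ← ENNReal.ofReal_add (by positivity) (by positivity)]
      refine ENNReal.ofReal_le_ofReal ?_
      set u := p * (inner ℝ (b i) x) ^ 2 / (4 * C)
      set v := p * (inner ℝ (b j) x) ^ 2 / (4 * C)
      have h1 : |Y x| ≤ (1 / 2) * u + (1 / 2) * v := by
        rw [abs_le]
        have e1 : (1 / 2) * u + (1 / 2) * v - Y x =
          p * (inner ℝ (b i) x - inner ℝ (b j) x) ^ 2 / (8 * C) := by
          simp only [u, v, hY]; field_simp; ring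
        have e2 : (1 / 2) * u + (1 / 2) * v + Y x =
          p * (inner ℝ (b i) x + inner ℝ (b j) x) ^ 2 / (8 * C) := by
          simp only [u, v, hY]; field_simp; ring
        have n1 : 0 ≤ p * (inner ℝ (b i) x - inner ℝ (b j) x) ^ 2 / (8 * C) := by positivity
        have n2 : 0 ≤ p * (inner ℝ (b i) x + inner ℝ (b j) x) ^ 2 / (8 * C) := by positivity
        constructor <;> linarith
      have h2 := convexOn_exp.2 (Set.mem_univ u) (Set.mem_univ v)
        (by norm_num : (0 : ℝ) ≤ 1 / 2) (by norm_num : (0 : ℝ) ≤ 1 / 2) (by norm_num)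
      simp only [smul_eq_mul] at h2
      exact (Real.exp_le_exp.2 h1).trans h2
    refine (lintegral_mono hle).trans ?_
    rw [lintegral_add_left (by fun_prop), lintegral_const_mul _ (by fun_prop),
      lintegral_const_mul _ (by fun_prop)]
    refine (add_le_add
      (mul_le_mul_right (lintegral_exp_sq_sphereUniform hp hC (hb i)) _)
      (mul_le_mul_right (lintegral_exp_sq_sphereUniform hp hC (hb j)) _)).trans ?_
    rw [← ENNReal.ofReal_mul (by norm_num), ← ENNReal.ofReal_add (by positivity) (by positivity)]
    refine ENNReal.ofReal_le_ofReal ?_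
    have : √2 ≤ 2 := by
      rw [Real.sqrt_le_left (by norm_num)]; norm_num
    linarith
  have key : ∀ ε : ℝ, |ε| = 1 →
      P {ω | n * s ≤ ε * ∑ t, (p * (inner ℝ (b i) (w t ω) * inner ℝ (b j) (w t ω)) -
        inner ℝ (b i) (b j))} ≤ ENNReal.ofReal (Real.exp (-(n * s ^ 2 / (1024 * C ^ 2)))) := by
    intro ε hε
    have hε2 : ε ^ 2 = 1 := by rw [← sq_abs, hε, one_pow]
    set τ : ℝ := ε * (s / (128 * C)) with hτ
    have hτ2 : |τ| ≤ 1 / 2 := by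
      rw [hτ, abs_mul, hε, one_mul, abs_of_nonneg (by positivity),
        div_le_div_iff₀ (by positivity) (by norm_num)]
      linarith
    have hX := measure_sum_ge_le (P := P)
      (X := fun t ω => τ * (Y (w t ω) - ∫ x, Y x ∂(sphereUniform p)))
      (hind.comp (fun _ x => τ * (Y x - ∫ x, Y x ∂(sphereUniform p))) fun _ => by fun_prop)
      (fun t => by have := hm t; fun_prop) (b := fun _ => 16 * τ ^ 2)
      (fun t => by
        have := lintegral_exp_centred_le hYm hexp hτ2
        rw [← hw t, lintegral_map (by fun_prop) (hm t), hw t] at this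
        exact this)
      (s / (128 * C) * (n * s) / (4 * C))
    refine (measure_mono fun ω hω => ?_).trans (hX.trans (le_of_eq ?_))
    · simp only [Set.mem_ofPred_eq] at hω ⊢
      rw [hmean, ← Finset.mul_sum]
      calc _ ≤ s / (128 * C) * (ε * ∑ t, (p * (inner ℝ (b i) (w t ω) * inner ℝ (b j) (w t ω)) -
            inner ℝ (b i) (b j))) / (4 * C) := by gcongr
        _ = _ := by
          simp only [hτ, hY, ← sub_div, ← Finset.sum_div]
          ring
    · congr 2
      simp only [Finset.sum_const, Finset.card_univ, Fintype.card_fin, nsmul_eq_mul, hτ, mul_pow,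
        hε2]
      field_simp
      ring
  have hsplit : ∀ ω, 1 / (n : ℝ) * ∑ t, p * (inner ℝ (b i) (w t ω) * inner ℝ (b j) (w t ω)) -
      inner ℝ (b i) (b j) = 1 / (n : ℝ) *
        ∑ t, (p * (inner ℝ (b i) (w t ω) * inner ℝ (b j) (w t ω)) - inner ℝ (b i) (b j)) := by
    intro ω
    rw [Finset.sum_sub_distrib]
    simp only [Finset.sum_const, Finset.card_univ, Fintype.card_fin, nsmul_eq_mul]
    field_simp
  refine (measure_mono (t := {ω | n * s ≤ 1 * ∑ t, (p * (inner ℝ (b i) (w t ω) *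
      inner ℝ (b j) (w t ω)) - inner ℝ (b i) (b j))} ∪ {ω | n * s ≤ (-1) * ∑ t,
      (p * (inner ℝ (b i) (w t ω) * inner ℝ (b j) (w t ω)) - inner ℝ (b i) (b j))})
      fun ω hω => ?_).trans ?_
  · simp only [Set.mem_ofPred_eq, Set.mem_union, hsplit] at hω ⊢
    set S := ∑ t, (p * (inner ℝ (b i) (w t ω) * inner ℝ (b j) (w t ω)) - inner ℝ (b i) (b j))
    rw [abs_mul, abs_of_nonneg (by positivity), one_div, inv_mul_eq_div, lt_div_iff₀ hn'] at hω
    rcases le_total 0 S with h | h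
    · left; rw [abs_of_nonneg h] at hω; linarith
    · right; rw [abs_of_nonpos h] at hω; linarith
  · refine (measure_union_le _ _).trans
      ((add_le_add (key 1 (by norm_num)) (key (-1) (by norm_num))).trans (le_of_eq ?_))
    rw [← ENNReal.ofReal_add (Real.exp_nonneg _) (Real.exp_nonneg _)]
    ring_nf

end Concentration

/-! ### The Huber location equation -/

section Huber

theorem huberPsi_mono (H : ℝ) : Monotone (huberPsi H) := fun x y hxy => by
  unfold huberPsi
  gcongr

theorem huberPsi_neg {H : ℝ} (hH : 0 ≤ H) (x : ℝ) : huberPsi H (-x) = -huberPsi H x := by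
  unfold huberPsi
  rcases le_total x H with h1 | h1 <;> rcases le_total (-H) x with h2 | h2
  · rw [max_eq_right (by linarith), min_eq_right (by linarith), max_eq_right h2, min_eq_right h1]
  · rw [max_eq_right (by linarith), min_eq_left (by linarith), max_eq_left h2,
      min_eq_right (by linarith)]
    ring
  · rw [max_eq_left (by linarith), min_eq_right (by linarith), max_eq_right h2, min_eq_left h1]
  · have : H = 0 := by linarith
    subst this
    have : x = 0 := by linarith
    simp [this]

theorem huberPsi_of_abs_le {H x : ℝ} (hx : |x| ≤ H) : huberPsi H x = x := by
  have := abs_le.1 hx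
  rw [huberPsi, max_eq_right this.1, min_eq_right this.2]

theorem abs_huberPsi_le {H : ℝ} (hH : 0 ≤ H) (x : ℝ) : |huberPsi H x| ≤ H := by
  rw [abs_le, huberPsi]
  exact ⟨le_min (by linarith) (le_max_left _ _), min_le_left _ _⟩

theorem abs_huberPsi_le_abs {H : ℝ} (hH : 0 ≤ H) (x : ℝ) : |huberPsi H x| ≤ |x| := by
  rcases le_total |x| H with h | h
  · rw [huberPsi_of_abs_le h]
  · exact (abs_huberPsi_le hH x).trans h

theorem continuous_huberPsi (H : ℝ) : Continuous (huberPsi H) := by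
  unfold huberPsi
  fun_prop

/-- The symmetrized drift of the Huber score. -/
theorem huberPsi_add_ge {H ρ : ℝ} (hρ : 0 ≤ ρ) (hρH : ρ < H) (z : ℝ) :
    2 * ρ * (1 - z ^ 2 / (H - ρ) ^ 2) ≤ huberPsi H (z + ρ) + huberPsi H (-z + ρ) := by
  have hd : 0 < H - ρ := by linarith
  rcases le_total |z| (H - ρ) with h | h
  · have := abs_le.1 h
    rw [huberPsi_of_abs_le (abs_le.2 ⟨by linarith, by linarith⟩),
      huberPsi_of_abs_le (abs_le.2 ⟨by linarith, by linarith⟩)]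
    have : 0 ≤ z ^ 2 / (H - ρ) ^ 2 := by positivity
    nlinarith
  · have h1 : 1 ≤ z ^ 2 / (H - ρ) ^ 2 := by
      rw [one_le_div (by positivity), ← sq_abs z]
      gcongr
    have h2 : huberPsi H (-(z + ρ)) ≤ huberPsi H (-z + ρ) := huberPsi_mono H (by linarith)
    rw [huberPsi_neg (by linarith)] at h2
    nlinarith

variable {p : ℕ}

/-- Exponential moment of one term of the Huber score: the drift comes from pairing `x` with `-x`,
the variance from `|huberPsi H z| ≤ |z|`. Only second moments enter. -/
theorem lintegral_exp_huberPsi_le (hp : 0 < p) (b : EuclideanSpace ℝ (Fin p)) (c : ℝ)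
    {H ρ τ : ℝ} (hρ : 0 ≤ ρ) (hρH : ρ < H) (hτ : 0 ≤ τ) (hτH : τ * H ≤ 1) :
    ∫⁻ x, ENNReal.ofReal (Real.exp (-(τ * huberPsi H (c * inner ℝ b x + ρ)))) ∂(sphereUniform p) ≤
      ENNReal.ofReal (Real.exp (-(τ * ρ * (1 - c ^ 2 * (‖b‖ ^ 2 / p) / (H - ρ) ^ 2)) +
        τ ^ 2 * (2 * (c ^ 2 * (‖b‖ ^ 2 / p)) + 2 * ρ ^ 2))) := by
  have hprob := isProbabilityMeasure_sphereUniform hp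
  have hH : 0 ≤ H := by linarith
  have hrot := isRotationInvariant_sphereUniform hp
  have hcont := continuous_huberPsi H
  have hi : ∀ {f : EuclideanSpace ℝ (Fin p) → ℝ}, Continuous f → Integrable f (sphereUniform p) :=
    fun hf => integrable_sphereUniform hp hf
  have hsq : ∫ x, (inner ℝ b x) ^ 2 ∂(sphereUniform p) = ‖b‖ ^ 2 / p := by
    simp_rw [sq]
    rw [integral_mul_sphereUniform hp, real_inner_self_eq_norm_mul_norm]
  have hmean : ρ * (1 - c ^ 2 * (‖b‖ ^ 2 / p) / (H - ρ) ^ 2) ≤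
      ∫ x, huberPsi H (c * inner ℝ b x + ρ) ∂(sphereUniform p) := by
    have hsymm : ∫ x, huberPsi H (c * inner ℝ b x + ρ) ∂(sphereUniform p) =
        ∫ x, huberPsi H (-(c * inner ℝ b x) + ρ) ∂(sphereUniform p) := by
      rw [hrot.integral_inner (b := -b) (by simp) (fun t => huberPsi H (c * t + ρ))]
      simp
    have h2 : ∫ x, 2 * ρ * (1 - (c * inner ℝ b x) ^ 2 / (H - ρ) ^ 2) ∂(sphereUniform p) ≤
        ∫ x, (huberPsi H (c * inner ℝ b x + ρ) + huberPsi H (-(c * inner ℝ b x) + ρ))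
          ∂(sphereUniform p) :=
      integral_mono (hi (by fun_prop)) (hi (by fun_prop)) fun x => huberPsi_add_ge hρ hρH _
    rw [integral_add (hi (by fun_prop)) (hi (by fun_prop)), ← hsymm, integral_const_mul,
      integral_sub (integrable_const _) (hi (by fun_prop)), integral_div] at h2
    simp_rw [mul_pow] at h2
    rw [integral_const_mul, hsq] at h2
    simp only [integral_const, probReal_univ, smul_eq_mul, mul_one] at h2
    linarith
  have hpt : ∀ x, Real.exp (-(τ * huberPsi H (c * inner ℝ b x + ρ))) ≤
      1 - τ * huberPsi H (c * inner ℝ b x + ρ) +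
        τ ^ 2 * (2 * (c ^ 2 * (inner ℝ b x) ^ 2) + 2 * ρ ^ 2) := by
    intro x
    set y := huberPsi H (c * inner ℝ b x + ρ)
    have h1 : |(-(τ * y))| ≤ 1 := by
      rw [abs_neg, abs_mul, abs_of_nonneg hτ]
      exact (mul_le_mul_of_nonneg_left (abs_huberPsi_le hH _) hτ).trans hτH
    have h2 : y ^ 2 ≤ 2 * (c ^ 2 * (inner ℝ b x) ^ 2) + 2 * ρ ^ 2 := by
      have : y ^ 2 ≤ (c * inner ℝ b x + ρ) ^ 2 := sq_le_sq.2 (abs_huberPsi_le_abs hH _)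
      nlinarith [sq_nonneg (c * inner ℝ b x - ρ)]
    have h3 := exp_le_one_add_add_sq h1
    nlinarith [mul_le_mul_of_nonneg_left h2 (sq_nonneg τ)]
  rw [← ofReal_integral_eq_lintegral_ofReal (hi (by fun_prop))
    (ae_of_all _ fun _ => Real.exp_nonneg _)]
  refine ENNReal.ofReal_le_ofReal ?_
  refine (integral_mono (hi (by fun_prop)) (hi (by fun_prop)) hpt).trans ?_
  rw [integral_add (hi (by fun_prop)) (hi (by fun_prop)),
    integral_sub (integrable_const _) (hi (by fun_prop)), integral_const_mul, integral_const_mul,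
    integral_add (hi (by fun_prop)) (integrable_const _), integral_const_mul, integral_const_mul,
    hsq]
  simp only [integral_const, probReal_univ, smul_eq_mul, mul_one]
  refine le_trans ?_ (Real.add_one_le_exp _)
  nlinarith [mul_le_mul_of_nonneg_left hmean hτ]

variable {Ω : Type*} [MeasurableSpace Ω] {P : Measure Ω} {n : ℕ}
  {w : Fin n → Ω → EuclideanSpace ℝ (Fin p)}

/-- With high probability the Huber score equation changes sign within `ρ` of the true centre,
uniformly over `d` coordinates. -/
theorem measure_huber_sign_le (hp : 0 < p) (hm : ∀ t, Measurable (w t))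
    (hw : ∀ t, P.map (w t) = sphereUniform p) (hind : iIndepFun w P) {d : ℕ}
    {b : Fin d → EuclideanSpace ℝ (Fin p)} {C M H ρ τ : ℝ} (hC : 0 ≤ C)
    (hb : ∀ i, ‖b i‖ ^ 2 ≤ C) (ξ : Fin n → ℝ) (hξ : ∑ t, ξ t ^ 2 ≤ n * M)
    (hρ : 0 ≤ ρ) (hρH : ρ < H) (hτ : 0 ≤ τ) (hτH : τ * H ≤ 1)
    (hHbig : 2 * (C * M) ≤ (H - ρ) ^ 2) :
    P {ω | ∃ i, ∑ t, huberPsi H (ξ t * (√p * inner ℝ (b i) (w t ω)) + ρ) ≤ 0 ∨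
        0 ≤ ∑ t, huberPsi H (ξ t * (√p * inner ℝ (b i) (w t ω)) - ρ)} ≤
      ENNReal.ofReal (d * (2 * Real.exp
        (n * (-(τ * ρ / 2) + τ ^ 2 * (2 * (C * M) + 2 * ρ ^ 2))))) := by
  have hH : 0 ≤ H := by linarith
  have hcont := continuous_huberPsi H
  have hp' : (0 : ℝ) < p := by positivity
  have key : ∀ v : EuclideanSpace ℝ (Fin p), ‖v‖ ^ 2 ≤ C →
      P {ω | 0 ≤ ∑ t, -(τ * huberPsi H (ξ t * √p * inner ℝ v (w t ω) + ρ))} ≤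
        ENNReal.ofReal (Real.exp (n * (-(τ * ρ / 2) + τ ^ 2 * (2 * (C * M) + 2 * ρ ^ 2)))) := by
    intro v hv
    refine (measure_sum_ge_le (P := P)
      (X := fun t ω => -(τ * huberPsi H (ξ t * √p * inner ℝ v (w t ω) + ρ)))
      (hind.comp (fun t x => -(τ * huberPsi H (ξ t * √p * inner ℝ v x + ρ)))
        fun _ => (Continuous.measurable (by fun_prop)))
      (fun t => (Continuous.measurable (by fun_prop :
        Continuous fun x => -(τ * huberPsi H (ξ t * √p * inner ℝ v x + ρ)))).comp (hm t))
      (b := fun t => -(τ * ρ * (1 - (ξ t * √p) ^ 2 * (‖v‖ ^ 2 / p) / (H - ρ) ^ 2)) +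
        τ ^ 2 * (2 * ((ξ t * √p) ^ 2 * (‖v‖ ^ 2 / p)) + 2 * ρ ^ 2))
      (fun t => ?_) 0).trans (ENNReal.ofReal_le_ofReal (Real.exp_le_exp.2 ?_))
    · have := lintegral_exp_huberPsi_le hp v (ξ t * √p) hρ hρH hτ hτH
      rwa [← hw t, lintegral_map ((Continuous.measurable (by fun_prop :
        Continuous fun x => Real.exp (-(τ * huberPsi H (ξ t * √p * inner ℝ v x + ρ))))).ennreal_ofReal)
        (hm t)] at this
    · have e : ∀ t, (ξ t * √p) ^ 2 * (‖v‖ ^ 2 / p) = ξ t ^ 2 * ‖v‖ ^ 2 := fun t => by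
        rw [mul_pow, Real.sq_sqrt hp'.le]
        field_simp
      have hV : ∑ t, ξ t ^ 2 * ‖v‖ ^ 2 ≤ n * (C * M) := by
        rw [← Finset.sum_mul]
        have h0 : 0 ≤ ∑ t, ξ t ^ 2 := Finset.sum_nonneg fun t _ => sq_nonneg _
        calc _ ≤ (∑ t, ξ t ^ 2) * C := mul_le_mul_of_nonneg_left hv h0
          _ ≤ (n * M) * C := mul_le_mul_of_nonneg_right hξ hC
          _ = _ := by ring
      have hd : 0 < (H - ρ) ^ 2 := by
        have : 0 < H - ρ := by linarith
        positivity
      have hfrac : (∑ t, ξ t ^ 2 * ‖v‖ ^ 2) / (H - ρ) ^ 2 ≤ n / 2 := by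
        rw [div_le_iff₀ hd]
        have : (0 : ℝ) ≤ n := n.cast_nonneg
        nlinarith
      simp_rw [e]
      have hs : ∑ t : Fin n, (-(τ * ρ * (1 - ξ t ^ 2 * ‖v‖ ^ 2 / (H - ρ) ^ 2)) +
          τ ^ 2 * (2 * (ξ t ^ 2 * ‖v‖ ^ 2) + 2 * ρ ^ 2)) =
          -(τ * ρ * (n - (∑ t, ξ t ^ 2 * ‖v‖ ^ 2) / (H - ρ) ^ 2)) +
            τ ^ 2 * (2 * (∑ t, ξ t ^ 2 * ‖v‖ ^ 2) + n * (2 * ρ ^ 2)) := by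
        rw [Finset.sum_add_distrib, Finset.sum_neg_distrib, ← Finset.mul_sum, ← Finset.mul_sum,
          Finset.sum_sub_distrib, Finset.sum_add_distrib, ← Finset.mul_sum, Finset.sum_div]
        simp
      rw [hs]
      have h1 := mul_le_mul_of_nonneg_left hV (sq_nonneg τ)
      have h2 := mul_le_mul_of_nonneg_left hfrac (mul_nonneg hτ hρ)
      linarith
  refine (measure_exists_le (c := 2 * Real.exp
    (n * (-(τ * ρ / 2) + τ ^ 2 * (2 * (C * M) + 2 * ρ ^ 2)))) fun i => ?_).trans (by simp)
  refine (measure_mono (t := {ω | 0 ≤ ∑ t, -(τ * huberPsi H (ξ t * √p * inner ℝ (b i) (w t ω) + ρ))} ∪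
    {ω | 0 ≤ ∑ t, -(τ * huberPsi H (ξ t * √p * inner ℝ (-b i) (w t ω) + ρ))})
    fun ω hω => ?_).trans ?_
  · simp only [Set.mem_ofPred_eq, Set.mem_union, Finset.sum_neg_distrib, ← Finset.mul_sum] at hω ⊢
    rcases hω with h | h
    · left
      simp_rw [← mul_assoc] at h
      nlinarith
    · right
      have e : ∀ t, huberPsi H (ξ t * √p * inner ℝ (-b i) (w t ω) + ρ) =
          -huberPsi H (ξ t * (√p * inner ℝ (b i) (w t ω)) - ρ) := fun t => by
        rw [← huberPsi_neg hH, inner_neg_left]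
        ring_nf
      simp_rw [e, Finset.sum_neg_distrib]
      nlinarith
  · refine (measure_union_le _ _).trans
      ((add_le_add (key _ (hb i)) (key _ (by simpa using hb i))).trans (le_of_eq ?_))
    rw [← ENNReal.ofReal_add (Real.exp_nonneg _) (Real.exp_nonneg _)]
    ring_nf

end Huber

/-! ### Spatial Kendall's tau in the population eigenbasis -/

section KendallKernel

variable {p : ℕ}

/-- The kernel `e eᵀ / ‖e‖²` of spatial Kendall's tau at `e = Λ^{1/2} v`, where
`Λ = diag(lam)`. It vanishes at `v = 0`. -/
noncomputable def shapeKernel (lam : Fin p → ℝ) (v : EuclideanSpace ℝ (Fin p)) (k l : Fin p) : ℝ :=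
  √(lam k) * v k * (√(lam l) * v l) / ∑ i, lam i * v i ^ 2

theorem measurable_shapeKernel (lam : Fin p → ℝ) (k l : Fin p) :
    Measurable fun v => shapeKernel lam v k l := by
  unfold shapeKernel
  fun_prop

theorem shapeKernel_zero (lam : Fin p → ℝ) (k l : Fin p) : shapeKernel lam 0 k l = 0 := by
  simp [shapeKernel]

theorem shapeKernel_smul (lam : Fin p → ℝ) (v : EuclideanSpace ℝ (Fin p)) (k l : Fin p) {c : ℝ}
    (hc : c ≠ 0) : shapeKernel lam (c • v) k l = shapeKernel lam v k l := by
  have e : ∑ i, lam i * (c • v) i ^ 2 = c ^ 2 * ∑ i, lam i * v i ^ 2 := by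
    rw [Finset.mul_sum]
    refine Finset.sum_congr rfl fun i _ => ?_
    simp only [PiLp.smul_apply, smul_eq_mul]
    ring
  unfold shapeKernel
  rw [e]
  simp only [PiLp.smul_apply, smul_eq_mul]
  rw [show √(lam k) * (c * v k) * (√(lam l) * (c * v l)) =
    c ^ 2 * (√(lam k) * v k * (√(lam l) * v l)) by ring]
  exact mul_div_mul_left _ _ (pow_ne_zero 2 hc)

theorem shapeKernel_normalize (lam : Fin p → ℝ) (v : EuclideanSpace ℝ (Fin p)) (k l : Fin p) :
    shapeKernel lam (‖v‖⁻¹ • v) k l = shapeKernel lam v k l := by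
  by_cases hv : v = 0
  · simp [hv]
  · exact shapeKernel_smul lam v k l (inv_ne_zero (norm_ne_zero_iff.2 hv))

theorem shapeKernel_diag {lam : Fin p → ℝ} (h0 : ∀ i, 0 ≤ lam i) (v : EuclideanSpace ℝ (Fin p))
    (k : Fin p) : shapeKernel lam v k k = lam k * v k ^ 2 / ∑ i, lam i * v i ^ 2 := by
  unfold shapeKernel
  rw [show √(lam k) * v k * (√(lam k) * v k) = √(lam k) ^ 2 * v k ^ 2 by ring,
    Real.sq_sqrt (h0 k)]

theorem sum_shapeKernel_sq_le {lam : Fin p → ℝ} (h0 : ∀ i, 0 ≤ lam i)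
    (v : EuclideanSpace ℝ (Fin p)) : ∑ kl : Fin p × Fin p, shapeKernel lam v kl.1 kl.2 ^ 2 ≤ 1 := by
  have e : ∀ k, (√(lam k) * v k) ^ 2 = lam k * v k ^ 2 := fun k => by
    rw [mul_pow, Real.sq_sqrt (h0 k)]
  have : ∑ kl : Fin p × Fin p, shapeKernel lam v kl.1 kl.2 ^ 2 =
      (∑ i, lam i * v i ^ 2) ^ 2 / (∑ i, lam i * v i ^ 2) ^ 2 := by
    rw [Fintype.sum_prod_type]
    unfold shapeKernel
    simp_rw [div_pow, mul_pow (_ * _) (_ * _), e, ← Finset.sum_div, ← Finset.sum_mul_sum]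
    rw [sq (∑ i, lam i * v i ^ 2)]
  rw [this]
  exact div_self_le_one _

theorem abs_shapeKernel_le {lam : Fin p → ℝ} (h0 : ∀ i, 0 ≤ lam i)
    (v : EuclideanSpace ℝ (Fin p)) (k l : Fin p) : |shapeKernel lam v k l| ≤ 1 := by
  rw [← sq_le_one_iff_abs_le_one]
  exact (Finset.single_le_sum (f := fun kl : Fin p × Fin p => shapeKernel lam v kl.1 kl.2 ^ 2)
    (fun _ _ => sq_nonneg _) (Finset.mem_univ (k, l))).trans (sum_shapeKernel_sq_le h0 v)

/-- The off-diagonal entries of the kernel are odd under flipping a coordinate. -/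
theorem shapeKernel_coordFlip (lam : Fin p → ℝ) (v : EuclideanSpace ℝ (Fin p)) {k l : Fin p}
    (hkl : k ≠ l) : shapeKernel lam (coordFlip k v) k l = -shapeKernel lam v k l := by
  have e : ∑ i, lam i * (coordFlip k v) i ^ 2 = ∑ i, lam i * v i ^ 2 := by
    refine Finset.sum_congr rfl fun i _ => ?_
    rw [coordFlip_apply]
    split_ifs <;> ring
  unfold shapeKernel
  rw [e, coordFlip_apply, coordFlip_apply, if_pos rfl, if_neg hkl.symm]
  ring

variable {ν : Measure (EuclideanSpace ℝ (Fin p))} [IsProbabilityMeasure ν]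

theorem integrable_shapeKernel {lam : Fin p → ℝ} (h0 : ∀ i, 0 ≤ lam i) (k l : Fin p) :
    Integrable (fun v => shapeKernel lam v k l) ν :=
  Integrable.of_bound (measurable_shapeKernel lam k l).aestronglyMeasurable 1
    (ae_of_all _ fun v => abs_shapeKernel_le h0 v k l)

omit [IsProbabilityMeasure ν] in
theorem integral_shapeKernel_offDiag (hν : IsRotationInvariant ν) (lam : Fin p → ℝ) {k l : Fin p}
    (hkl : k ≠ l) : ∫ v, shapeKernel lam v k l ∂ν = 0 := by
  have h := hν.integral_comp (coordFlip k) fun v => shapeKernel lam v k l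
  simp_rw [shapeKernel_coordFlip lam _ hkl, integral_neg] at h
  linarith

omit [IsProbabilityMeasure ν] in
theorem ae_norm_le_one_of_eq (h1 : ∀ᵐ v ∂ν, ‖v‖ = 1 ∨ v = 0) : ∀ᵐ v ∂ν, ‖v‖ ≤ 1 := by
  filter_upwards [h1] with v hv
  rcases hv with h | h
  · exact h.le
  · simp [h]

/-- A trailing entry of the mean kernel is `O(1 / p)`, since the denominator is at least `δ ‖v‖²`. -/
theorem integral_shapeKernel_le (hν : IsRotationInvariant ν) (h1 : ∀ᵐ v ∂ν, ‖v‖ = 1 ∨ v = 0)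
    {lam : Fin p → ℝ} {δ : ℝ} (hδ : 0 < δ) (hlow : ∀ i, δ ≤ lam i) {j : Fin p}
    (hj : lam j ≤ 1 / δ) : ∫ v, shapeKernel lam v j j ∂ν ≤ 1 / (δ ^ 2 * p) := by
  have hp : 0 < p := j.pos
  have hp' : (0 : ℝ) < p := by exact_mod_cast hp
  have h0 : ∀ i, 0 ≤ lam i := fun i => hδ.le.trans (hlow i)
  have hle := ae_norm_le_one_of_eq h1
  have hsq := hν.integral_sq hle hp (EuclideanSpace.single j 1)
  simp only [inner_single, one_mul] at hsq
  have hmass : ∫ v, ‖v‖ ^ 2 ∂ν ≤ 1 := by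
    calc _ ≤ ∫ _v, (1 : ℝ) ∂ν := integral_mono_ae
          (integrable_of_ae_norm_le_one hle (by fun_prop)) (integrable_const _) (by
            filter_upwards [hle] with x hx
            exact pow_le_one₀ (norm_nonneg _) hx)
      _ = 1 := by simp
  calc _ ≤ ∫ v, 1 / δ ^ 2 * (v j) ^ 2 ∂ν := by
        refine integral_mono_ae (integrable_shapeKernel h0 j j)
          (integrable_of_ae_norm_le_one hle (by fun_prop)) ?_
        filter_upwards [h1] with v hv
        rcases hv with hv | hv
        · rw [shapeKernel_diag h0]
          have hD : δ ≤ ∑ i, lam i * v i ^ 2 := by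
            have : ∑ i, δ * v i ^ 2 = δ := by
              rw [← Finset.mul_sum]
              have := EuclideanSpace.norm_sq_eq v
              simp only [Real.norm_eq_abs, sq_abs] at this
              rw [← this, hv]; ring
            rw [← this]
            exact Finset.sum_le_sum fun i _ => mul_le_mul_of_nonneg_right (hlow i) (sq_nonneg _)
          calc _ ≤ (1 / δ * v j ^ 2) / δ :=
                div_le_div₀ (by positivity) (mul_le_mul_of_nonneg_right hj (sq_nonneg _)) hδ hD
            _ = _ := by field_simp
        · simp [hv, shapeKernel_zero]
    _ = 1 / δ ^ 2 * ((∫ v, ‖v‖ ^ 2 ∂ν) / p) := by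
        rw [integral_const_mul, hsq]
        simp
    _ ≤ 1 / δ ^ 2 * (1 / p) := by gcongr
    _ = _ := by field_simp

/-- A leading population eigenvalue of Kendall's tau is bounded away from zero:
`1 / D ≥ 2 τ - τ² D` turns the expectation of a ratio into second and fourth moments. -/
theorem le_integral_shapeKernel (hν : IsRotationInvariant ν) (h1 : ∀ᵐ v ∂ν, ‖v‖ = 1 ∨ v = 0)
    (hmass : 1 / 2 ≤ ∫ v, ‖v‖ ^ 2 ∂ν)
    {lam : Fin p → ℝ} {δ : ℝ} (hδ : 0 < δ) (hlow : ∀ i, 0 ≤ lam i) (hsum : ∑ i, lam i = p)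
    {k : Fin p} (hk : δ * p ≤ lam k) (hk' : lam k ≤ p / δ) :
    δ ^ 3 / 12 ≤ ∫ v, shapeKernel lam v k k ∂ν := by
  have hp : 0 < p := k.pos
  have hp' : (0 : ℝ) < p := by exact_mod_cast hp
  have hle := ae_norm_le_one_of_eq h1
  have hsq := hν.integral_sq hle hp (EuclideanSpace.single k 1)
  simp only [inner_single, one_mul] at hsq
  set τ : ℝ := δ ^ 2 / 6 with hτ
  have hA : δ / 2 ≤ ∫ v, lam k * (v k) ^ 2 ∂ν := by
    rw [integral_const_mul, hsq]
    simp only [PiLp.norm_single, norm_one, one_pow, one_mul]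
    calc δ / 2 = (δ * p) * ((1 / 2) / p) := by field_simp
      _ ≤ _ := by gcongr; exact (by positivity : 0 ≤ δ * p).trans hk
  have hAD : ∫ v, lam k * (v k) ^ 2 * ∑ i, lam i * v i ^ 2 ∂ν ≤ 3 / δ := by
    have e : ∀ v : EuclideanSpace ℝ (Fin p), lam k * (v k) ^ 2 * ∑ i, lam i * v i ^ 2 =
        ∑ i, lam k * lam i * ((v k) ^ 2 * (v i) ^ 2) := fun v => by
      rw [Finset.mul_sum]
      exact Finset.sum_congr rfl fun i _ => by ring
    simp_rw [e]
    rw [integral_finsetSum _ fun i _ => integrable_of_ae_norm_le_one hle (by fun_prop)]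
    simp_rw [integral_const_mul]
    calc _ ≤ ∑ i, lam k * lam i * (3 / p ^ 2) := by
          refine Finset.sum_le_sum fun i _ => ?_
          exact mul_le_mul_of_nonneg_left (hν.integral_sq_mul_sq_le hle k i)
            (mul_nonneg (hlow k) (hlow i))
      _ = lam k * p * (3 / p ^ 2) := by rw [← Finset.sum_mul, ← Finset.mul_sum, hsum]
      _ ≤ (p / δ) * p * (3 / p ^ 2) := by gcongr
      _ = _ := by field_simp
  calc δ ^ 3 / 12 = 2 * τ * (δ / 2) - τ ^ 2 * (3 / δ) := by rw [hτ]; field_simp; ring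
    _ ≤ 2 * τ * (∫ v, lam k * (v k) ^ 2 ∂ν) -
        τ ^ 2 * ∫ v, lam k * (v k) ^ 2 * ∑ i, lam i * v i ^ 2 ∂ν := by
        gcongr
    _ = ∫ v, (2 * τ * (lam k * (v k) ^ 2) -
        τ ^ 2 * (lam k * (v k) ^ 2 * ∑ i, lam i * v i ^ 2)) ∂ν := by
        rw [integral_sub (integrable_of_ae_norm_le_one hle (by fun_prop))
          (integrable_of_ae_norm_le_one hle (by fun_prop)), integral_const_mul (2 * τ),
          integral_const_mul (τ ^ 2)]
    _ ≤ _ := by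
        refine integral_mono (integrable_of_ae_norm_le_one hle (by fun_prop))
          (integrable_shapeKernel hlow k k) fun v => ?_
        simp only [shapeKernel_diag hlow]
        set D := ∑ i, lam i * v i ^ 2
        have hA0 : 0 ≤ lam k * v k ^ 2 := mul_nonneg (hlow k) (sq_nonneg _)
        have hAle : lam k * v k ^ 2 ≤ D := Finset.single_le_sum
          (f := fun i => lam i * v i ^ 2) (fun i _ => mul_nonneg (hlow i) (sq_nonneg _))
          (Finset.mem_univ k)
        rcases (hA0.trans hAle).eq_or_lt with hD | hD
        · have : lam k * v k ^ 2 = 0 := le_antisymm (hAle.trans hD.symm.le) hA0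
          simp [this]
        · rw [le_div_iff₀ hD]
          nlinarith [mul_nonneg hA0 (sq_nonneg (1 - τ * D))]

end KendallKernel

section UStatistic

variable {Ω : Type*} [MeasurableSpace Ω] {P : Measure Ω} [IsProbabilityMeasure P] {n : ℕ}

/-- Variance of a bounded vector-valued second-order U-statistic: only pairs of index pairs that
overlap contribute, and there are at most `4 n³` of them. -/
theorem integral_sum_centred_sq_le {κ : Type*} [Fintype κ] {X : κ → Fin n × Fin n → Ω → ℝ}
    (hm : ∀ c a, Measurable (X c a)) (hb : ∀ c a ω, |X c a ω| ≤ 1)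
    (hsum : ∀ a ω, ∑ c, X c a ω ^ 2 ≤ 1)
    (hind : ∀ a b : Fin n × Fin n, a.1 ≠ b.1 → a.1 ≠ b.2 → a.2 ≠ b.1 → a.2 ≠ b.2 → ∀ c,
      IndepFun (X c a) (X c b) P) :
    ∫ ω, ∑ c, (∑ a, X c a ω - ∫ ω, ∑ a, X c a ω ∂P) ^ 2 ∂P ≤ 4 * n ^ 3 := by
  have hXi : ∀ c a, Integrable (X c a) P := fun c a =>
    Integrable.of_bound (hm c a).aestronglyMeasurable 1 (ae_of_all _ fun ω => hb c a ω)
  set m : κ → Fin n × Fin n → ℝ := fun c a => ∫ ω, X c a ω ∂P with hmdef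
  have hmb : ∀ c a, |m c a| ≤ 1 := fun c a => by
    calc |m c a| ≤ ∫ ω, |X c a ω| ∂P := abs_integral_le_integral_abs
      _ ≤ ∫ _ω, (1 : ℝ) ∂P := integral_mono (hXi c a).abs (integrable_const _) (hb c a)
      _ = 1 := by simp
  set Y : κ → Fin n × Fin n → Ω → ℝ := fun c a ω => X c a ω - m c a with hY
  have hYb : ∀ c a ω, |Y c a ω| ≤ 2 := fun c a ω =>
    (abs_sub _ _).trans (by linarith [hb c a ω, hmb c a])
  have hYm : ∀ c a, Measurable (Y c a) := fun c a => (hm c a).sub_const _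
  have hYY : ∀ c a b, Integrable (fun ω => Y c a ω * Y c b ω) P := fun c a b => by
    refine Integrable.of_bound ((hYm c a).mul (hYm c b)).aestronglyMeasurable 4
      (ae_of_all _ fun ω => ?_)
    rw [Real.norm_eq_abs, abs_mul]
    nlinarith [hYb c a ω, hYb c b ω, abs_nonneg (Y c a ω), abs_nonneg (Y c b ω)]
  have hY0 : ∀ c a, ∫ ω, Y c a ω ∂P = 0 := fun c a => by
    simp only [hY]
    rw [integral_sub (hXi c a) (integrable_const _)]
    simp [hmdef]
  have hvar : ∀ a, ∑ c, ∫ ω, Y c a ω * Y c a ω ∂P ≤ 1 := fun a => by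
    have : ∀ c, ∫ ω, Y c a ω * Y c a ω ∂P ≤ ∫ ω, X c a ω ^ 2 ∂P := fun c => by
      have hX2 : Integrable (fun ω => X c a ω ^ 2) P :=
        Integrable.of_bound ((hm c a).pow_const 2).aestronglyMeasurable 1
          (ae_of_all _ fun ω => by
            rw [Real.norm_eq_abs, abs_pow]
            exact pow_le_one₀ (abs_nonneg _) (hb c a ω))
      have : ∀ ω, Y c a ω * Y c a ω = X c a ω ^ 2 - 2 * m c a * Y c a ω - m c a ^ 2 := fun ω => by
        simp only [hY]; ring
      simp_rw [this]
      have hYi : Integrable (Y c a) P := (hXi c a).sub (integrable_const _)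
      have hi : Integrable (fun ω => X c a ω ^ 2 - 2 * m c a * Y c a ω) P :=
        hX2.sub (hYi.const_mul _)
      rw [integral_sub hi (integrable_const _),
        integral_sub hX2 (hYi.const_mul _), integral_const_mul, hY0]
      simp only [mul_zero, sub_zero, integral_const, probReal_univ, smul_eq_mul, one_mul]
      linarith [sq_nonneg (m c a)]
    refine (Finset.sum_le_sum fun c _ => this c).trans ?_
    rw [← integral_finsetSum _ fun c _ => Integrable.of_bound
      ((hm c a).pow_const 2).aestronglyMeasurable 1 (ae_of_all _ fun ω => by
        rw [Real.norm_eq_abs, abs_pow]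
        exact pow_le_one₀ (abs_nonneg _) (hb c a ω))]
    calc _ ≤ ∫ _ω, (1 : ℝ) ∂P := by
          refine integral_mono_of_nonneg (ae_of_all _ fun ω => Finset.sum_nonneg fun _ _ =>
            sq_nonneg _) (integrable_const _) (ae_of_all _ fun ω => hsum a ω)
      _ = 1 := by simp
  let I : Fin n → Fin n → ℝ := fun i j => if i = j then 1 else 0
  have hcov : ∀ a b : Fin n × Fin n, ∑ c, ∫ ω, Y c a ω * Y c b ω ∂P ≤
      I a.1 b.1 + I a.1 b.2 + I a.2 b.1 + I a.2 b.2 := by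
    intro a b
    by_cases hd : a.1 ≠ b.1 ∧ a.1 ≠ b.2 ∧ a.2 ≠ b.1 ∧ a.2 ≠ b.2
    · obtain ⟨h1, h2, h3, h4⟩ := hd
      have : ∀ c, ∫ ω, Y c a ω * Y c b ω ∂P = 0 := fun c => by
        have hi : IndepFun (Y c a) (Y c b) P :=
          (hind a b h1 h2 h3 h4 c).comp (measurable_id.sub_const (m c a))
            (measurable_id.sub_const (m c b))
        rw [hi.integral_fun_mul_eq_mul_integral (hYm c a).aestronglyMeasurable
          (hYm c b).aestronglyMeasurable, hY0, zero_mul]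
      simp [this, h1, h2, h3, h4, I]
    · have h1 : ∑ c, ∫ ω, Y c a ω * Y c b ω ∂P ≤ 1 := by
        have : ∀ c, ∫ ω, Y c a ω * Y c b ω ∂P ≤
            (∫ ω, Y c a ω * Y c a ω ∂P) / 2 + (∫ ω, Y c b ω * Y c b ω ∂P) / 2 := fun c => by
          rw [← integral_div, ← integral_div, ← integral_add ((hYY c a a).div_const _)
            ((hYY c b b).div_const _)]
          refine integral_mono (hYY c a b) (((hYY c a a).div_const _).add
            ((hYY c b b).div_const _)) fun ω => ?_
          simp only
          nlinarith [sq_nonneg (Y c a ω - Y c b ω)]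
        refine (Finset.sum_le_sum fun c _ => this c).trans ?_
        rw [Finset.sum_add_distrib, ← Finset.sum_div, ← Finset.sum_div]
        linarith [hvar a, hvar b]
      refine h1.trans ?_
      have h0 : ∀ i j, 0 ≤ I i j := fun i j => by
        simp only [I]
        split_ifs <;> norm_num
      have hI : ∀ {i j}, i = j → I i j = 1 := fun h => if_pos h
      have e1 := h0 a.1 b.1
      have e2 := h0 a.1 b.2
      have e3 := h0 a.2 b.1
      have e4 := h0 a.2 b.2
      by_cases q1 : a.1 = b.1
      · linarith [hI q1]
      by_cases q2 : a.1 = b.2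
      · linarith [hI q2]
      by_cases q3 : a.2 = b.1
      · linarith [hI q3]
      by_cases q4 : a.2 = b.2
      · linarith [hI q4]
      exact absurd ⟨q1, q2, q3, q4⟩ hd
  have hexp : ∀ ω, ∑ c, (∑ a, X c a ω - ∫ ω, ∑ a, X c a ω ∂P) ^ 2 =
      ∑ c, ∑ a, ∑ b, Y c a ω * Y c b ω := fun ω => by
    refine Finset.sum_congr rfl fun c _ => ?_
    rw [integral_finsetSum _ fun a _ => hXi c a, ← Finset.sum_sub_distrib, sq, Finset.sum_mul_sum]
  simp_rw [hexp]
  rw [integral_finsetSum _ fun c _ => integrable_finsetSum _ fun a _ =>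
    integrable_finsetSum _ fun b _ => hYY c a b]
  have : ∀ c, ∫ ω, ∑ a, ∑ b, Y c a ω * Y c b ω ∂P = ∑ a, ∑ b, ∫ ω, Y c a ω * Y c b ω ∂P := fun c => by
    rw [integral_finsetSum _ fun a _ => integrable_finsetSum _ fun b _ => hYY c a b]
    exact Finset.sum_congr rfl fun a _ => integral_finsetSum _ fun b _ => hYY c a b
  simp_rw [this]
  rw [Finset.sum_comm]
  have : ∀ a, ∑ c, ∑ b, ∫ ω, Y c a ω * Y c b ω ∂P = ∑ b, ∑ c, ∫ ω, Y c a ω * Y c b ω ∂P :=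
    fun a => Finset.sum_comm
  simp_rw [this]
  refine (Finset.sum_le_sum fun a _ => Finset.sum_le_sum fun b _ => hcov a b).trans (le_of_eq ?_)
  simp_rw [Finset.sum_add_distrib, Fintype.sum_prod_type]
  have hcard : ∀ f : Fin n → ℝ, ∑ x, ∑ _y : Fin n, f x = n * ∑ x, f x := fun f => by
    simp [Finset.mul_sum]
  simp_rw [hcard]
  simp [I]
  ring

end UStatistic

/-! ### Concentration of spatial Kendall's tau -/

theorem measure_gt_le_of_integral_le {Ω : Type*} [MeasurableSpace Ω] {P : Measure Ω}
    [IsFiniteMeasure P] {f : Ω → ℝ} (hf : Integrable f P) (h0 : ∀ᵐ ω ∂P, 0 ≤ f ω) {A c : ℝ}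
    (hc : 0 < c) (hA : ∫ ω, f ω ∂P ≤ A) : P {ω | c < f ω} ≤ ENNReal.ofReal (A / c) := by
  have h := (mul_meas_ge_le_integral_of_nonneg h0 hf c).trans hA
  refine (measure_mono fun ω hω => ?_ : _ ≤ P {ω | c ≤ f ω}).trans ?_
  · simp only [Set.mem_ofPred_eq] at hω ⊢
    exact hω.le
  · rw [← ofReal_measureReal]
    refine ENNReal.ofReal_le_ofReal ?_
    rw [le_div_iff₀ hc]
    linarith

section KendallSum

variable {n p : ℕ}

/-- The normalized difference of two directions with weights `α` and `β`. -/
noncomputable def pairDirection (α β : ℝ)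
    (z : EuclideanSpace ℝ (Fin p) × EuclideanSpace ℝ (Fin p)) : EuclideanSpace ℝ (Fin p) :=
  ‖α • z.1 - β • z.2‖⁻¹ • (α • z.1 - β • z.2)

theorem measurable_pairDirection (α β : ℝ) : Measurable (pairDirection (p := p) α β) := by
  unfold pairDirection
  fun_prop

theorem isRotationInvariant_pairDirection (hp : 0 < p) (α β : ℝ) :
    IsRotationInvariant (((sphereUniform p).prod (sphereUniform p)).map (pairDirection α β)) := by
  have := isProbabilityMeasure_sphereUniform hp
  intro O
  have hO : Measurable O := O.continuous.measurable
  rw [Measure.map_map hO (measurable_pairDirection α β)]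
  conv_rhs => rw [← map_sphereUniform hp O, Measure.map_prod_map _ _ hO hO,
    Measure.map_map (measurable_pairDirection α β) (hO.prodMap hO)]
  congr 1
  funext z
  simp only [Function.comp_apply, pairDirection, Prod.map, ← map_smul, ← map_sub, O.norm_map]

theorem norm_pairDirection (α β : ℝ)
    (z : EuclideanSpace ℝ (Fin p) × EuclideanSpace ℝ (Fin p)) :
    ‖pairDirection α β z‖ = 1 ∨ pairDirection α β z = 0 := by
  by_cases h : α • z.1 - β • z.2 = 0
  · right
    simp [pairDirection, h]
  · left
    rw [pairDirection, norm_smul, norm_inv, norm_norm, inv_mul_cancel₀ (norm_ne_zero_iff.2 h)]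

theorem ae_norm_pairDirection (α β : ℝ) :
    ∀ᵐ v ∂(((sphereUniform p).prod (sphereUniform p)).map (pairDirection α β)),
      ‖v‖ = 1 ∨ v = 0 := by
  rw [ae_map_iff (measurable_pairDirection α β).aemeasurable]
  · exact ae_of_all _ (norm_pairDirection α β)
  · exact (measurableSet_eq_fun measurable_norm measurable_const).union (measurableSet_singleton 0)

/-- Replacing the second direction by its opposite shows that the two weighted directions cancel
with probability at most one half. -/
theorem half_le_integral_pairDirection (hp : 0 < p) {α : ℝ} (hα : 0 < α) (β : ℝ) :
    1 / 2 ≤ ∫ v, ‖v‖ ^ 2 ∂(((sphereUniform p).prod (sphereUniform p)).map (pairDirection α β)) := by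
  have := isProbabilityMeasure_sphereUniform hp
  set σ := sphereUniform p with hσ
  rw [integral_map (measurable_pairDirection α β).aemeasurable (by fun_prop)]
  have hmeas := measurable_pairDirection (p := p) α β
  have hb : ∀ z, ‖pairDirection (p := p) α β z‖ ^ 2 ≤ 1 := fun z => by
    rcases norm_pairDirection α β z with h | h <;> simp [h]
  have hi : Integrable (fun z => ‖pairDirection α β z‖ ^ 2) (σ.prod σ) :=
    Integrable.of_bound (by fun_prop) 1 (ae_of_all _ fun z => by
      rw [Real.norm_eq_abs, abs_of_nonneg (by positivity)]
      exact hb z)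
  have hneg : (σ.prod σ).map (Prod.map id (LinearIsometryEquiv.neg ℝ)) = σ.prod σ := by
    rw [← Measure.map_prod_map _ _ measurable_id
      (LinearIsometryEquiv.neg ℝ (E := EuclideanSpace ℝ (Fin p))).continuous.measurable,
      Measure.map_id, map_sphereUniform hp]
  have hmeasN : Measurable (Prod.map id (LinearIsometryEquiv.neg ℝ) :
      EuclideanSpace ℝ (Fin p) × EuclideanSpace ℝ (Fin p) → _) :=
    measurable_id.prodMap (LinearIsometryEquiv.neg ℝ (E := EuclideanSpace ℝ (Fin p))).continuous.measurable
  have hsymm : ∫ z, ‖pairDirection α β z‖ ^ 2 ∂(σ.prod σ) =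
      ∫ z, ‖pairDirection α β (Prod.map id (LinearIsometryEquiv.neg ℝ) z)‖ ^ 2 ∂(σ.prod σ) := by
    conv_lhs => rw [← hneg]
    rw [integral_map hmeasN.aemeasurable (by fun_prop)]
  have hi2 : Integrable (fun z => ‖pairDirection α β
      (Prod.map id (LinearIsometryEquiv.neg ℝ) z)‖ ^ 2) (σ.prod σ) :=
    Integrable.of_bound ((hmeas.comp hmeasN).norm.pow_const 2).aestronglyMeasurable 1
      (ae_of_all _ fun z => by
        rw [Real.norm_eq_abs, abs_of_nonneg (by positivity)]
        exact hb _)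
  have hne : ∀ᵐ z ∂(σ.prod σ), z.1 ≠ 0 := by
    have h1 : ∀ᵐ x ∂σ, x ≠ 0 := by
      filter_upwards [ae_norm_sphereUniform p] with x hx h0
      simp [h0] at hx
    exact Measure.quasiMeasurePreserving_fst.ae h1
  have hsum : 1 ≤ ∫ z, (‖pairDirection α β z‖ ^ 2 + ‖pairDirection α β
      (Prod.map id (LinearIsometryEquiv.neg ℝ) z)‖ ^ 2) ∂(σ.prod σ) := by
    calc (1 : ℝ) = ∫ _z, (1 : ℝ) ∂(σ.prod σ) := by simp
      _ ≤ _ := by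
        refine integral_mono_ae (integrable_const _) (hi.add hi2) ?_
        filter_upwards [hne] with z hz
        by_cases h : α • z.1 - β • z.2 = 0
        · have h' : α • z.1 + β • z.2 ≠ 0 := by
            intro h'
            have : (2 * α) • z.1 = 0 := by
              have := congrArg₂ (· + ·) h h'
              simp only [sub_add_add_cancel, add_zero] at this
              rw [two_mul, add_smul, this]
            rcases smul_eq_zero.1 this with h2 | h2
            · linarith
            · exact hz h2
          have : ‖pairDirection α β (Prod.map id (LinearIsometryEquiv.neg ℝ) z)‖ = 1 := by
            simp only [pairDirection, Prod.map, id, LinearIsometryEquiv.coe_neg, smul_neg,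
              sub_neg_eq_add]
            rw [norm_smul, norm_inv, norm_norm, inv_mul_cancel₀ (norm_ne_zero_iff.2 h')]
          rw [this]
          nlinarith [sq_nonneg ‖pairDirection α β z‖]
        · have : ‖pairDirection α β z‖ = 1 := by
            rw [pairDirection, norm_smul, norm_inv, norm_norm,
              inv_mul_cancel₀ (norm_ne_zero_iff.2 h)]
          rw [this]
          nlinarith [sq_nonneg ‖pairDirection α β (Prod.map id (LinearIsometryEquiv.neg ℝ) z)‖]
  rw [integral_add hi hi2, ← hsymm] at hsum
  linarith

/-- The sum over all ordered pairs of the Kendall kernels in the population eigenbasis, for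
directions `w` and radii `ξ`. -/
noncomputable def kendallSum (lam : Fin p → ℝ) (ξ : Fin n → ℝ)
    (w : Fin n → EuclideanSpace ℝ (Fin p)) (k l : Fin p) : ℝ :=
  ∑ a : Fin n × Fin n, shapeKernel lam (ξ a.1 • w a.1 - ξ a.2 • w a.2) k l

/-- The expectation of `kendallSum` over the directions, with the radii held fixed. -/
noncomputable def kendallMean (lam : Fin p → ℝ) (ξ : Fin n → ℝ) (k l : Fin p) : ℝ :=
  ∫ w, kendallSum lam ξ w k l ∂(Measure.pi fun _ => sphereUniform p)

theorem measurable_kendallSum (lam : Fin p → ℝ) (k l : Fin p) :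
    Measurable fun z : (Fin n → ℝ) × (Fin n → EuclideanSpace ℝ (Fin p)) =>
      kendallSum lam z.1 z.2 k l := by
  unfold kendallSum
  refine Finset.measurable_fun_sum _ fun a _ => ?_
  exact (measurable_shapeKernel lam k l).comp (by fun_prop)

theorem measurable_kendallMean (hp : 0 < p) (lam : Fin p → ℝ) (k l : Fin p) :
    Measurable fun ξ : Fin n → ℝ => kendallMean lam ξ k l := by
  have := isProbabilityMeasure_sphereUniform hp
  exact ((measurable_kendallSum lam k l).stronglyMeasurable.integral_prod_right (f := fun ξ w =>
    kendallSum lam ξ w k l)).measurable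

theorem iIndepFun_eval (hp : 0 < p) :
    iIndepFun (fun (t : Fin n) (w : Fin n → EuclideanSpace ℝ (Fin p)) => w t)
      (Measure.pi fun _ => sphereUniform p) := by
  have := isProbabilityMeasure_sphereUniform hp
  exact iIndepFun_pi (X := fun _ x => x) fun _ => aemeasurable_id

theorem map_eval_pi (hp : 0 < p) (t : Fin n) :
    (Measure.pi fun _ : Fin n => sphereUniform p).map (fun w => w t) = sphereUniform p := by
  have := isProbabilityMeasure_sphereUniform hp
  exact (measurePreserving_eval (fun _ : Fin n => sphereUniform p) t).map_eq

/-- The kernel depends on a pair of directions only through its normalized difference. -/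
theorem integral_shapeKernel_pair (hp : 0 < p) (lam : Fin p → ℝ) (ξ : Fin n → ℝ) {i j : Fin n}
    (hij : i ≠ j) (k l : Fin p) :
    ∫ w, shapeKernel lam (ξ i • w i - ξ j • w j) k l ∂(Measure.pi fun _ => sphereUniform p) =
      ∫ v, shapeKernel lam v k l
        ∂(((sphereUniform p).prod (sphereUniform p)).map (pairDirection (ξ i) (ξ j))) := by
  have := isProbabilityMeasure_sphereUniform hp
  have hind := (iIndepFun_eval (n := n) hp).indepFun hij
  have hmap := (indepFun_iff_map_prod_eq_prod_map_map
    (measurable_pi_apply i).aemeasurable (measurable_pi_apply j).aemeasurable).1 hind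
  rw [map_eval_pi hp, map_eval_pi hp] at hmap
  rw [integral_map (measurable_pairDirection _ _).aemeasurable
    (measurable_shapeKernel lam k l).aestronglyMeasurable, ← hmap]
  refine Eq.trans ?_ (integral_map ((measurable_pi_apply i).prodMk
    (measurable_pi_apply j)).aemeasurable ((measurable_shapeKernel lam k l).comp
      (measurable_pairDirection (ξ i) (ξ j))).aestronglyMeasurable).symm
  refine integral_congr_ae (ae_of_all _ fun w => ?_)
  simp only [pairDirection, shapeKernel_normalize]

theorem kendallMean_eq (hp : 0 < p) {lam : Fin p → ℝ} (h0 : ∀ i, 0 ≤ lam i) (ξ : Fin n → ℝ)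
    (k l : Fin p) :
    kendallMean lam ξ k l = ∑ a : Fin n × Fin n, if a.1 = a.2 then 0 else
      ∫ v, shapeKernel lam v k l
        ∂(((sphereUniform p).prod (sphereUniform p)).map (pairDirection (ξ a.1) (ξ a.2))) := by
  have := isProbabilityMeasure_sphereUniform hp
  unfold kendallMean kendallSum
  rw [integral_finsetSum]
  · refine Finset.sum_congr rfl fun a _ => ?_
    split_ifs with h
    · simp [h, shapeKernel_zero]
    · exact integral_shapeKernel_pair hp lam ξ h k l
  · intro a _
    exact Integrable.of_bound ((measurable_shapeKernel lam k l).comp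
      (by fun_prop)).aestronglyMeasurable 1 (ae_of_all _ fun w => abs_shapeKernel_le h0 _ k l)

theorem isProbabilityMeasure_map_pairDirection (hp : 0 < p) (α β : ℝ) : IsProbabilityMeasure
    (((sphereUniform p).prod (sphereUniform p)).map (pairDirection α β)) := by
  have := isProbabilityMeasure_sphereUniform hp
  exact Measure.isProbabilityMeasure_map (measurable_pairDirection _ _).aemeasurable

theorem kendallMean_offDiag (hp : 0 < p) {lam : Fin p → ℝ} (h0 : ∀ i, 0 ≤ lam i) (ξ : Fin n → ℝ)
    {k l : Fin p} (hkl : k ≠ l) : kendallMean lam ξ k l = 0 := by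
  rw [kendallMean_eq hp h0]
  refine Finset.sum_eq_zero fun a _ => ?_
  rw [integral_shapeKernel_offDiag (isRotationInvariant_pairDirection hp _ _) lam hkl, ite_self]

theorem kendallMean_le (ξ : Fin n → ℝ) {lam : Fin p → ℝ} {δ : ℝ} (hδ : 0 < δ)
    (hlow : ∀ i, δ ≤ lam i) {j : Fin p} (hj : lam j ≤ 1 / δ) :
    kendallMean lam ξ j j ≤ n ^ 2 * (1 / (δ ^ 2 * p)) := by
  have hp : 0 < p := j.pos
  rw [kendallMean_eq hp fun i => hδ.le.trans (hlow i)]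
  calc _ ≤ ∑ _a : Fin n × Fin n, 1 / (δ ^ 2 * p) := by
        refine Finset.sum_le_sum fun a _ => ?_
        split_ifs
        · positivity
        · have := isProbabilityMeasure_map_pairDirection hp (ξ a.1) (ξ a.2)
          exact integral_shapeKernel_le (isRotationInvariant_pairDirection hp _ _)
            (ae_norm_pairDirection _ _) hδ hlow hj
    _ = _ := by
        rw [Finset.sum_const, Finset.card_univ, Fintype.card_prod, Fintype.card_fin, nsmul_eq_mul]
        push_cast
        ring

/-- The `n² - n` off-diagonal pairs each contribute at least `δ³ / 12` to a leading entry. -/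
theorem le_kendallMean {ξ : Fin n → ℝ} (hξ : ∀ t, 0 < ξ t) {lam : Fin p → ℝ} {δ : ℝ} (hδ : 0 < δ)
    (hlow : ∀ i, 0 ≤ lam i) (hsum : ∑ i, lam i = p)
    {k : Fin p} (hk : δ * p ≤ lam k) (hk' : lam k ≤ p / δ) :
    (n ^ 2 - n : ℝ) * (δ ^ 3 / 12) ≤ kendallMean lam ξ k k := by
  have hp : 0 < p := k.pos
  rw [kendallMean_eq hp hlow]
  calc _ = ∑ a : Fin n × Fin n, ((δ ^ 3 / 12) - if a.1 = a.2 then δ ^ 3 / 12 else 0) := by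
        rw [Finset.sum_sub_distrib, Fintype.sum_prod_type, Fintype.sum_prod_type]
        simp
        ring
    _ ≤ _ := by
        refine Finset.sum_le_sum fun a _ => ?_
        split_ifs
        · simp
        · have := isProbabilityMeasure_map_pairDirection hp (ξ a.1) (ξ a.2)
          rw [sub_zero]
          exact le_integral_shapeKernel (isRotationInvariant_pairDirection hp _ _)
            (ae_norm_pairDirection _ _) (half_le_integral_pairDirection hp (hξ _) _) hδ hlow hsum
            hk hk'

theorem measurable_shapeKernel_pair (lam : Fin p → ℝ) (ξ : Fin n → ℝ) (k l : Fin p)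
    (a : Fin n × Fin n) : Measurable fun w : Fin n → EuclideanSpace ℝ (Fin p) =>
      shapeKernel lam (ξ a.1 • w a.1 - ξ a.2 • w a.2) k l :=
  (measurable_shapeKernel lam _ _).comp (by fun_prop)

theorem indepFun_shapeKernel_pair (hp : 0 < p) (lam : Fin p → ℝ) (ξ : Fin n → ℝ) (k l : Fin p)
    {a b : Fin n × Fin n} (h1 : a.1 ≠ b.1) (h2 : a.1 ≠ b.2) (h3 : a.2 ≠ b.1) (h4 : a.2 ≠ b.2) :
    IndepFun (fun w : Fin n → EuclideanSpace ℝ (Fin p) =>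
        shapeKernel lam (ξ a.1 • w a.1 - ξ a.2 • w a.2) k l)
      (fun w => shapeKernel lam (ξ b.1 • w b.1 - ξ b.2 • w b.2) k l)
      (Measure.pi fun _ => sphereUniform p) := by
  have h := (iIndepFun_eval (n := n) hp).indepFun_prodMk_prodMk (fun t => measurable_pi_apply t)
    a.1 a.2 b.1 b.2 h1 h2 h3 h4
  have hφ : ∀ x y : ℝ, Measurable fun z : EuclideanSpace ℝ (Fin p) × EuclideanSpace ℝ (Fin p) =>
      shapeKernel lam (x • z.1 - y • z.2) k l := fun x y =>
    (measurable_shapeKernel lam k l).comp (by fun_prop)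
  exact h.comp (hφ (ξ a.1) (ξ a.2)) (hφ (ξ b.1) (ξ b.2))

theorem integral_kendallSum_sub_sq_le (hp : 0 < p) {lam : Fin p → ℝ} (h0 : ∀ i, 0 ≤ lam i)
    (ξ : Fin n → ℝ) :
    ∫ w, ∑ kl : Fin p × Fin p, (kendallSum lam ξ w kl.1 kl.2 -
      kendallMean lam ξ kl.1 kl.2) ^ 2 ∂(Measure.pi fun _ : Fin n => sphereUniform p) ≤
      4 * n ^ 3 := by
  have := isProbabilityMeasure_sphereUniform hp
  simp only [kendallMean, kendallSum]
  exact integral_sum_centred_sq_le (P := Measure.pi fun _ : Fin n => sphereUniform p)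
    (X := fun (kl : Fin p × Fin p) (a : Fin n × Fin n) w =>
      shapeKernel lam (ξ a.1 • w a.1 - ξ a.2 • w a.2) kl.1 kl.2)
    (fun kl a => measurable_shapeKernel_pair lam ξ kl.1 kl.2 a)
    (fun kl a w => abs_shapeKernel_le h0 _ _ _) (fun a w => sum_shapeKernel_sq_le h0 _)
    fun a b h1 h2 h3 h4 kl => indepFun_shapeKernel_pair hp lam ξ kl.1 kl.2 h1 h2 h3 h4

theorem measure_kendallSum_gt_le (hp : 0 < p) (hn : 0 < n) {lam : Fin p → ℝ} (h0 : ∀ i, 0 ≤ lam i)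
    (ξ : Fin n → ℝ) {M : ℝ} (hM : 0 < M) :
    (Measure.pi fun _ : Fin n => sphereUniform p)
      {w | M * n ^ 3 < ∑ kl : Fin p × Fin p,
        (kendallSum lam ξ w kl.1 kl.2 - kendallMean lam ξ kl.1 kl.2) ^ 2} ≤
      ENNReal.ofReal (4 / M) := by
  have := isProbabilityMeasure_sphereUniform hp
  have hvar := integral_kendallSum_sub_sq_le hp h0 ξ
  have hks : ∀ kl : Fin p × Fin p, Measurable (fun w : Fin n → EuclideanSpace ℝ (Fin p) =>
      kendallSum lam ξ w kl.1 kl.2) := fun kl =>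
    Finset.measurable_fun_sum _ fun a _ => measurable_shapeKernel_pair lam ξ kl.1 kl.2 a
  have hbd : ∀ (kl : Fin p × Fin p) w, |kendallSum lam ξ w kl.1 kl.2| ≤ n ^ 2 := fun kl w => by
    refine (Finset.abs_sum_le_sum_abs _ _).trans ?_
    refine (Finset.sum_le_sum fun a _ => abs_shapeKernel_le h0 _ _ _).trans (le_of_eq ?_)
    simp
    ring
  have hSi : Integrable (fun w => ∑ kl : Fin p × Fin p, (kendallSum lam ξ w kl.1 kl.2 -
      kendallMean lam ξ kl.1 kl.2) ^ 2) (Measure.pi fun _ : Fin n => sphereUniform p) := by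
    refine integrable_finsetSum _ fun kl _ => ?_
    refine Integrable.of_bound (((hks kl).sub_const _).pow_const 2).aestronglyMeasurable
      ((n ^ 2 + |kendallMean lam ξ kl.1 kl.2|) ^ 2) (ae_of_all _ fun w => ?_)
    rw [Real.norm_eq_abs, abs_pow]
    gcongr
    exact (abs_sub _ _).trans (by gcongr; exact hbd kl w)
  have hn3 : (0 : ℝ) < (n : ℝ) ^ 3 := by positivity
  refine (measure_gt_le_of_integral_le hSi (ae_of_all _ fun w => Finset.sum_nonneg fun kl _ =>
    sq_nonneg _) (mul_pos hM hn3) hvar).trans (le_of_eq ?_)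
  congr 1
  field_simp

end KendallSum

/-! ### Matrix perturbation theory -/

section LinearAlgebra

theorem abs_le_maxNorm {a b : ℕ} (A : Matrix (Fin a) (Fin b) ℝ) (i : Fin a) (j : Fin b) :
    |A i j| ≤ maxNorm A :=
  le_ciSup (f := fun ij : Fin a × Fin b => |A ij.1 ij.2|) (Set.finite_range _).bddAbove (i, j)

theorem maxNorm_le {a b : ℕ} {A : Matrix (Fin a) (Fin b) ℝ} {c : ℝ} (hc : 0 ≤ c)
    (h : ∀ i j, |A i j| ≤ c) : maxNorm A ≤ c :=
  Real.iSup_le (fun ij => h ij.1 ij.2) hc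

theorem maxNorm_nonneg {a b : ℕ} (A : Matrix (Fin a) (Fin b) ℝ) : 0 ≤ maxNorm A :=
  Real.iSup_nonneg fun _ => abs_nonneg _

theorem dotProduct_self_nonneg' {ι : Type*} [Fintype ι] (x : ι → ℝ) : 0 ≤ x ⬝ᵥ x :=
  Finset.sum_nonneg fun i _ => mul_self_nonneg (x i)

theorem dotProduct_sq_le {ι : Type*} [Fintype ι] (x y : ι → ℝ) :
    (x ⬝ᵥ y) ^ 2 ≤ (x ⬝ᵥ x) * (y ⬝ᵥ y) := by
  have h := Finset.sum_mul_sq_le_sq_mul_sq Finset.univ x y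
  simp only [sq (x _), sq (y _)] at h
  exact h

theorem abs_dotProduct_le {ι : Type*} [Fintype ι] {x y : ι → ℝ} {a b : ℝ} (ha : 0 ≤ a)
    (hb : 0 ≤ b) (hx : x ⬝ᵥ x ≤ a ^ 2) (hy : y ⬝ᵥ y ≤ b ^ 2) : |x ⬝ᵥ y| ≤ a * b := by
  refine abs_le_of_sq_le_sq ?_ (mul_nonneg ha hb)
  rw [mul_pow]
  exact (dotProduct_sq_le x y).trans
    (mul_le_mul hx hy (dotProduct_self_nonneg' y) (sq_nonneg a))

theorem dotProduct_self_le_of_abs_le {m : ℕ} {x : Fin m → ℝ} {c : ℝ} (h : ∀ i, |x i| ≤ c) :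
    x ⬝ᵥ x ≤ m * c ^ 2 := by
  calc x ⬝ᵥ x ≤ ∑ _i : Fin m, c ^ 2 := Finset.sum_le_sum fun i _ => by
        rw [← sq, ← sq_abs]
        exact pow_le_pow_left₀ (abs_nonneg _) (h i) 2
    _ = _ := by simp

theorem abs_sum_mul_mul_le {m : ℕ} {a x b : Fin m → ℝ} {c : ℝ} (hc : 0 ≤ c)
    (ha : a ⬝ᵥ a ≤ 1) (hb : b ⬝ᵥ b ≤ 1) (hx : ∀ l, |x l| ≤ c) : |∑ l, a l * x l * b l| ≤ c := by
  calc |∑ l, a l * x l * b l| ≤ ∑ l, |a l * x l * b l| := Finset.abs_sum_le_sum_abs _ _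
    _ ≤ ∑ l, c / 2 * (a l * a l + b l * b l) := by
        refine Finset.sum_le_sum fun l _ => ?_
        rw [abs_mul, abs_mul]
        have h1 := mul_le_mul_of_nonneg_left (hx l) (mul_nonneg (abs_nonneg (a l)) (abs_nonneg (b l)))
        nlinarith [sq_nonneg (|a l| - |b l|), sq_abs (a l), sq_abs (b l)]
    _ = c / 2 * (a ⬝ᵥ a + b ⬝ᵥ b) := by
        rw [← Finset.mul_sum, Finset.sum_add_distrib]
        rfl
    _ ≤ c := by nlinarith

/-- A matrix with entries bounded by `s` has operator norm at most `s p`. -/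
theorem abs_dotProduct_mulVec_le {m : ℕ} {E : Matrix (Fin m) (Fin m) ℝ} {s : ℝ} (hs : 0 ≤ s)
    (hE : ∀ i j, |E i j| ≤ s) {x y : Fin m → ℝ} (hx : x ⬝ᵥ x ≤ 1) (hy : y ⬝ᵥ y ≤ 1) :
    |x ⬝ᵥ E *ᵥ y| ≤ s * m := by
  have h1 : ∀ i, |(E *ᵥ y) i| ≤ s * √m := fun i => by
    have := abs_dotProduct_le (x := E i) (y := y) (a := s * √m) (b := 1) (by positivity) zero_le_one
      (by rw [mul_pow, Real.sq_sqrt (Nat.cast_nonneg m), mul_comm]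
          exact dotProduct_self_le_of_abs_le (hE i)) (by simpa using hy)
    simpa [Matrix.mulVec] using this
  have h2 := abs_dotProduct_le (x := x) (y := E *ᵥ y) (a := 1) (b := s * m) zero_le_one
    (by positivity) (by simpa using hx) (by
      refine (dotProduct_self_le_of_abs_le h1).trans (le_of_eq ?_)
      rw [mul_pow, Real.sq_sqrt (Nat.cast_nonneg m)]
      ring)
  simpa using h2

variable {p : ℕ} {A Γ : Matrix (Fin p) (Fin p) ℝ} {lam : Fin p → ℝ}

theorem IsEigenDecomp.orth' (h : IsEigenDecomp A Γ lam) : Γ * Γᵀ = 1 :=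
  mul_eq_one_comm.1 h.orth

theorem IsEigenDecomp.conj (h : IsEigenDecomp A Γ lam) : Γᵀ * A * Γ = Matrix.diagonal lam := by
  rw [h.eq]
  calc _ = (Γᵀ * Γ) * Matrix.diagonal lam * (Γᵀ * Γ) := by simp only [Matrix.mul_assoc]
    _ = _ := by rw [h.orth, Matrix.one_mul, Matrix.mul_one]

theorem IsEigenDecomp.isSymm (h : IsEigenDecomp A Γ lam) : Aᵀ = A := by
  rw [h.eq]
  simp [Matrix.mul_assoc]

/-- The `k`-th column of `Γ` is an eigenvector for `lam k`. -/
theorem IsEigenDecomp.mulVec_col (h : IsEigenDecomp A Γ lam) (k : Fin p) :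
    A *ᵥ Γ.col k = lam k • Γ.col k := by
  have : A * Γ = Γ * Matrix.diagonal lam := by
    conv_lhs => rw [h.eq]
    rw [Matrix.mul_assoc, h.orth, Matrix.mul_one]
  ext i
  have h1 := congrFun (congrFun this i) k
  rw [Matrix.mul_diagonal] at h1
  simpa [Matrix.mul_apply, Matrix.mulVec, dotProduct, mul_comm] using h1

theorem IsEigenDecomp.col_dotProduct (h : IsEigenDecomp A Γ lam) (k l : Fin p) :
    Γ.col k ⬝ᵥ Γ.col l = if k = l then 1 else 0 := by
  have h1 := congrFun (congrFun h.orth k) l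
  rw [Matrix.one_apply] at h1
  rw [← h1]
  simp [Matrix.mul_apply, dotProduct]

theorem IsEigenDecomp.row_dotProduct (h : IsEigenDecomp A Γ lam) (k l : Fin p) :
    Γ k ⬝ᵥ Γ l = if k = l then 1 else 0 := by
  have h1 := congrFun (congrFun h.orth' k) l
  rw [Matrix.one_apply] at h1
  rw [← h1]
  simp [Matrix.mul_apply, dotProduct]

theorem dotProduct_mulVec_orth {m q : ℕ} {V : Matrix (Fin m) (Fin q) ℝ} (hV : Vᵀ * V = 1)
    (x y : Fin q → ℝ) : (V *ᵥ x) ⬝ᵥ (V *ᵥ y) = x ⬝ᵥ y := by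
  rw [Matrix.dotProduct_mulVec, Matrix.vecMul_mulVec, ← Matrix.dotProduct_mulVec, hV,
    Matrix.one_mulVec]

theorem IsEigenDecomp.dotProduct_mulVec (h : IsEigenDecomp A Γ lam) (x : Fin p → ℝ) :
    x ⬝ᵥ A *ᵥ x = ∑ k, lam k * (Γᵀ *ᵥ x) k ^ 2 := by
  conv_lhs => rw [h.eq]
  rw [← Matrix.mulVec_mulVec, ← Matrix.mulVec_mulVec, Matrix.dotProduct_mulVec,
    ← Matrix.mulVec_transpose]
  simp only [dotProduct, Matrix.mulVec_diagonal]
  refine Finset.sum_congr rfl fun k _ => ?_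
  ring

theorem IsEigenDecomp.sum_sq (h : IsEigenDecomp A Γ lam) (x : Fin p → ℝ) :
    ∑ k, (Γᵀ *ᵥ x) k ^ 2 = x ⬝ᵥ x := by
  have : (Γᵀ)ᵀ * Γᵀ = 1 := by rw [Matrix.transpose_transpose, h.orth']
  rw [← dotProduct_mulVec_orth this]
  exact Finset.sum_congr rfl fun k _ => sq _

theorem leadCols_orth {K : ℕ} (hK : K ≤ p) (h : Γᵀ * Γ = 1) :
    (leadCols hK Γ)ᵀ * leadCols hK Γ = 1 := by
  have : (leadCols hK Γ)ᵀ * leadCols hK Γ = (Γᵀ * Γ).submatrix (Fin.castLE hK) (Fin.castLE hK) := by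
    ext i j
    simp [leadCols, Matrix.mul_apply]
  rw [this, h, ← Matrix.diagonal_one, Matrix.submatrix_diagonal _ _ (Fin.castLE_injective hK)]
  rfl

/-- A lower bound of Courant–Fischer type for the `k`-th eigenvalue, from a subspace of dimension
larger than `k` on which the quadratic form is bounded below. -/
theorem IsEigenDecomp.le_eigenvalue (h : IsEigenDecomp A Γ lam) {q : ℕ}
    {V : Matrix (Fin p) (Fin q) ℝ} (hV : Vᵀ * V = 1) {lo : ℝ}
    (hlo : ∀ c : Fin q → ℝ, lo * (c ⬝ᵥ c) ≤ (V *ᵥ c) ⬝ᵥ A *ᵥ (V *ᵥ c)) {k : Fin p}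
    (hk : (k : ℕ) < q) : lo ≤ lam k := by
  let F : (Fin q → ℝ) →ₗ[ℝ] (Fin k → ℝ) :=
    (Matrix.of fun (i : Fin k) (j : Fin q) => (Γᵀ * V) (Fin.castLE k.2.le i) j).mulVecLin
  obtain ⟨c, hcF, hc0⟩ := (Submodule.ne_bot_iff _).1
    (F.ker_ne_bot_of_finrank_lt (by simpa using hk))
  have hz : ∀ j : Fin p, j < k → (Γᵀ *ᵥ (V *ᵥ c)) j = 0 := by
    intro j hj
    have := congrFun (LinearMap.mem_ker.1 hcF) ⟨j, hj⟩
    rw [Matrix.mulVec_mulVec]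
    simpa [F, Matrix.mulVec, dotProduct] using this
  have hcc : 0 < c ⬝ᵥ c := by
    refine lt_of_le_of_ne (dotProduct_self_nonneg' c) fun h0 => hc0 ?_
    exact dotProduct_self_eq_zero.1 h0.symm
  have h1 := hlo c
  rw [h.dotProduct_mulVec] at h1
  have h2 : ∑ j, lam j * (Γᵀ *ᵥ (V *ᵥ c)) j ^ 2 ≤ lam k * (c ⬝ᵥ c) := by
    rw [← dotProduct_mulVec_orth hV, ← h.sum_sq, Finset.mul_sum]
    refine Finset.sum_le_sum fun j _ => ?_
    rcases lt_or_ge j k with hj | hj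
    · simp [hz j hj]
    · exact mul_le_mul_of_nonneg_right (h.anti hj) (sq_nonneg _)
  exact le_of_mul_le_mul_right (h1.trans h2) hcc

/-- Weyl's inequality. -/
theorem IsEigenDecomp.eigenvalue_le_add (h : IsEigenDecomp A Γ lam)
    {B G : Matrix (Fin p) (Fin p) ℝ} {L : Fin p → ℝ} (hB : IsEigenDecomp B G L) {e : ℝ}
    (he : ∀ x : Fin p → ℝ, x ⬝ᵥ x = 1 → |x ⬝ᵥ (B - A) *ᵥ x| ≤ e) (k : Fin p) :
    |L k - lam k| ≤ e := by
  have key : ∀ {A' Γ' : Matrix (Fin p) (Fin p) ℝ} {lam' : Fin p → ℝ}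
      {B' G' : Matrix (Fin p) (Fin p) ℝ} {L' : Fin p → ℝ}, IsEigenDecomp A' Γ' lam' →
      IsEigenDecomp B' G' L' → (∀ x : Fin p → ℝ, x ⬝ᵥ x = 1 → |x ⬝ᵥ (B' - A') *ᵥ x| ≤ e) →
      lam' k - e ≤ L' k := by
    intro A' Γ' lam' B' G' L' h hB he
    have hk1 : (k : ℕ) + 1 ≤ p := k.2
    have hV := leadCols_orth hk1 h.orth
    refine hB.le_eigenvalue hV (fun c => ?_) (Nat.lt_succ_self k)
    rcases (dotProduct_self_nonneg' c).eq_or_lt with h0 | hpos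
    · have : c = 0 := dotProduct_self_eq_zero.1 h0.symm
      simp [this]
    set V := leadCols hk1 Γ' with hVdef
    have hA : lam' k * (c ⬝ᵥ c) ≤ (V *ᵥ c) ⬝ᵥ A' *ᵥ (V *ᵥ c) := by
      have hconj : Vᵀ * A' * V = Matrix.diagonal (lam' ∘ Fin.castLE hk1) := by
        rw [← Matrix.submatrix_diagonal _ _ (Fin.castLE_injective hk1), ← h.conj]
        rw [Matrix.submatrix_mul _ _ _ id _ Function.bijective_id,
          Matrix.submatrix_mul _ _ _ id _ Function.bijective_id]
        rfl
      have : (V *ᵥ c) ⬝ᵥ A' *ᵥ (V *ᵥ c) = c ⬝ᵥ (Vᵀ * A' * V) *ᵥ c := by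
        rw [Matrix.mulVec_mulVec, Matrix.dotProduct_mulVec, Matrix.vecMul_mulVec,
          ← Matrix.dotProduct_mulVec, Matrix.mul_assoc]
      rw [this, hconj]
      simp only [dotProduct, Matrix.mulVec_diagonal, Finset.mul_sum]
      refine Finset.sum_le_sum fun j _ => ?_
      have hj : Fin.castLE hk1 j ≤ k := by
        rw [Fin.le_def]
        simpa using Nat.lt_succ_iff.1 j.2
      have := h.anti hj
      simp only [Function.comp_apply]
      nlinarith [mul_self_nonneg (c j)]
    have hE : |(V *ᵥ c) ⬝ᵥ (B' - A') *ᵥ (V *ᵥ c)| ≤ e * (c ⬝ᵥ c) := by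
      set r := √(c ⬝ᵥ c)
      have hr : 0 < r := Real.sqrt_pos.2 hpos
      have hr2 : r ^ 2 = c ⬝ᵥ c := Real.sq_sqrt hpos.le
      have h1 := he (r⁻¹ • (V *ᵥ c)) (by
        rw [smul_dotProduct, dotProduct_smul, dotProduct_mulVec_orth hV, ← hr2]
        simp only [smul_eq_mul]
        field_simp)
      rw [Matrix.mulVec_smul, smul_dotProduct, dotProduct_smul, smul_eq_mul, smul_eq_mul,
        abs_mul, abs_mul, abs_of_pos (inv_pos.2 hr)] at h1
      rw [← hr2]
      calc _ = r ^ 2 * (r⁻¹ * (r⁻¹ * |(V *ᵥ c) ⬝ᵥ (B' - A') *ᵥ (V *ᵥ c)|)) := by field_simp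
        _ ≤ r ^ 2 * e := by gcongr
        _ = _ := mul_comm _ _
    rw [Matrix.sub_mulVec, dotProduct_sub] at hE
    linarith [(abs_le.1 hE).1]
  have h1 := key h hB he
  have h2 := key hB h (fun x hx => by
    rw [← neg_sub B A, Matrix.neg_mulVec, dotProduct_neg, abs_neg]
    exact he x hx)
  rw [abs_le]
  constructor <;> linarith

/-- An almost orthogonal matrix is close to an orthogonal one, its polar factor. -/
theorem exists_orthogonal_near {K : ℕ} (B : Matrix (Fin K) (Fin K) ℝ) :
    ∃ Q : Matrix (Fin K) (Fin K) ℝ, Qᵀ * Q = 1 ∧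
      ∀ e : ℝ, 0 ≤ e → K * e ≤ 1 / 2 → (∀ i j, |(Bᵀ * B - 1) i j| ≤ e) →
        ∀ i j, |B i j - Q i j| ≤ K * e := by
  by_cases hex : ∃ e : ℝ, 0 ≤ e ∧ K * e ≤ 1 / 2 ∧ ∀ i j, |(Bᵀ * B - 1) i j| ≤ e
  swap
  · refine ⟨1, by simp, fun e h0 h1 h2 => absurd ⟨e, h0, h1, h2⟩ hex⟩
  have hN : (Bᵀ * B).IsHermitian := by
    rw [Matrix.IsHermitian, Matrix.conjTranspose_eq_transpose_of_trivial]
    simp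
  obtain ⟨V, s, hVV, hNV⟩ : ∃ (V : Matrix (Fin K) (Fin K) ℝ) (s : Fin K → ℝ), Vᵀ * V = 1 ∧
      Bᵀ * B = V * Matrix.diagonal s * Vᵀ := by
    refine ⟨hN.eigenvectorUnitary, hN.eigenvalues, ?_, ?_⟩
    · have := Unitary.coe_star_mul_self hN.eigenvectorUnitary
      rwa [Matrix.star_eq_conjTranspose, Matrix.conjTranspose_eq_transpose_of_trivial] at this
    · have := hN.spectral_theorem
      rw [Unitary.conjStarAlgAut_apply, Matrix.star_eq_conjTranspose,
        Matrix.conjTranspose_eq_transpose_of_trivial] at this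
      exact this
  have hVV' : V * Vᵀ = 1 := mul_eq_one_comm.1 hVV
  have hs : ∀ e : ℝ, 0 ≤ e → (∀ i j, |(Bᵀ * B - 1) i j| ≤ e) → ∀ l, |s l - 1| ≤ K * e := by
    intro e h0 he l
    have hcol : V.col l ⬝ᵥ V.col l = 1 := by
      have := congrFun (congrFun hVV l) l
      simpa [Matrix.mul_apply, dotProduct] using this
    have h1 := abs_dotProduct_mulVec_le h0 he hcol.le hcol.le
    have h2 : V.col l ⬝ᵥ (Bᵀ * B - 1) *ᵥ V.col l = s l - 1 := by
      rw [Matrix.sub_mulVec, dotProduct_sub, Matrix.one_mulVec, hcol]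
      have h3 : Bᵀ * B * V = V * Matrix.diagonal s := by
        rw [hNV, Matrix.mul_assoc, hVV, Matrix.mul_one]
      have h4 : (Bᵀ * B) *ᵥ V.col l = s l • V.col l := by
        ext i
        have := congrFun (congrFun h3 i) l
        rw [Matrix.mul_diagonal] at this
        rw [Matrix.mul_apply] at this
        simpa [Matrix.mulVec, dotProduct, mul_comm] using this
      rw [h4, dotProduct_smul, hcol]
      simp
    rw [h2, mul_comm] at h1
    exact h1
  obtain ⟨e₀, he0, hKe0, hBe0⟩ := hex
  have hspos : ∀ l, 0 < s l := fun l => by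
    have := (abs_le.1 (hs e₀ he0 hBe0 l)).1
    linarith
  set D : Matrix (Fin K) (Fin K) ℝ := Matrix.diagonal fun l => (√(s l))⁻¹ with hD
  set Q := B * V * D * Vᵀ with hQ
  have hDs : D * Matrix.diagonal s * D = 1 := by
    rw [hD, Matrix.diagonal_mul_diagonal, Matrix.diagonal_mul_diagonal, ← Matrix.diagonal_one]
    congr 1
    funext l
    have := hspos l
    have h2 := Real.sqrt_pos.2 this
    have h3 := Real.sq_sqrt this.le
    field_simp
    linarith
  have hQQ : Qᵀ * Q = 1 := by
    have : Qᵀ * Q = V * (D * (Vᵀ * (Bᵀ * B) * V) * D) * Vᵀ := by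
      simp [hQ, Matrix.mul_assoc, hD]
    have h2 : Vᵀ * (Bᵀ * B) * V = Matrix.diagonal s := by
      rw [hNV]
      calc _ = (Vᵀ * V) * Matrix.diagonal s * (Vᵀ * V) := by simp only [Matrix.mul_assoc]
        _ = _ := by rw [hVV, Matrix.one_mul, Matrix.mul_one]
    rw [this, h2, hDs, Matrix.mul_one, hVV']
  refine ⟨Q, hQQ, fun e h0 hKe he i j => ?_⟩
  set W := Q * V with hW
  have hWD : B = W * Matrix.diagonal (fun l => √(s l)) * Vᵀ := by
    have h1 : D * Matrix.diagonal (fun l => √(s l)) = 1 := by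
      rw [hD, Matrix.diagonal_mul_diagonal, ← Matrix.diagonal_one]
      congr 1
      funext l
      exact inv_mul_cancel₀ (Real.sqrt_pos.2 (hspos l)).ne'
    calc B = B * (V * Vᵀ) := by rw [hVV', Matrix.mul_one]
      _ = B * V * (D * Matrix.diagonal (fun l => √(s l))) * Vᵀ := by
          rw [h1, Matrix.mul_one, Matrix.mul_assoc]
      _ = B * V * D * (Vᵀ * V) * Matrix.diagonal (fun l => √(s l)) * Vᵀ := by
          rw [hVV, Matrix.mul_one]; simp only [Matrix.mul_assoc]
      _ = _ := by rw [hW, hQ]; simp only [Matrix.mul_assoc]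
  have hQW : Q = W * Vᵀ := by rw [hW, Matrix.mul_assoc, hVV', Matrix.mul_one]
  have hWW : W * Wᵀ = 1 := by
    have : Wᵀ * W = 1 := by
      rw [hW, Matrix.transpose_mul]
      calc _ = Vᵀ * (Qᵀ * Q) * V := by simp only [Matrix.mul_assoc]
        _ = _ := by rw [hQQ, Matrix.mul_one, hVV]
    exact mul_eq_one_comm.1 this
  have hrow : ∀ {U : Matrix (Fin K) (Fin K) ℝ}, U * Uᵀ = 1 → ∀ i, U i ⬝ᵥ U i ≤ 1 := by
    intro U hU i
    have := congrFun (congrFun hU i) i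
    rw [Matrix.mul_apply, Matrix.one_apply_eq] at this
    exact le_of_eq (by simpa [dotProduct] using this)
  have hdiff : B i j - Q i j = ∑ l, W i l * (√(s l) - 1) * V j l := by
    conv_lhs => rw [hWD, hQW]
    rw [Matrix.mul_apply, Matrix.mul_apply, ← Finset.sum_sub_distrib]
    refine Finset.sum_congr rfl fun l _ => ?_
    rw [Matrix.mul_diagonal, Matrix.transpose_apply]
    ring
  rw [hdiff]
  refine abs_sum_mul_mul_le (by positivity) (hrow hWW i) (hrow hVV' j) fun l => ?_
  refine le_trans ?_ (hs e h0 he l)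
  have h1 : s l - 1 = (√(s l) - 1) * (√(s l) + 1) := by
    have := Real.sq_sqrt (hspos l).le
    nlinarith
  rw [h1, abs_mul]
  have h2 : 1 ≤ |√(s l) + 1| := by
    rw [abs_of_nonneg (by positivity)]
    linarith [Real.sqrt_nonneg (s l)]
  exact le_mul_of_one_le_right (abs_nonneg _) h2

end LinearAlgebra

/-! ### Leading eigenpairs of an entrywise perturbation -/

section EigenPerturbation

variable {p K : ℕ} {A Γ S G : Matrix (Fin p) (Fin p) ℝ} {lam L : Fin p → ℝ}

/-- Weyl's inequality, with the operator norm bounded by `p` times the largest entry. -/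
theorem eigenvalue_sub_le (hA : IsEigenDecomp A Γ lam) (hS : IsEigenDecomp S G L) {s : ℝ}
    (hs : 0 ≤ s) (hE : ∀ i j, |(S - A) i j| ≤ s) (k : Fin p) : |L k - lam k| ≤ s * p :=
  hA.eigenvalue_le_add hS (fun _ hx => abs_dotProduct_mulVec_le hs hE hx.le hx.le) k

/-- The matrix `Λ_K Γ_Kᵀ Ĝ_K L_K⁻¹` that aligns the leading eigenvectors `Γ_K` with `Ĝ_K`. -/
noncomputable def alignMatrix (hK : K ≤ p) (Γ : Matrix (Fin p) (Fin p) ℝ) (lam : Fin p → ℝ)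
    (G : Matrix (Fin p) (Fin p) ℝ) (L : Fin p → ℝ) : Matrix (Fin K) (Fin K) ℝ :=
  Matrix.of fun l k => lam (Fin.castLE hK l) *
    (Γ.col (Fin.castLE hK l) ⬝ᵥ G.col (Fin.castLE hK k)) / L (Fin.castLE hK k)

theorem sum_castLE (hK : K ≤ p) (f : Fin p → ℝ) :
    ∑ l : Fin K, f (Fin.castLE hK l) = ∑ l : Fin p, if (l : ℕ) < K then f l else 0 := by
  rw [← Finset.sum_filter]
  refine Finset.sum_bij (fun l _ => Fin.castLE hK l) (fun l _ => by simp)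
    (fun a _ b _ h => Fin.castLE_injective hK h) (fun b hb => ?_) (fun _ _ => rfl)
  exact ⟨⟨b, by simpa using hb⟩, by simp, by ext; simp⟩

theorem IsEigenDecomp.col_dotProduct_le_one (h : IsEigenDecomp A Γ lam) (k : Fin p) :
    Γ.col k ⬝ᵥ Γ.col k ≤ 1 := by
  rw [h.col_dotProduct, if_pos rfl]

theorem IsEigenDecomp.row_dotProduct_le_one (h : IsEigenDecomp A Γ lam) (k : Fin p) :
    Γ k ⬝ᵥ Γ k ≤ 1 := by
  rw [h.row_dotProduct, if_pos rfl]

theorem IsEigenDecomp.sum_col_dotProduct_sq (h : IsEigenDecomp A Γ lam) (x : Fin p → ℝ) :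
    ∑ l, (Γ.col l ⬝ᵥ x) ^ 2 = x ⬝ᵥ x := h.sum_sq x

/-- The entries of the eigenvector residual: the noise averages out over a row, and the
non-spiked part of `A` has bounded norm. -/
theorem abs_leadCols_sub_le (hK : K ≤ p) (hA : IsEigenDecomp A Γ lam) (hS : IsEigenDecomp S G L)
    {s δ : ℝ} (hs : 0 ≤ s) (hE : ∀ i j, |(S - A) i j| ≤ s) (hδ : 0 < δ)
    (hlead : ∀ i : Fin p, (i : ℕ) < K → δ * p ≤ lam i)
    (hidio : ∀ i : Fin p, K ≤ (i : ℕ) → |lam i| ≤ 1 / δ) (hsδ : s ≤ δ / 2) (i : Fin p)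
    (k : Fin K) :
    |leadCols hK G i k - (leadCols hK Γ * alignMatrix hK Γ lam G L) i k| ≤
      2 / (δ * p) * (s * √p + 1 / δ) := by
  have hp : 0 < p := i.pos
  have hp' : (0 : ℝ) < p := by exact_mod_cast hp
  set k' := Fin.castLE hK k with hk'
  set g := G.col k' with hg
  have hgg : g ⬝ᵥ g ≤ 1 := hS.col_dotProduct_le_one k'
  have hLk : δ * p / 2 ≤ L k' := by
    have h1 := (abs_le.1 (eigenvalue_sub_le hA hS hs hE k')).1
    have h2 := hlead k' k.2
    nlinarith
  have hLpos : 0 < L k' := lt_of_lt_of_le (by positivity) hLk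
  -- the eigenvalue equation of `S`, split as `S = (S - A) + A`
  have heq : L k' * g i = ((S - A) *ᵥ g) i + ∑ l, Γ i l * lam l * (Γ.col l ⬝ᵥ g) := by
    have h1 := congrFun (hS.mulVec_col k') i
    have h2 : (A *ᵥ g) i = ∑ l, Γ i l * lam l * (Γ.col l ⬝ᵥ g) := by
      conv_lhs => rw [hA.eq]
      rw [← Matrix.mulVec_mulVec, Matrix.mulVec, dotProduct]
      refine Finset.sum_congr rfl fun l _ => ?_
      rw [Matrix.mul_diagonal]
      rfl
    rw [← h2, Matrix.sub_mulVec]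
    simp only [Pi.smul_apply, smul_eq_mul, Pi.sub_apply] at h1 ⊢
    rw [← h1]
    ring
  have hB : (leadCols hK Γ * alignMatrix hK Γ lam G L) i k =
      (∑ l : Fin p, if (l : ℕ) < K then Γ i l * lam l * (Γ.col l ⬝ᵥ g) else 0) / L k' := by
    rw [← sum_castLE hK (fun l => Γ i l * lam l * (Γ.col l ⬝ᵥ g)), Matrix.mul_apply,
      Finset.sum_div]
    refine Finset.sum_congr rfl fun l _ => ?_
    simp only [leadCols, alignMatrix, Matrix.submatrix_apply, id, Matrix.of_apply]
    ring
  have hdiff : leadCols hK G i k - (leadCols hK Γ * alignMatrix hK Γ lam G L) i k =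
      (((S - A) *ᵥ g) i + ∑ l, Γ i l * (if (l : ℕ) < K then 0 else lam l) * (Γ.col l ⬝ᵥ g)) /
        L k' := by
    have h1 : leadCols hK G i k = g i := rfl
    rw [hB, h1, eq_div_iff hLpos.ne', sub_mul, div_mul_cancel₀ _ hLpos.ne', mul_comm, heq,
      add_sub_assoc, ← Finset.sum_sub_distrib]
    congr 1
    refine Finset.sum_congr rfl fun l _ => ?_
    split_ifs <;> ring
  have hn1 : |((S - A) *ᵥ g) i| ≤ s * √p := by
    have := abs_dotProduct_le (x := (S - A) i) (y := g) (a := s * √p) (b := 1) (by positivity)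
      zero_le_one (by
        rw [mul_pow, Real.sq_sqrt hp'.le, mul_comm]
        exact dotProduct_self_le_of_abs_le (hE i)) (by simpa using hgg)
    rw [mul_one] at this
    exact this
  have hn2 : |∑ l, Γ i l * (if (l : ℕ) < K then 0 else lam l) * (Γ.col l ⬝ᵥ g)| ≤ 1 / δ := by
    refine abs_sum_mul_mul_le (by positivity) (hA.row_dotProduct_le_one i)
      (b := fun l => Γ.col l ⬝ᵥ g) ?_ fun l => ?_
    · refine le_trans (le_of_eq ?_) hgg
      rw [← hA.sum_col_dotProduct_sq g]
      exact Finset.sum_congr rfl fun l _ => (sq _).symm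
    · split_ifs with hl
      · simpa using hδ.le
      · exact hidio l (not_lt.1 hl)
  rw [hdiff, abs_div, abs_of_pos hLpos]
  calc _ ≤ (s * √p + 1 / δ) / (δ * p / 2) :=
        div_le_div₀ (by positivity) ((abs_add_le _ _).trans (add_le_add hn1 hn2)) (by positivity) hLk
    _ = _ := by field_simp

/-- If two orthonormal systems satisfy `U ≈ V B`, then `B` is nearly orthogonal. -/
theorem abs_gram_sub_one_le {U V : Matrix (Fin p) (Fin K) ℝ} (hU : Uᵀ * U = 1) (hV : Vᵀ * V = 1)
    {B : Matrix (Fin K) (Fin K) ℝ} {τ : ℝ} (hτ0 : 0 ≤ τ) (hτ : ∀ i k, |U i k - (V * B) i k| ≤ τ)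
    (hsmall : √p * τ ≤ 1) (k l : Fin K) : |(Bᵀ * B - 1) k l| ≤ 3 * (√p * τ) := by
  obtain ⟨F, hF⟩ : ∃ F, F = U - V * B := ⟨_, rfl⟩
  have hFe : ∀ k, F.col k ⬝ᵥ F.col k ≤ (√p * τ) ^ 2 := fun k => by
    rw [mul_pow, Real.sq_sqrt (Nat.cast_nonneg p)]
    exact dotProduct_self_le_of_abs_le fun i => by rw [hF]; exact hτ i k
  have hUe : ∀ k, U.col k ⬝ᵥ U.col k ≤ 1 ^ 2 := fun k => by
    have := congrFun (congrFun hU k) k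
    rw [Matrix.mul_apply, Matrix.one_apply_eq] at this
    rw [one_pow]
    exact le_of_eq (by simpa [dotProduct] using this)
  have h0 : 0 ≤ √p * τ := by positivity
  have hBB : Bᵀ * B - 1 = Fᵀ * F - Uᵀ * F - Fᵀ * U := by
    have h1 : Bᵀ * B = (V * B)ᵀ * (V * B) := by
      rw [Matrix.transpose_mul]
      calc Bᵀ * B = Bᵀ * (Vᵀ * V) * B := by rw [hV, Matrix.mul_one]
        _ = _ := by simp only [Matrix.mul_assoc]
    have h2 : V * B = U - F := by rw [hF]; abel
    rw [h1, h2]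
    simp only [Matrix.transpose_sub, Matrix.sub_mul, Matrix.mul_sub, hU]
    abel
  have e1 : (Fᵀ * F) k l = F.col k ⬝ᵥ F.col l := by simp [Matrix.mul_apply, dotProduct]
  have e2 : (Uᵀ * F) k l = U.col k ⬝ᵥ F.col l := by simp [Matrix.mul_apply, dotProduct]
  have e3 : (Fᵀ * U) k l = F.col k ⬝ᵥ U.col l := by simp [Matrix.mul_apply, dotProduct]
  have b1 := abs_dotProduct_le h0 h0 (hFe k) (hFe l)
  have b2 := abs_dotProduct_le zero_le_one h0 (hUe k) (hFe l)
  have b3 := abs_dotProduct_le h0 zero_le_one (hFe k) (hUe l)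
  rw [hBB, Matrix.sub_apply, Matrix.sub_apply, e1, e2, e3]
  have h4 := abs_sub (F.col k ⬝ᵥ F.col l - U.col k ⬝ᵥ F.col l) (F.col k ⬝ᵥ U.col l)
  have h5 := abs_sub (F.col k ⬝ᵥ F.col l) (U.col k ⬝ᵥ F.col l)
  nlinarith

/-- Leading eigenvectors are delocalized: `A i i ≥ lam k * Γ i k ^ 2` and `lam k` is of order `p`. -/
theorem abs_leadCols_le (hK : K ≤ p) (hA : IsEigenDecomp A Γ lam) {δ C : ℝ} (hδ : 0 < δ)
    (hlead : ∀ i : Fin p, (i : ℕ) < K → δ * p ≤ lam i) (h0 : ∀ i, 0 ≤ lam i)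
    (hC : ∀ i, A i i ≤ C) (i : Fin p) (k : Fin K) : |leadCols hK Γ i k| ≤ √(C / δ) / √p := by
  have hp' : (0 : ℝ) < p := by exact_mod_cast i.pos
  have h1 : A i i = ∑ l, lam l * Γ i l ^ 2 := by
    conv_lhs => rw [hA.eq]
    rw [Matrix.mul_apply]
    refine Finset.sum_congr rfl fun l _ => ?_
    rw [Matrix.mul_diagonal, Matrix.transpose_apply]
    ring
  set k' := Fin.castLE hK k
  have h2 : lam k' * Γ i k' ^ 2 ≤ C := by
    refine le_trans ?_ (hC i)
    rw [h1]
    exact Finset.single_le_sum (f := fun l => lam l * Γ i l ^ 2)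
      (fun l _ => mul_nonneg (h0 l) (sq_nonneg _)) (Finset.mem_univ k')
  have h3 : δ * p * Γ i k' ^ 2 ≤ C :=
    (mul_le_mul_of_nonneg_right (hlead k' k.2) (sq_nonneg _)).trans h2
  rw [← Real.sqrt_div' _ hp'.le]
  refine Real.abs_le_sqrt ?_
  rw [div_div, le_div_iff₀ (by positivity)]
  change Γ i k' ^ 2 * (δ * p) ≤ C
  linarith

/-- Entrywise comparison of the leading eigenvectors with a rotation of the true ones, at the
rate `r / √p`. -/
theorem abs_leadCols_sub_mul_le (hK : K ≤ p) (hA : IsEigenDecomp A Γ lam)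
    (hS : IsEigenDecomp S G L) {M r δ C : ℝ} (hM : 0 ≤ M) (hr : 1 / √p ≤ r)
    (hE : ∀ i j, |(S - A) i j| ≤ M * r) (hδ : 0 < δ)
    (hlead : ∀ i : Fin p, (i : ℕ) < K → δ * p ≤ lam i) (h0 : ∀ i, 0 ≤ lam i)
    (hidio : ∀ i : Fin p, K ≤ (i : ℕ) → lam i ≤ 1 / δ) (hC : ∀ i, A i i ≤ C) (hsδ : M * r ≤ δ / 2)
    (i : Fin p) (k : Fin K) :
    |leadCols hK G i k - (leadCols hK Γ * alignMatrix hK Γ lam G L) i k| ≤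
        2 / δ * (M + 1 / δ) * (r / √p) ∧
      ∀ (Q : Matrix (Fin K) (Fin K) ℝ) (e : ℝ),
        (∀ l j, |alignMatrix hK Γ lam G L l j - Q l j| ≤ e) →
        |leadCols hK G i k - (leadCols hK Γ * Q) i k| ≤
          2 / δ * (M + 1 / δ) * (r / √p) + K * (√(C / δ) / √p * e) := by
  have hp' : (0 : ℝ) < p := by exact_mod_cast i.pos
  have hsp : 0 < √(p : ℝ) := Real.sqrt_pos.2 hp'
  have hr0 : 0 ≤ r := le_trans (by positivity) hr
  have h1 : |leadCols hK G i k - (leadCols hK Γ * alignMatrix hK Γ lam G L) i k| ≤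
      2 / δ * (M + 1 / δ) * (r / √p) := by
    refine (abs_leadCols_sub_le hK hA hS (by positivity) hE hδ hlead
      (fun i hi => by rw [abs_of_nonneg (h0 i)]; exact hidio i hi) hsδ i k).trans ?_
    have h2 : (1 : ℝ) ≤ r * √p := by rwa [div_le_iff₀ hsp] at hr
    have h3 : 1 / δ ≤ 1 / δ * (r * √p) := le_mul_of_one_le_right (by positivity) h2
    calc _ ≤ 2 / (δ * p) * (M * r * √p + 1 / δ * (r * √p)) := by gcongr
      _ = 2 / δ * (M + 1 / δ) * (r * √p / p) := by field_simp
      _ = _ := by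
        congr 1
        rw [div_eq_div_iff hp'.ne' hsp.ne', mul_assoc, Real.mul_self_sqrt hp'.le]
  refine ⟨h1, fun Q e hQ => ?_⟩
  have h4 : (leadCols hK Γ * alignMatrix hK Γ lam G L) i k - (leadCols hK Γ * Q) i k =
      ∑ l, leadCols hK Γ i l * (alignMatrix hK Γ lam G L l k - Q l k) := by
    rw [Matrix.mul_apply, Matrix.mul_apply, ← Finset.sum_sub_distrib]
    exact Finset.sum_congr rfl fun l _ => (mul_sub _ _ _).symm
  have h5 : |(leadCols hK Γ * alignMatrix hK Γ lam G L) i k - (leadCols hK Γ * Q) i k| ≤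
      K * (√(C / δ) / √p * e) := by
    rw [h4]
    calc _ ≤ ∑ l, |leadCols hK Γ i l * (alignMatrix hK Γ lam G L l k - Q l k)| :=
          Finset.abs_sum_le_sum_abs _ _
      _ ≤ ∑ _l : Fin K, √(C / δ) / √p * e := by
          refine Finset.sum_le_sum fun l _ => ?_
          rw [abs_mul]
          exact mul_le_mul (abs_leadCols_le hK hA hδ hlead h0 hC i l) (hQ l k) (abs_nonneg _)
            (by positivity)
      _ = _ := by simp
  calc _ = |(leadCols hK G i k - (leadCols hK Γ * alignMatrix hK Γ lam G L) i k) +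
        ((leadCols hK Γ * alignMatrix hK Γ lam G L) i k - (leadCols hK Γ * Q) i k)| := by
        congr 1; ring
    _ ≤ _ := (abs_add_le _ _).trans (add_le_add h1 h5)

/-- When the leading eigenvalues are separated, distinct estimated and true eigenvectors are nearly
orthogonal. -/
theorem abs_alignMatrix_offDiag_le (hK : K ≤ p) (hA : IsEigenDecomp A Γ lam)
    (hS : IsEigenDecomp S G L) {s δ δ' : ℝ} (hs : 0 ≤ s) (hE : ∀ i j, |(S - A) i j| ≤ s)
    (hδ : 0 < δ) (hδ' : 0 < δ')
    (hlead : ∀ i : Fin p, (i : ℕ) < K → δ * p ≤ lam i ∧ lam i ≤ p / δ)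
    (hsep : ∀ i j : Fin p, i < j → (j : ℕ) < K → δ' * p ≤ lam i - lam j)
    (hsδ : s ≤ δ / 2) (hsδ' : s ≤ δ' / 2) {l k : Fin K} (hlk : l ≠ k) :
    |alignMatrix hK Γ lam G L l k| ≤ 4 / (δ ^ 2 * δ') * s := by
  set k' := Fin.castLE hK k with hk'
  set l' := Fin.castLE hK l with hl'
  have hp' : (0 : ℝ) < p := by exact_mod_cast k'.pos
  set g := G.col k' with hg
  have hgg : g ⬝ᵥ g ≤ 1 := hS.col_dotProduct_le_one k'
  have hev := abs_le.1 (eigenvalue_sub_le hA hS hs hE k')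
  have hLk : δ * p / 2 ≤ L k' := by
    have h2 := (hlead k' k.2).1
    nlinarith [hev.1]
  have hLpos : 0 < L k' := lt_of_lt_of_le (by positivity) hLk
  have hgap : δ' * p / 2 ≤ |L k' - lam l'| := by
    have h1 : δ' * p ≤ |lam k' - lam l'| := by
      rcases lt_or_gt_of_ne hlk with h | h
      · have := hsep l' k' h k.2
        rw [abs_sub_comm]
        exact this.trans (le_abs_self _)
      · have := hsep k' l' h l.2
        exact this.trans (le_abs_self _)
    have h2 : |lam k' - lam l'| ≤ |L k' - lam l'| + |L k' - lam k'| := by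
      have := abs_sub (L k' - lam l') (L k' - lam k')
      rwa [sub_sub_sub_cancel_left] at this
    have h3 := eigenvalue_sub_le hA hS hs hE k'
    nlinarith
  have heq : (L k' - lam l') * (Γ.col l' ⬝ᵥ g) = Γ.col l' ⬝ᵥ (S - A) *ᵥ g := by
    have h1 : A *ᵥ Γ.col l' = lam l' • Γ.col l' := hA.mulVec_col l'
    have h2 : Γ.col l' ⬝ᵥ A *ᵥ g = lam l' * (Γ.col l' ⬝ᵥ g) := by
      rw [Matrix.dotProduct_mulVec, ← Matrix.mulVec_transpose, hA.isSymm, h1, smul_dotProduct,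
        smul_eq_mul]
    rw [Matrix.sub_mulVec, dotProduct_sub, hg, hS.mulVec_col k', dotProduct_smul, ← hg, h2,
      smul_eq_mul]
    ring
  have hn := abs_dotProduct_mulVec_le hs hE (hA.col_dotProduct_le_one l') hgg
  rw [← heq, abs_mul] at hn
  have hdot : |Γ.col l' ⬝ᵥ g| ≤ 2 * s / δ' := by
    rw [le_div_iff₀ hδ']
    have h1 := (mul_le_mul_of_nonneg_right hgap (abs_nonneg (Γ.col l' ⬝ᵥ g))).trans hn
    have h2 : p * (|Γ.col l' ⬝ᵥ g| * δ') ≤ p * (2 * s) := by linarith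
    exact le_of_mul_le_mul_left h2 hp'
  have hl0 : 0 ≤ lam l' := le_trans (by positivity) (hlead l' l.2).1
  calc |alignMatrix hK Γ lam G L l k| = lam l' * |Γ.col l' ⬝ᵥ g| / L k' := by
        simp only [alignMatrix, Matrix.of_apply]
        rw [abs_div, abs_mul, abs_of_nonneg hl0, abs_of_pos hLpos]
    _ ≤ (p / δ) * (2 * s / δ') / (δ * p / 2) := by
        refine div_le_div₀ (by positivity) ?_ (by positivity) hLk
        exact mul_le_mul (hlead l' l.2).2 hdot (abs_nonneg _) (by positivity)
    _ = _ := by field_simp; ring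

theorem abs_sub_sign_le (b : ℝ) : |b - if 0 ≤ b then 1 else -1| ≤ |b ^ 2 - 1| := by
  have e : ∀ s : ℝ, s ^ 2 = 1 → 1 ≤ |b + s| → |b - s| ≤ |b ^ 2 - 1| := by
    intro s hs h
    have : b ^ 2 - 1 = (b - s) * (b + s) := by linarith [mul_self_nonneg b, hs, sq b, sq s]
    rw [this, abs_mul]
    exact le_mul_of_one_le_right (abs_nonneg _) h
  split_ifs with h
  · exact e 1 (by norm_num) (by rw [abs_of_nonneg (by linarith)]; linarith)
  · exact e (-1) (by norm_num) (by rw [abs_of_nonpos (by linarith)]; linarith)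

/-- A nearly orthogonal matrix with small off-diagonal entries is close to a matrix of signs. -/
theorem abs_sub_diagonal_sign_le {B : Matrix (Fin K) (Fin K) ℝ} {e₀ e₁ : ℝ} (he₀ : 0 ≤ e₀)
    (he₁ : 0 ≤ e₁) (he₁' : e₁ ≤ 1)
    (hgram : ∀ k, |(Bᵀ * B - 1) k k| ≤ e₀) (hoff : ∀ l k, l ≠ k → |B l k| ≤ e₁) (l k : Fin K) :
    |B l k - Matrix.diagonal (fun j => if 0 ≤ B j j then (1 : ℝ) else -1) l k| ≤
      e₀ + (K + 1) * e₁ := by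
  by_cases hlk : l = k
  · subst hlk
    rw [Matrix.diagonal_apply_eq]
    refine (abs_sub_sign_le _).trans ?_
    have h1 : (Bᵀ * B - 1) l l = B l l ^ 2 - 1 + ∑ j ∈ Finset.univ.erase l, B j l ^ 2 := by
      rw [Matrix.sub_apply, Matrix.one_apply_eq, Matrix.mul_apply,
        ← Finset.add_sum_erase _ _ (Finset.mem_univ l)]
      simp only [Matrix.transpose_apply, ← sq]
      ring
    have h2 : ∑ j ∈ Finset.univ.erase l, B j l ^ 2 ≤ K * e₁ := by
      calc _ ≤ ∑ _j ∈ Finset.univ.erase l, e₁ := by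
            refine Finset.sum_le_sum fun j hj => ?_
            have := hoff j l (Finset.ne_of_mem_erase hj)
            rw [← sq_abs]
            nlinarith [abs_nonneg (B j l)]
        _ ≤ ∑ _j : Fin K, e₁ :=
            Finset.sum_le_sum_of_subset_of_nonneg (Finset.erase_subset _ _) fun _ _ _ => he₁
        _ = _ := by simp
    have h3 : 0 ≤ ∑ j ∈ Finset.univ.erase l, B j l ^ 2 := Finset.sum_nonneg fun _ _ => sq_nonneg _
    have h4 := abs_le.1 (hgram l)
    rw [h1] at h4
    rw [abs_le]
    constructor <;> nlinarith [h4.1, h4.2]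
  · rw [Matrix.diagonal_apply_ne _ hlk, sub_zero]
    refine (hoff l k hlk).trans ?_
    have : (0 : ℝ) ≤ K * e₁ := by positivity
    linarith

/-- Relative error of the leading eigenvalues. -/
theorem maxNorm_leadDiag_le (hK : K ≤ p) (hA : IsEigenDecomp A Γ lam) (hS : IsEigenDecomp S G L)
    {s δ : ℝ} (hs : 0 ≤ s) (hE : ∀ i j, |(S - A) i j| ≤ s) (hδ : 0 < δ)
    (hlead : ∀ i : Fin p, (i : ℕ) < K → δ * p ≤ lam i) :
    maxNorm (leadDiag hK L * (leadDiag hK lam)⁻¹ - 1) ≤ s / δ := by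
  refine maxNorm_le (by positivity) fun i j => ?_
  have hp' : (0 : ℝ) < p := by exact_mod_cast (Fin.castLE hK i).pos
  have hpos : ∀ k : Fin K, 0 < lam (Fin.castLE hK k) := fun k =>
    lt_of_lt_of_le (by positivity) (hlead _ k.2)
  have hinv : (leadDiag hK lam)⁻¹ = Matrix.diagonal fun k => (lam (Fin.castLE hK k))⁻¹ := by
    refine Matrix.inv_eq_right_inv ?_
    rw [leadDiag, Matrix.diagonal_mul_diagonal, ← Matrix.diagonal_one]
    congr 1
    funext k
    exact mul_inv_cancel₀ (hpos k).ne'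
  rw [hinv, leadDiag, Matrix.diagonal_mul_diagonal, ← Matrix.diagonal_one, Matrix.diagonal_sub]
  by_cases hij : i = j
  · subst hij
    rw [Matrix.diagonal_apply_eq]
    set k := Fin.castLE hK i
    have h1 := eigenvalue_sub_le hA hS hs hE k
    have h2 : L k * (lam k)⁻¹ - 1 = (L k - lam k) / lam k := by
      have : lam k ≠ 0 := (hpos i).ne'
      rw [sub_div, div_self this, div_eq_mul_inv]
    rw [h2, abs_div, abs_of_pos (hpos i)]
    calc _ ≤ (s * p) / (δ * p) := div_le_div₀ (by positivity) h1 (by positivity) (hlead k i.2)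
      _ = _ := by field_simp
  · rw [Matrix.diagonal_apply_ne _ hij, abs_zero]
    positivity

end EigenPerturbation

/-! ### The model in the eigenbasis of the scatter matrix -/

section Coordinates

variable {p : ℕ} {A Γ : Matrix (Fin p) (Fin p) ℝ} {lam : Fin p → ℝ}

open scoped MatrixOrder Matrix.Norms.L2Operator in
theorem matrixSqrt_eq (h : IsEigenDecomp A Γ lam) (h0 : ∀ i, 0 ≤ lam i) :
    matrixSqrt A = Γ * Matrix.diagonal (fun k => √(lam k)) * Γᵀ := by
  refine CFC.sqrt_unique ?_ ?_
  · calc _ = Γ * Matrix.diagonal (fun k => √(lam k)) * (Γᵀ * Γ) *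
          Matrix.diagonal (fun k => √(lam k)) * Γᵀ := by simp only [Matrix.mul_assoc]
      _ = A := by
        rw [h.orth, Matrix.mul_one, Matrix.mul_assoc Γ, Matrix.diagonal_mul_diagonal, h.eq]
        congr 3
        funext k
        exact Real.mul_self_sqrt (h0 k)
  · rw [Matrix.nonneg_iff_posSemidef]
    have h1 : (Matrix.diagonal fun k => √(lam k)).PosSemidef :=
      Matrix.PosSemidef.diagonal fun k => Real.sqrt_nonneg _
    have h2 := h1.mul_mul_conjTranspose_same Γ
    rwa [Matrix.conjTranspose_eq_transpose_of_trivial] at h2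

/-- The vector of loadings `Λ^{1/2} Γᵀ e_i` of coordinate `i`. -/
noncomputable def loading (Γ : Matrix (Fin p) (Fin p) ℝ) (lam : Fin p → ℝ) (i : Fin p) :
    EuclideanSpace ℝ (Fin p) :=
  WithLp.toLp 2 fun k => Γ i k * √(lam k)

theorem inner_loading (h : IsEigenDecomp A Γ lam) (h0 : ∀ i, 0 ≤ lam i) (i j : Fin p) :
    inner ℝ (loading Γ lam i) (loading Γ lam j) = A i j := by
  rw [h.eq, Matrix.mul_apply]
  simp only [loading, PiLp.inner_apply, RCLike.inner_apply, conj_trivial, Matrix.mul_diagonal,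
    Matrix.transpose_apply]
  refine Finset.sum_congr rfl fun k _ => ?_
  calc _ = Γ i k * (√(lam k) * √(lam k)) * Γ j k := by ring
    _ = _ := by rw [Real.mul_self_sqrt (h0 k)]

theorem norm_loading_sq (h : IsEigenDecomp A Γ lam) (h0 : ∀ i, 0 ≤ lam i) (i : Fin p) :
    ‖loading Γ lam i‖ ^ 2 = A i i := by
  rw [← real_inner_self_eq_norm_sq, inner_loading h h0]

/-- Multiplication by `Γᵀ` as a linear isometry of Euclidean space. -/
noncomputable def transposeIsometry (h : IsEigenDecomp A Γ lam) :
    EuclideanSpace ℝ (Fin p) ≃ₗᵢ[ℝ] EuclideanSpace ℝ (Fin p) :=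
  LinearIsometry.toLinearIsometryEquiv
    { toLinearMap := Matrix.toEuclideanLin Γᵀ
      norm_map' := fun x => by
        rw [← sq_eq_sq₀ (norm_nonneg _) (norm_nonneg _), EuclideanSpace.real_norm_sq_eq,
          EuclideanSpace.real_norm_sq_eq]
        exact (h.sum_sq x.ofLp).trans (Finset.sum_congr rfl fun i _ => (sq _).symm) } rfl

theorem transposeIsometry_apply (h : IsEigenDecomp A Γ lam) (x : EuclideanSpace ℝ (Fin p)) :
    (transposeIsometry h x).ofLp = Γᵀ *ᵥ x.ofLp := rfl

/-- The standardized noise `√p Γ Λ^{1/2} w` of the direction `w`, in the original coordinates. -/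
noncomputable def noise (Γ : Matrix (Fin p) (Fin p) ℝ) (lam : Fin p → ℝ)
    (w : EuclideanSpace ℝ (Fin p)) (i : Fin p) : ℝ :=
  √p * inner ℝ (loading Γ lam i) w

theorem noise_eq_mulVec (w : EuclideanSpace ℝ (Fin p)) :
    noise Γ lam w = Γ *ᵥ fun k => √p * (√(lam k) * w k) := by
  funext i
  simp only [noise, loading, PiLp.inner_apply, RCLike.inner_apply, conj_trivial, Matrix.mulVec,
    dotProduct, Finset.mul_sum]
  refine Finset.sum_congr rfl fun k _ => ?_
  ring

theorem ellipticalObs_eq (h : IsEigenDecomp A Γ lam) (h0 : ∀ i, 0 ≤ lam i) {n : ℕ}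
    (μ : Fin p → ℝ) (ξ : Fin n → ℝ) (u : Fin n → EuclideanSpace ℝ (Fin p)) (t : Fin n) :
    ellipticalObs μ A ξ u t = μ + ξ t • noise Γ lam (transposeIsometry h (u t)) := by
  rw [noise_eq_mulVec, ellipticalObs, matrixSqrt_eq h h0, ← Matrix.mulVec_mulVec,
    ← Matrix.mulVec_mulVec, ← transposeIsometry_apply h]
  congr 1
  rw [← Matrix.mulVec_smul Γ (√(p : ℝ) * ξ t), ← Matrix.mulVec_smul Γ (ξ t)]
  congr 1
  funext k
  simp only [Pi.smul_apply, smul_eq_mul, Matrix.mulVec_diagonal]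
  ring

theorem transpose_mulVec_noise (h : IsEigenDecomp A Γ lam) (w : EuclideanSpace ℝ (Fin p))
    (k : Fin p) : (Γᵀ *ᵥ noise Γ lam w) k = √p * (√(lam k) * w k) := by
  rw [noise_eq_mulVec, Matrix.mulVec_mulVec, h.orth, Matrix.one_mulVec]

theorem noise_smul_sub (w w' : EuclideanSpace ℝ (Fin p)) (a b : ℝ) :
    noise Γ lam (a • w - b • w') = a • noise Γ lam w - b • noise Γ lam w' := by
  funext i
  simp only [noise, inner_sub_right, inner_smul_right, Pi.sub_apply, Pi.smul_apply, smul_eq_mul]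
  ring

theorem l2norm_sq {a : ℕ} (v : Fin a → ℝ) : l2norm v ^ 2 = v ⬝ᵥ v := by
  rw [l2norm, Real.sq_sqrt (Finset.sum_nonneg fun _ _ => sq_nonneg _)]
  exact Finset.sum_congr rfl fun _ _ => sq _

theorem noise_dotProduct_self (h : IsEigenDecomp A Γ lam) (h0 : ∀ i, 0 ≤ lam i)
    (w : EuclideanSpace ℝ (Fin p)) :
    noise Γ lam w ⬝ᵥ noise Γ lam w = p * ∑ k, lam k * w k ^ 2 := by
  rw [← h.sum_sq, Finset.mul_sum]
  refine Finset.sum_congr rfl fun k _ => ?_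
  rw [transpose_mulVec_noise h, mul_pow, mul_pow, Real.sq_sqrt (Nat.cast_nonneg p),
    Real.sq_sqrt (h0 k)]

/-- In the eigenbasis, one summand of spatial Kendall's tau is `shapeKernel`. -/
theorem conj_vecMulVec_noise (h : IsEigenDecomp A Γ lam) (h0 : ∀ i, 0 ≤ lam i)
    (w : EuclideanSpace ℝ (Fin p)) (k l : Fin p) :
    1 / l2norm (noise Γ lam w) ^ 2 * ((Γᵀ *ᵥ noise Γ lam w) k * (Γᵀ *ᵥ noise Γ lam w) l) =
      shapeKernel lam w k l := by
  have hp : (p : ℝ) ≠ 0 := by exact_mod_cast k.pos.ne'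
  rw [transpose_mulVec_noise h, transpose_mulVec_noise h, l2norm_sq, noise_dotProduct_self h h0,
    shapeKernel]
  calc _ = (√p * √p) * (√(lam k) * w k * (√(lam l) * w l)) /
        (p * ∑ i, lam i * w i ^ 2) := by ring
    _ = _ := by rw [Real.mul_self_sqrt (Nat.cast_nonneg p), mul_div_mul_left _ _ hp]

theorem conj_vecMulVec (x y : Fin p → ℝ) (k l : Fin p) :
    (Γᵀ * Matrix.vecMulVec x y * Γ) k l = (Γᵀ *ᵥ x) k * (Γᵀ *ᵥ y) l := by
  rw [Matrix.mul_vecMulVec, Matrix.vecMulVec_mul, Matrix.vecMulVec_apply, Matrix.mulVec_transpose Γ y]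

theorem sum_prod_eq_two_mul_sum_Ioi {n : ℕ} {f : Fin n → Fin n → ℝ} (h0 : ∀ i, f i i = 0)
    (hs : ∀ i j, f i j = f j i) :
    ∑ a : Fin n × Fin n, f a.1 a.2 = 2 * ∑ i, ∑ j ∈ Finset.Ioi i, f i j := by
  have e1 : ∀ i j, f i j = (if i < j then f i j else 0) + if j < i then f i j else 0 := by
    intro i j
    rcases lt_trichotomy i j with h | h | h
    · simp [h, h.not_gt]
    · subst h; simp [h0]
    · simp [h, h.not_gt]
  have e2 : ∑ i, ∑ j, (if j < i then f i j else 0) = ∑ i, ∑ j, if i < j then f i j else 0 := by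
    rw [Finset.sum_comm]
    exact Finset.sum_congr rfl fun i _ => Finset.sum_congr rfl fun j _ => by rw [hs j i]
  have e3 : ∑ i, ∑ j ∈ Finset.Ioi i, f i j = ∑ i, ∑ j, if i < j then f i j else 0 := by
    refine Finset.sum_congr rfl fun i _ => ?_
    rw [← Finset.sum_filter]
    congr 1
    ext j
    simp
  rw [Fintype.sum_prod_type, e3, two_mul]
  conv_rhs => arg 2; rw [← e2]
  rw [← Finset.sum_add_distrib]
  refine Finset.sum_congr rfl fun i _ => ?_
  rw [← Finset.sum_add_distrib]
  exact Finset.sum_congr rfl fun j _ => e1 i j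

/-- Spatial Kendall's tau of the elliptical sample, in the eigenbasis. -/
theorem conj_kendallTau (h : IsEigenDecomp A Γ lam) (h0 : ∀ i, 0 ≤ lam i) {n : ℕ}
    (μ : Fin p → ℝ) (ξ : Fin n → ℝ) (u : Fin n → EuclideanSpace ℝ (Fin p)) (k l : Fin p) :
    (Γᵀ * kendallTau (ellipticalObs μ A ξ u) * Γ) k l =
      1 / ((n : ℝ) * ((n : ℝ) - 1)) *
        kendallSum lam ξ (fun t => transposeIsometry h (u t)) k l := by
  have hd : ∀ i j, ellipticalObs μ A ξ u i - ellipticalObs μ A ξ u j =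
      noise Γ lam (ξ i • transposeIsometry h (u i) - ξ j • transposeIsometry h (u j)) := by
    intro i j
    rw [ellipticalObs_eq h h0, ellipticalObs_eq h h0, noise_smul_sub]
    abel
  have hk : ∀ i j, (Γᵀ * ((1 / l2norm (ellipticalObs μ A ξ u i - ellipticalObs μ A ξ u j) ^ 2) •
      Matrix.vecMulVec (ellipticalObs μ A ξ u i - ellipticalObs μ A ξ u j)
        (ellipticalObs μ A ξ u i - ellipticalObs μ A ξ u j)) * Γ) k l =
      shapeKernel lam (ξ i • transposeIsometry h (u i) - ξ j • transposeIsometry h (u j)) k l := by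
    intro i j
    rw [hd, Matrix.mul_smul, Matrix.smul_mul, Matrix.smul_apply, conj_vecMulVec, smul_eq_mul,
      conj_vecMulVec_noise h h0]
  rw [kendallTau, Matrix.mul_smul, Matrix.smul_mul, Matrix.smul_apply, smul_eq_mul]
  have : (Γᵀ * (∑ i, ∑ j ∈ Finset.Ioi i,
      (1 / l2norm (ellipticalObs μ A ξ u i - ellipticalObs μ A ξ u j) ^ 2) •
      Matrix.vecMulVec (ellipticalObs μ A ξ u i - ellipticalObs μ A ξ u j)
        (ellipticalObs μ A ξ u i - ellipticalObs μ A ξ u j)) * Γ) k l =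
      ∑ i, ∑ j ∈ Finset.Ioi i, shapeKernel lam
        (ξ i • transposeIsometry h (u i) - ξ j • transposeIsometry h (u j)) k l := by
    simp only [Matrix.mul_sum, Matrix.sum_mul, Matrix.sum_apply, hk]
  rw [this, kendallSum, sum_prod_eq_two_mul_sum_Ioi (f := fun i j => shapeKernel lam
        (ξ i • transposeIsometry h (u i) - ξ j • transposeIsometry h (u j)) k l)]
  · ring
  · intro i
    simp [shapeKernel_zero]
  · intro i j
    rw [← neg_sub, ← neg_one_smul ℝ, shapeKernel_smul _ _ _ _ (by norm_num)]

end Coordinates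

/-! ### Leading eigenspace of spatial Kendall's tau and the projection off it -/

section Projection

variable {p K : ℕ} {A Γ T G : Matrix (Fin p) (Fin p) ℝ} {lam L : Fin p → ℝ}

theorem abs_dotProduct_mulVec_le_frobenius {E : Matrix (Fin p) (Fin p) ℝ} {F : ℝ} (hF : 0 ≤ F)
    (hE : ∑ kl : Fin p × Fin p, E kl.1 kl.2 ^ 2 ≤ F ^ 2) (x : Fin p → ℝ) :
    |x ⬝ᵥ E *ᵥ x| ≤ F * (x ⬝ᵥ x) := by
  have h1 : (E *ᵥ x) ⬝ᵥ (E *ᵥ x) ≤ F ^ 2 * (x ⬝ᵥ x) := by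
    rw [Fintype.sum_prod_type] at hE
    calc _ ≤ ∑ k, (∑ l, E k l ^ 2) * (x ⬝ᵥ x) := Finset.sum_le_sum fun k _ => by
          have := dotProduct_sq_le (E k) x
          simp only [dotProduct, ← sq] at this ⊢
          exact this
      _ = (∑ k, ∑ l, E k l ^ 2) * (x ⬝ᵥ x) := by rw [Finset.sum_mul]
      _ ≤ _ := mul_le_mul_of_nonneg_right hE (dotProduct_self_nonneg' x)
  have hx := dotProduct_self_nonneg' x
  refine abs_le_of_sq_le_sq ?_ (mul_nonneg hF hx)
  calc _ ≤ (x ⬝ᵥ x) * ((E *ᵥ x) ⬝ᵥ (E *ᵥ x)) := dotProduct_sq_le _ _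
    _ ≤ (x ⬝ᵥ x) * (F ^ 2 * (x ⬝ᵥ x)) := mul_le_mul_of_nonneg_left h1 hx
    _ = _ := by ring

/-- A sin-theta bound: if `T` is, in the basis `Γ`, within Frobenius distance `F` of a diagonal
matrix whose first `K` entries exceed the others by a margin, then its leading eigenvectors are
almost orthogonal to the trailing columns of `Γ`. -/
theorem sum_trailing_sq_le (hK : K ≤ p) (hA : IsEigenDecomp A Γ lam) (hT : IsEigenDecomp T G L)
    {t : Fin p → ℝ} {F τ : ℝ} (hF : 0 ≤ F) (hτ : 0 < τ)
    (hE : ∑ kl : Fin p × Fin p, ((Γᵀ * T * Γ - Matrix.diagonal t) kl.1 kl.2) ^ 2 ≤ F ^ 2)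
    (hlead : ∀ k : Fin p, (k : ℕ) < K → τ ≤ t k)
    (htrail : ∀ k : Fin p, K ≤ (k : ℕ) → t k + F ≤ τ / 2) {k : Fin p} (hk : (k : ℕ) < K) :
    ∑ j : Fin p, (if (j : ℕ) < K then 0 else (Γ.col j ⬝ᵥ G.col k) ^ 2) ≤ (2 * F / τ) ^ 2 := by
  obtain ⟨E, hEdef⟩ : ∃ E, E = Γᵀ * T * Γ - Matrix.diagonal t := ⟨_, rfl⟩
  rw [← hEdef] at hE
  have hN : Γᵀ * T * Γ = E + Matrix.diagonal t := by rw [hEdef]; abel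
  have hLk : τ - F ≤ L k := by
    refine hT.le_eigenvalue (V := leadCols hK Γ) (leadCols_orth hK hA.orth) (fun c => ?_) hk
    set c' : Fin p → ℝ := fun j => if h : (j : ℕ) < K then c ⟨j, h⟩ else 0 with hc'
    have hsum : ∀ f : Fin p → ℝ, (∀ j : Fin p, K ≤ (j : ℕ) → f j = 0) →
        ∑ j, f j = ∑ l : Fin K, f (Fin.castLE hK l) := fun f hf => by
      rw [sum_castLE hK f]
      refine Finset.sum_congr rfl fun j _ => ?_
      split_ifs with h
      · rfl
      · exact hf j (not_lt.1 h)
    have hcc : ∀ l : Fin K, c' (Fin.castLE hK l) = c l := fun l => by simp [hc']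
    have hc0 : ∀ j : Fin p, K ≤ (j : ℕ) → c' j = 0 := fun j hj => by simp [hc', not_lt.2 hj]
    have h1 : leadCols hK Γ *ᵥ c = Γ *ᵥ c' := by
      funext i
      simp only [Matrix.mulVec, dotProduct]
      rw [hsum _ fun j hj => by rw [hc0 j hj, mul_zero]]
      exact Finset.sum_congr rfl fun l _ => by rw [hcc]; rfl
    have h2 : c ⬝ᵥ c = c' ⬝ᵥ c' := by
      simp only [dotProduct]
      rw [hsum _ fun j hj => by rw [hc0 j hj, mul_zero]]
      exact Finset.sum_congr rfl fun l _ => by rw [hcc]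
    have h3 : (Γ *ᵥ c') ⬝ᵥ T *ᵥ (Γ *ᵥ c') = c' ⬝ᵥ E *ᵥ c' + ∑ j, t j * c' j ^ 2 := by
      have e : (Γ *ᵥ c') ⬝ᵥ T *ᵥ (Γ *ᵥ c') = c' ⬝ᵥ (Γᵀ * T * Γ) *ᵥ c' := by
        rw [Matrix.mul_assoc, ← Matrix.mulVec_mulVec, ← Matrix.mulVec_mulVec,
          Matrix.dotProduct_mulVec c', ← Matrix.mulVec_transpose, Matrix.transpose_transpose]
      rw [e, hN, Matrix.add_mulVec, dotProduct_add]
      congr 1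
      simp only [dotProduct, Matrix.mulVec_diagonal]
      exact Finset.sum_congr rfl fun j _ => by ring
    have h4 : τ * (c' ⬝ᵥ c') ≤ ∑ j, t j * c' j ^ 2 := by
      rw [dotProduct, Finset.mul_sum]
      refine Finset.sum_le_sum fun j _ => ?_
      by_cases hj : (j : ℕ) < K
      · nlinarith [hlead j hj, sq_nonneg (c' j)]
      · rw [hc0 j (not_lt.1 hj)]
        simp
    have h5 := (abs_le.1 (abs_dotProduct_mulVec_le_frobenius hF hE c')).1
    rw [h1, h2, h3]
    linarith
  set x : Fin p → ℝ := Γᵀ *ᵥ G.col k with hx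
  have hxx : x ⬝ᵥ x = 1 := by
    have h1 := hA.sum_sq (G.col k)
    rw [hT.col_dotProduct, if_pos rfl] at h1
    rw [← h1]
    exact Finset.sum_congr rfl fun j _ => (sq _).symm
  -- the eigenvalue equation in the basis `Γ`
  have heq : (Γᵀ * T * Γ) *ᵥ x = L k • x := by
    rw [hx, Matrix.mulVec_mulVec, Matrix.mul_assoc, hA.orth', Matrix.mul_one,
      ← Matrix.mulVec_mulVec, hT.mulVec_col, Matrix.mulVec_smul]
  have hj : ∀ j, (L k - t j) * x j = (E *ᵥ x) j := fun j => by
    have h1 := congrFun heq j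
    rw [hN, Matrix.add_mulVec] at h1
    simp only [Pi.add_apply, Matrix.mulVec_diagonal, Pi.smul_apply, smul_eq_mul] at h1
    linarith
  have hbound : ∑ j : Fin p, (if (j : ℕ) < K then 0 else x j ^ 2) * (τ / 2) ^ 2 ≤ F ^ 2 := by
    have h1 : ∀ j : Fin p, (if (j : ℕ) < K then 0 else x j ^ 2) * (τ / 2) ^ 2 ≤
        ∑ l, E j l ^ 2 := fun j => by
      split_ifs with h
      · rw [zero_mul]
        exact Finset.sum_nonneg fun _ _ => sq_nonneg _
      · have h2 : (E *ᵥ x) j ^ 2 ≤ ∑ l, E j l ^ 2 := by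
          have := dotProduct_sq_le (E j) x
          rw [hxx, mul_one] at this
          simp only [dotProduct, ← sq] at this
          exact this
        have h3 : τ / 2 ≤ L k - t j := by linarith [htrail j (not_lt.1 h)]
        rw [← hj j, mul_pow] at h2
        refine le_trans ?_ h2
        rw [mul_comm]
        exact mul_le_mul_of_nonneg_right (pow_le_pow_left₀ (by positivity) h3 2) (sq_nonneg _)
    rw [Fintype.sum_prod_type] at hE
    exact (Finset.sum_le_sum fun j _ => h1 j).trans hE
  have : ∑ j : Fin p, (if (j : ℕ) < K then 0 else (Γ.col j ⬝ᵥ G.col k) ^ 2) =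
      ∑ j : Fin p, (if (j : ℕ) < K then 0 else x j ^ 2) := rfl
  rw [this, div_pow, le_div_iff₀ (by positivity)]
  rw [← Finset.sum_mul] at hbound
  nlinarith

theorem l2norm_eq_norm {a : ℕ} (v : Fin a → ℝ) : l2norm v = ‖WithLp.toLp 2 v‖ := by
  rw [l2norm, EuclideanSpace.norm_eq]
  simp

theorem abs_l2norm_add_sub_le {a : ℕ} (v w : Fin a → ℝ) :
    |l2norm (v + w) - l2norm v| ≤ l2norm w := by
  simp only [l2norm_eq_norm, WithLp.toLp_add]
  have := abs_norm_sub_norm_le (WithLp.toLp 2 v + WithLp.toLp 2 w) (WithLp.toLp 2 v)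
  rwa [add_sub_cancel_left] at this

theorem l2norm_smul {a : ℕ} (c : ℝ) (v : Fin a → ℝ) : l2norm (c • v) = |c| * l2norm v := by
  simp only [l2norm_eq_norm, WithLp.toLp_smul, norm_smul, Real.norm_eq_abs]

theorem l2norm_nonneg {a : ℕ} (v : Fin a → ℝ) : 0 ≤ l2norm v := Real.sqrt_nonneg _

theorem l2norm_sum_le {a : ℕ} {ι : Type*} (s : Finset ι) (f : ι → Fin a → ℝ) :
    l2norm (∑ i ∈ s, f i) ≤ ∑ i ∈ s, l2norm (f i) := by
  simp only [l2norm_eq_norm, WithLp.toLp_sum]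
  exact norm_sum_le _ _

/-- A matrix with `p - K` orthonormal rows that annihilates `K` orthonormal vectors is an isometry
on their orthogonal complement. -/
theorem l2norm_proj_sq (hK : K ≤ p) {Pr : Matrix (Fin (p - K)) (Fin p) ℝ} (hPr : Pr * Prᵀ = 1)
    (hG : Gᵀ * G = 1) (hnull : Pr * leadCols hK G = 0) (v : Fin p → ℝ) :
    l2norm (Pr *ᵥ v) ^ 2 = v ⬝ᵥ v - ∑ k : Fin K, (G.col (Fin.castLE hK k) ⬝ᵥ v) ^ 2 := by
  set S : Matrix (Fin (p - K) ⊕ Fin K) (Fin p) ℝ := Matrix.fromRows Pr (leadCols hK G)ᵀ with hS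
  have h1 : S * Sᵀ = 1 := by
    have h2 : (leadCols hK G)ᵀ * Prᵀ = 0 := by rw [← Matrix.transpose_mul, hnull, Matrix.transpose_zero]
    rw [hS, Matrix.transpose_fromRows, Matrix.fromRows_mul_fromCols, hPr, Matrix.transpose_transpose,
      hnull, h2, leadCols_orth hK hG, Matrix.fromBlocks_one]
  have h3 : Sᵀ * S = 1 := by
    refine (Matrix.mul_eq_one_comm_of_card_eq _ _ _ ?_).1 h1
    simp only [Fintype.card_sum, Fintype.card_fin]
    omega
  have h4 : (S *ᵥ v) ⬝ᵥ (S *ᵥ v) = v ⬝ᵥ v := by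
    rw [Matrix.dotProduct_mulVec, Matrix.vecMul_mulVec, ← Matrix.dotProduct_mulVec, h3,
      Matrix.one_mulVec]
  rw [hS, Matrix.fromRows_mulVec, dotProduct, Fintype.sum_sum_type] at h4
  rw [l2norm_sq, ← h4, dotProduct]
  have h5 : ∀ k : Fin K, ((leadCols hK G)ᵀ *ᵥ v) k = G.col (Fin.castLE hK k) ⬝ᵥ v := fun k => rfl
  simp only [Sum.elim_inl, Sum.elim_inr, h5, ← sq]
  ring

/-- The component of `v` orthogonal to the first `K` columns of `Γ`. -/
noncomputable def trailPart (hK : K ≤ p) (Γ : Matrix (Fin p) (Fin p) ℝ) (v : Fin p → ℝ) :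
    Fin p → ℝ :=
  v - ∑ k : Fin K, (Γ.col (Fin.castLE hK k) ⬝ᵥ v) • Γ.col (Fin.castLE hK k)

theorem trailPart_add (hK : K ≤ p) (v w : Fin p → ℝ) :
    trailPart hK Γ (v + w) = trailPart hK Γ v + trailPart hK Γ w := by
  simp only [trailPart, dotProduct_add, add_smul, Finset.sum_add_distrib]
  abel

theorem col_dotProduct_trailPart (hK : K ≤ p) (hA : IsEigenDecomp A Γ lam) (v : Fin p → ℝ)
    (j : Fin p) : Γ.col j ⬝ᵥ trailPart hK Γ v = if (j : ℕ) < K then 0 else Γ.col j ⬝ᵥ v := by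
  rw [trailPart, dotProduct_sub, dotProduct_sum]
  simp only [dotProduct_smul, smul_eq_mul, hA.col_dotProduct]
  rw [sum_castLE hK fun l => (Γ.col l ⬝ᵥ v) * if j = l then (1 : ℝ) else 0]
  have : ∀ l : Fin p, (if (l : ℕ) < K then (Γ.col l ⬝ᵥ v) * (if j = l then (1 : ℝ) else 0) else 0) =
      if j = l then (if (j : ℕ) < K then Γ.col j ⬝ᵥ v else 0) else 0 := fun l => by
    by_cases h : j = l
    · subst h; simp
    · simp [h]
  simp only [this, Finset.sum_ite_eq, Finset.mem_univ, if_true]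
  split_ifs <;> ring

theorem l2norm_trailPart_sq (hK : K ≤ p) (hA : IsEigenDecomp A Γ lam) (v : Fin p → ℝ) :
    l2norm (trailPart hK Γ v) ^ 2 = ∑ j : Fin p, if (j : ℕ) < K then 0 else (Γ.col j ⬝ᵥ v) ^ 2 := by
  rw [l2norm_sq, ← hA.sum_col_dotProduct_sq]
  refine Finset.sum_congr rfl fun j _ => ?_
  rw [col_dotProduct_trailPart hK hA]
  split_ifs <;> simp

theorem l2norm_trailPart_le (hK : K ≤ p) (hA : IsEigenDecomp A Γ lam) (v : Fin p → ℝ) :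
    l2norm (trailPart hK Γ v) ≤ l2norm v := by
  refine le_of_pow_le_pow_left₀ two_ne_zero (l2norm_nonneg _) ?_
  rw [l2norm_trailPart_sq hK hA, l2norm_sq, ← hA.sum_col_dotProduct_sq]
  refine Finset.sum_le_sum fun j _ => ?_
  split_ifs
  · exact sq_nonneg _
  · exact le_rfl

/-- If the annihilated vectors nearly span the first `K` columns of `Γ`, then the projected length
of a vector is close to the length of its trailing part. -/
theorem abs_l2norm_proj_sub_le (hK : K ≤ p) (hA : IsEigenDecomp A Γ lam)
    {Pr : Matrix (Fin (p - K)) (Fin p) ℝ} (hPr : Pr * Prᵀ = 1) (hG : Gᵀ * G = 1)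
    (hnull : Pr * leadCols hK G = 0) {θ₀ θ : ℝ} (hθ0 : 0 ≤ θ) (hθ1 : θ ≤ 1)
    (hθ : K * θ₀ ^ 2 ≤ θ ^ 2)
    (htrail : ∀ k : Fin p, (k : ℕ) < K →
      ∑ j : Fin p, (if (j : ℕ) < K then 0 else (Γ.col j ⬝ᵥ G.col k) ^ 2) ≤ θ₀ ^ 2)
    (v : Fin p → ℝ) :
    |l2norm (Pr *ᵥ v) - l2norm (trailPart hK Γ v)| ≤ θ * l2norm (trailPart hK Γ v) +
      θ * ∑ k : Fin K, |Γ.col (Fin.castLE hK k) ⬝ᵥ v| := by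
  have hlead : ∀ k : Fin K, l2norm (Pr *ᵥ Γ.col (Fin.castLE hK k)) ≤ θ := fun k => by
    refine le_of_pow_le_pow_left₀ two_ne_zero hθ0 (le_trans ?_ hθ)
    have h1 : ∀ l : Fin K, 1 - ∑ j : Fin K, (Γ.col (Fin.castLE hK j) ⬝ᵥ G.col (Fin.castLE hK l)) ^ 2
        ≤ θ₀ ^ 2 := fun l => by
      refine le_trans (le_of_eq ?_) (htrail (Fin.castLE hK l) l.2)
      have h2 := hA.sum_col_dotProduct_sq (G.col (Fin.castLE hK l))
      have h3 : G.col (Fin.castLE hK l) ⬝ᵥ G.col (Fin.castLE hK l) = 1 := by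
        have := congrFun (congrFun hG (Fin.castLE hK l)) (Fin.castLE hK l)
        rw [Matrix.one_apply_eq] at this
        exact this
      rw [← h3, ← h2, sum_castLE hK fun j => (Γ.col j ⬝ᵥ G.col (Fin.castLE hK l)) ^ 2,
        ← Finset.sum_sub_distrib]
      refine Finset.sum_congr rfl fun j _ => ?_
      split_ifs <;> ring
    have h4 : ∀ j : Fin K, l2norm (Pr *ᵥ Γ.col (Fin.castLE hK j)) ^ 2 = 1 -
        ∑ l : Fin K, (Γ.col (Fin.castLE hK j) ⬝ᵥ G.col (Fin.castLE hK l)) ^ 2 := fun j => by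
      rw [l2norm_proj_sq hK hPr hG hnull, hA.col_dotProduct, if_pos rfl]
      simp only [dotProduct_comm]
    calc _ ≤ ∑ j : Fin K, l2norm (Pr *ᵥ Γ.col (Fin.castLE hK j)) ^ 2 :=
          Finset.single_le_sum (f := fun j : Fin K => l2norm (Pr *ᵥ Γ.col (Fin.castLE hK j)) ^ 2)
            (fun _ _ => sq_nonneg _) (Finset.mem_univ k)
      _ = ∑ l : Fin K, (1 - ∑ j : Fin K,
            (Γ.col (Fin.castLE hK j) ⬝ᵥ G.col (Fin.castLE hK l)) ^ 2) := by
          simp only [h4, Finset.sum_sub_distrib]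
          rw [Finset.sum_comm]
      _ ≤ ∑ _l : Fin K, θ₀ ^ 2 := Finset.sum_le_sum fun l _ => h1 l
      _ = _ := by simp
  set v₂ := trailPart hK Γ v with hv₂
  have hn := l2norm_nonneg v₂
  have hproj := l2norm_proj_sq hK hPr hG hnull v₂
  have hup : l2norm (Pr *ᵥ v₂) ≤ l2norm v₂ := by
    refine le_of_pow_le_pow_left₀ two_ne_zero hn ?_
    rw [hproj, l2norm_sq]
    linarith [Finset.sum_nonneg fun (k : Fin K) (_ : k ∈ Finset.univ) =>
      sq_nonneg (G.col (Fin.castLE hK k) ⬝ᵥ v₂)]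
  have hlow : l2norm v₂ - θ * l2norm v₂ ≤ l2norm (Pr *ᵥ v₂) := by
    have h1 : ∀ k : Fin K, (G.col (Fin.castLE hK k) ⬝ᵥ v₂) ^ 2 ≤ θ₀ ^ 2 * l2norm v₂ ^ 2 := fun k => by
      -- only the trailing component of `G.col k` meets `v₂`
      have h2 : G.col (Fin.castLE hK k) ⬝ᵥ v₂ = trailPart hK Γ (G.col (Fin.castLE hK k)) ⬝ᵥ v₂ := by
        rw [trailPart, sub_dotProduct, sum_dotProduct]
        simp only [smul_dotProduct, hv₂, col_dotProduct_trailPart hK hA]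
        simp
      rw [h2, l2norm_sq]
      refine (dotProduct_sq_le _ _).trans (mul_le_mul_of_nonneg_right ?_ (dotProduct_self_nonneg' _))
      rw [← l2norm_sq, l2norm_trailPart_sq hK hA]
      exact htrail _ k.2
    have h3 : ∑ k : Fin K, (G.col (Fin.castLE hK k) ⬝ᵥ v₂) ^ 2 ≤ θ ^ 2 * l2norm v₂ ^ 2 := by
      calc _ ≤ ∑ _k : Fin K, θ₀ ^ 2 * l2norm v₂ ^ 2 := Finset.sum_le_sum fun k _ => h1 k
        _ = K * θ₀ ^ 2 * l2norm v₂ ^ 2 := by simp [mul_assoc]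
        _ ≤ _ := mul_le_mul_of_nonneg_right hθ (sq_nonneg _)
    refine le_of_pow_le_pow_left₀ two_ne_zero (l2norm_nonneg _) ?_
    rw [hproj, ← l2norm_sq]
    have h4 : 0 ≤ θ * (1 - θ) * l2norm v₂ ^ 2 :=
      mul_nonneg (mul_nonneg hθ0 (by linarith)) (sq_nonneg _)
    nlinarith
  have hdec : Pr *ᵥ v = Pr *ᵥ v₂ +
      ∑ k : Fin K, (Γ.col (Fin.castLE hK k) ⬝ᵥ v) • (Pr *ᵥ Γ.col (Fin.castLE hK k)) := by
    have h1 : v = v₂ + ∑ k : Fin K, (Γ.col (Fin.castLE hK k) ⬝ᵥ v) • Γ.col (Fin.castLE hK k) := by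
      rw [hv₂, trailPart]
      abel
    conv_lhs => rw [h1]
    rw [Matrix.mulVec_add, Matrix.mulVec_sum]
    simp only [Matrix.mulVec_smul]
  have hrest : l2norm (∑ k : Fin K, (Γ.col (Fin.castLE hK k) ⬝ᵥ v) •
      (Pr *ᵥ Γ.col (Fin.castLE hK k))) ≤ θ * ∑ k : Fin K, |Γ.col (Fin.castLE hK k) ⬝ᵥ v| := by
    rw [Finset.mul_sum]
    refine (l2norm_sum_le _ _).trans (Finset.sum_le_sum fun k _ => ?_)
    rw [l2norm_smul, mul_comm]
    exact mul_le_mul_of_nonneg_right (hlead k) (abs_nonneg _)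
  have hfin := (abs_l2norm_add_sub_le (Pr *ᵥ v₂) _).trans hrest
  rw [← hdec] at hfin
  rw [abs_le] at hfin ⊢
  constructor <;> linarith [hfin.1, hfin.2, mul_nonneg hθ0 hn]

end Projection

/-! ### Error of the trace-normalized second moment matrix -/

section SecondMoment

variable {n p : ℕ}

theorem abs_weighted_mul_sub_le {q a b d e r : ℝ} (hr : 0 ≤ r) (hr1 : r ≤ 1) (hq : |q - 1| ≤ r)
    (hd : |d| ≤ r) (he : |e| ≤ r) :
    |q * ((a + d) * (b + e)) - a * b| ≤ r * (3 / 2 * (a ^ 2 + b ^ 2) + 4) := by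
  have hd2 : d ^ 2 ≤ r ^ 2 := by rw [← sq_abs d]; exact pow_le_pow_left₀ (abs_nonneg _) hd 2
  have he2 : e ^ 2 ≤ r ^ 2 := by rw [← sq_abs e]; exact pow_le_pow_left₀ (abs_nonneg _) he 2
  have h1 : |(a + d) * (b + e)| ≤ a ^ 2 + b ^ 2 + 2 * r ^ 2 := by
    rw [abs_le]
    constructor <;>
      nlinarith [sq_nonneg (a + d + (b + e)), sq_nonneg (a + d - (b + e)), sq_nonneg (a - d),
        sq_nonneg (b - e)]
  have h2 : |a * e| ≤ r * (a ^ 2 / 2 + 1 / 2) := by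
    rw [abs_mul]
    have : |a| ≤ a ^ 2 / 2 + 1 / 2 := by
      rw [← sq_abs a]
      nlinarith [sq_nonneg (|a| - 1)]
    calc _ ≤ |a| * r := mul_le_mul_of_nonneg_left he (abs_nonneg _)
      _ ≤ _ := by rw [mul_comm]; exact mul_le_mul_of_nonneg_left this hr
  have h3 : |d * b| ≤ r * (b ^ 2 / 2 + 1 / 2) := by
    rw [abs_mul]
    have : |b| ≤ b ^ 2 / 2 + 1 / 2 := by
      rw [← sq_abs b]
      nlinarith [sq_nonneg (|b| - 1)]
    exact mul_le_mul hd this (abs_nonneg _) hr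
  have h4 : |d * e| ≤ r * r := by
    rw [abs_mul]
    exact mul_le_mul hd he (abs_nonneg _) hr
  have h5 : |(q - 1) * ((a + d) * (b + e))| ≤ r * (a ^ 2 + b ^ 2 + 2 * r ^ 2) := by
    rw [abs_mul]
    exact mul_le_mul hq h1 (abs_nonneg _) hr
  have e1 : q * ((a + d) * (b + e)) - a * b =
      (q - 1) * ((a + d) * (b + e)) + (a * e + d * b + d * e) := by ring
  rw [e1]
  have h6 := abs_add_le ((q - 1) * ((a + d) * (b + e))) (a * e + d * b + d * e)
  have h7 := abs_add_le (a * e + d * b) (d * e)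
  have h8 := abs_add_le (a * e) (d * b)
  have h9 : r * r ^ 2 ≤ r * 1 := mul_le_mul_of_nonneg_left (by nlinarith) hr
  have h10 : r * r ≤ r * 1 := mul_le_mul_of_nonneg_left hr1 hr
  linarith

/-- Normalizing the trace removes the unknown scale `κ`. -/
theorem abs_traceNormalized_sub_le (hn : 0 < n) {X a d : Fin n → Fin p → ℝ} {D : Fin n → ℝ} {κ : ℝ}
    (hκ : 0 < κ)
    (hX : ∀ t i j, X t i * X t j = (D t)⁻¹ * ((a t i + d t i) * (a t j + d t j)))
    {S : Matrix (Fin p) (Fin p) ℝ} {C r : ℝ} (hC : 1 ≤ C) (hr : 0 ≤ r) (hr1 : 22 * C * r ≤ 1)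
    (hD : ∀ t, |κ / D t - 1| ≤ r) (hd : ∀ t i, |d t i| ≤ r)
    (hS : ∀ i j, |1 / (n : ℝ) * ∑ t, a t i * a t j - S i j| ≤ r) (hSC : ∀ i j, |S i j| ≤ C)
    (htr : S.trace = p) (i j : Fin p) : |(traceNormalized X - S) i j| ≤ 55 * C ^ 2 * r := by
  have hn' : (0 : ℝ) < n := by exact_mod_cast hn
  have hp' : (0 : ℝ) < p := by exact_mod_cast i.pos
  have hr2 : r ≤ 1 := by nlinarith
  set M := secondMoment X with hM
  have hMij : ∀ i j, κ * M i j = 1 / (n : ℝ) * ∑ t, κ / D t * ((a t i + d t i) * (a t j + d t j)) := by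
    intro i j
    rw [hM, secondMoment, Matrix.smul_apply, Matrix.sum_apply, smul_eq_mul, mul_left_comm,
      Finset.mul_sum]
    congr 1
    refine Finset.sum_congr rfl fun t _ => ?_
    rw [Matrix.vecMulVec_apply, hX, div_eq_mul_inv, mul_assoc]
  have hsq : ∀ i, 1 / (n : ℝ) * ∑ t, a t i ^ 2 ≤ 2 * C := fun i => by
    have h1 := (abs_le.1 (hS i i)).2
    have h2 := (abs_le.1 (hSC i i)).2
    simp only [← sq] at h1
    linarith
  have hdiff : ∀ i j, |κ * M i j - S i j| ≤ 11 * C * r := fun i j => by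
    have h1 : |κ * M i j - 1 / (n : ℝ) * ∑ t, a t i * a t j| ≤ r * (6 * C + 4) := by
      rw [hMij, ← mul_sub, ← Finset.sum_sub_distrib, abs_mul, abs_of_pos (by positivity)]
      calc _ ≤ 1 / (n : ℝ) * ∑ t, r * (3 / 2 * (a t i ^ 2 + a t j ^ 2) + 4) := by
            refine mul_le_mul_of_nonneg_left ?_ (by positivity)
            exact (Finset.abs_sum_le_sum_abs _ _).trans (Finset.sum_le_sum fun t _ =>
              abs_weighted_mul_sub_le hr hr2 (hD t) (hd t i) (hd t j))
        _ = r * (3 / 2 * (1 / (n : ℝ) * ∑ t, a t i ^ 2 + 1 / (n : ℝ) * ∑ t, a t j ^ 2) + 4) := by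
            rw [← Finset.mul_sum, Finset.sum_add_distrib, ← Finset.mul_sum, Finset.sum_add_distrib]
            simp only [Finset.sum_const, Finset.card_univ, Fintype.card_fin, nsmul_eq_mul]
            field_simp
        _ ≤ _ := by
            refine mul_le_mul_of_nonneg_left ?_ hr
            linarith [hsq i, hsq j]
    have h2 := abs_add_le (κ * M i j - 1 / (n : ℝ) * ∑ t, a t i * a t j)
      (1 / (n : ℝ) * ∑ t, a t i * a t j - S i j)
    rw [sub_add_sub_cancel] at h2
    have h3 := hS i j
    have h4 : r * 1 ≤ r * C := mul_le_mul_of_nonneg_left hC hr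
    linarith
  set r' := 11 * C * r with hr'
  have hr'0 : 0 ≤ r' := by positivity
  have hr'1 : r' ≤ 1 / 2 := by linarith
  have htrM : |κ * M.trace - p| ≤ r' * p := by
    have h1 : κ * M.trace - p = ∑ i, (κ * M i i - S i i) := by
      rw [← htr, Matrix.trace, Matrix.trace, Finset.mul_sum, ← Finset.sum_sub_distrib]
      rfl
    rw [h1]
    calc _ ≤ ∑ i, |κ * M i i - S i i| := Finset.abs_sum_le_sum_abs _ _
      _ ≤ ∑ _i : Fin p, r' := Finset.sum_le_sum fun i _ => hdiff i i
      _ = _ := by simp [mul_comm r']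
  set T := κ * M.trace with hT
  have hTlow : (p : ℝ) / 2 ≤ T := by
    have := (abs_le.1 htrM).1
    nlinarith
  have hTpos : 0 < T := lt_of_lt_of_le (by positivity) hTlow
  have htrpos : M.trace ≠ 0 := fun h0 => by
    rw [hT, h0, mul_zero] at hTpos
    exact lt_irrefl _ hTpos
  have hval : traceNormalized X i j = p / T * (κ * M i j) := by
    rw [traceNormalized, ← hM, Matrix.smul_apply, smul_eq_mul, hT]
    field_simp
  have hratio : |p / T - 1| ≤ 2 * r' := by
    have : (p : ℝ) / T - 1 = -(T - p) / T := by
      field_simp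
      ring
    rw [this, abs_div, abs_neg, abs_of_pos hTpos, div_le_iff₀ hTpos]
    nlinarith
  have hfin : (traceNormalized X - S) i j =
      (p / T - 1) * (κ * M i j) + (κ * M i j - S i j) := by
    rw [Matrix.sub_apply, hval]
    ring
  have hkM : |κ * M i j| ≤ 2 * C := by
    have h1 := abs_add_le (κ * M i j - S i j) (S i j)
    rw [sub_add_cancel] at h1
    linarith [hdiff i j, hSC i j]
  rw [hfin]
  have h2 : |(p / T - 1) * (κ * M i j)| ≤ 2 * r' * (2 * C) := by
    rw [abs_mul]
    exact mul_le_mul hratio hkM (abs_nonneg _) (by positivity)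
  have h3 := abs_add_le ((p / T - 1) * (κ * M i j)) (κ * M i j - S i j)
  have h4 := hdiff i j
  have h5 : r' * 1 ≤ r' * C := mul_le_mul_of_nonneg_left hC hr'0
  have h6 : 55 * C ^ 2 * r = 5 * (r' * C) := by rw [hr']; ring
  rw [h6]
  linarith

/-- From an error bound on `√D` to one on `κ / D`. -/
theorem abs_div_sq_sub_one_le {s β e : ℝ} (hβ : 0 < β) (he : |s - β| ≤ e) (heβ : e ≤ β / 2) :
    |β ^ 2 / s ^ 2 - 1| ≤ 10 * e / β := by
  have h1 := abs_le.1 he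
  have hs : β / 2 ≤ s := by linarith
  have hs0 : 0 < s := by linarith
  have he0 : 0 ≤ e := (abs_nonneg _).trans he
  have e1 : β ^ 2 / s ^ 2 - 1 = -((s - β) * (s + β)) / s ^ 2 := by
    field_simp
    ring
  rw [e1, abs_div, abs_neg, abs_mul, abs_of_pos (show 0 < s ^ 2 by positivity),
    abs_of_pos (show 0 < s + β by linarith)]
  calc _ ≤ e * (5 / 2 * β) / (β / 2) ^ 2 := by
        refine div_le_div₀ (by positivity) ?_ (by positivity) (by gcongr)
        exact mul_le_mul he (by linarith) (by linarith) he0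
    _ = _ := by field_simp; ring

end SecondMoment

/-! ### Deterministic error bound for the pilot scatter matrix -/

section Pilot

variable {n p K : ℕ} {A Γ G : Matrix (Fin p) (Fin p) ℝ} {lam L : Fin p → ℝ}

/-- When the matrix of sums of kernels is close to its mean, the leading eigenvectors of spatial
Kendall's tau are nearly orthogonal to the trailing columns of `Γ`. -/
theorem sum_trailing_sq_le_of_kendallSum (hK : K ≤ p) (hA : IsEigenDecomp A Γ lam)
    (htr : A.trace = p) {δ : ℝ} (hδ : 0 < δ)
    (hlead : ∀ i : Fin p, (i : ℕ) < K → δ * p ≤ lam i ∧ lam i ≤ p / δ)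
    (hidio : ∀ i : Fin p, K ≤ (i : ℕ) → δ ≤ lam i ∧ lam i ≤ 1 / δ)
    (hn : 2 ≤ n) (μ : Fin p → ℝ) {ξ : Fin n → ℝ} (hξ : ∀ t, 0 < ξ t)
    (u : Fin n → EuclideanSpace ℝ (Fin p)) {M : ℝ} (hM : 0 ≤ M)
    (hdev : ∑ kl : Fin p × Fin p, (kendallSum lam ξ (fun t => transposeIsometry hA (u t)) kl.1 kl.2 -
      kendallMean lam ξ kl.1 kl.2) ^ 2 ≤ M * n ^ 3)
    (hsmall : 2 / (δ ^ 2 * p) + 2 * √(M / n) ≤ δ ^ 3 / 24)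
    (hT : IsEigenDecomp (kendallTau (ellipticalObs μ A ξ u)) G L) {k : Fin p} (hk : (k : ℕ) < K) :
    ∑ j : Fin p, (if (j : ℕ) < K then 0 else (Γ.col j ⬝ᵥ G.col k) ^ 2) ≤
      (48 / δ ^ 3 * √(M / n)) ^ 2 := by
  have hp : 0 < p := k.pos
  have hp1 : (1 : ℝ) ≤ p := by exact_mod_cast hp
  have hlow : ∀ i, δ ≤ lam i := fun i => by
    rcases lt_or_ge (i : ℕ) K with h | h
    · exact le_trans (by nlinarith) (hlead i h).1
    · exact (hidio i h).1
  have h0 : ∀ i, 0 ≤ lam i := fun i => hδ.le.trans (hlow i)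
  have hsum : ∑ i, lam i = p := by
    rw [← htr, hA.eq, Matrix.trace_mul_comm, ← Matrix.mul_assoc, hA.orth, Matrix.one_mul,
      Matrix.trace_diagonal]
  have hn2 : (2 : ℝ) ≤ n := by exact_mod_cast hn
  set N : ℝ := n * (n - 1) with hN
  have hNpos : 0 < N := by rw [hN]; nlinarith
  have hNn : (n : ℝ) ^ 2 ≤ 2 * N := by rw [hN]; nlinarith
  have e : 48 / δ ^ 3 * √(M / n) = 2 * (2 * √(M / n)) / (δ ^ 3 / 12) := by
    field_simp
    ring
  rw [e]
  refine sum_trailing_sq_le hK hA hT (t := fun k => 1 / N * kendallMean lam ξ k k) (by positivity)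
    (by positivity) ?_ (fun i hi => ?_) (fun i hi => ?_) hk
  · have h1 : ∀ k l, (Γᵀ * kendallTau (ellipticalObs μ A ξ u) * Γ -
        Matrix.diagonal fun k => 1 / N * kendallMean lam ξ k k) k l = 1 / N *
        (kendallSum lam ξ (fun t => transposeIsometry hA (u t)) k l - kendallMean lam ξ k l) := by
      intro k l
      rw [Matrix.sub_apply, conj_kendallTau hA h0, ← hN]
      by_cases hkl : k = l
      · subst hkl
        rw [Matrix.diagonal_apply_eq, mul_sub]
      · rw [Matrix.diagonal_apply_ne _ hkl, kendallMean_offDiag hp h0 ξ hkl, sub_zero, sub_zero]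
    simp only [h1, mul_pow, ← Finset.mul_sum]
    rw [Real.sq_sqrt (by positivity)]
    calc _ ≤ (1 / N) ^ 2 * (M * n ^ 3) := mul_le_mul_of_nonneg_left hdev (by positivity)
      _ = M / n * (n ^ 2 / N) ^ 2 := by field_simp
      _ ≤ M / n * 2 ^ 2 := by
          gcongr
          rwa [div_le_iff₀ hNpos]
      _ = _ := by ring
  · have h1 := le_kendallMean hξ hδ h0 hsum (hlead i hi).1 (hlead i hi).2
    rw [one_div, inv_mul_eq_div, le_div_iff₀ hNpos]
    refine le_trans (le_of_eq ?_) h1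
    rw [hN]
    ring
  · have h1 := kendallMean_le ξ hδ hlow (hidio i hi).2
    have h2 : 1 / N * kendallMean lam ξ i i ≤ 2 / (δ ^ 2 * p) := by
      rw [one_div, inv_mul_eq_div, div_le_iff₀ hNpos]
      refine h1.trans ?_
      calc _ ≤ 2 * N * (1 / (δ ^ 2 * p)) := mul_le_mul_of_nonneg_right hNn (by positivity)
        _ = _ := by ring
    linarith

/-- The mean `κ` of the squared idiosyncratic length of the standardized noise. -/
noncomputable def idioScale (K : ℕ) (lam : Fin p → ℝ) : ℝ :=
  (∑ k : Fin p, if (k : ℕ) < K then 0 else lam k) / p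

theorem idioScale_mem (hp : 0 < p) (hKp : 2 * K ≤ p) {δ : ℝ} (hδ : 0 < δ)
    (hidio : ∀ i : Fin p, K ≤ (i : ℕ) → δ ≤ lam i ∧ lam i ≤ 1 / δ) :
    δ / 2 ≤ idioScale K lam ∧ idioScale K lam ≤ 1 / δ := by
  have hp' : (0 : ℝ) < p := by exact_mod_cast hp
  have hcount : ∑ k : Fin p, (if (k : ℕ) < K then δ else 0) = K * δ := by
    rw [← sum_castLE (show K ≤ p by omega) fun _ => δ]
    simp
  have hKp' : (2 * K : ℝ) ≤ p := by exact_mod_cast hKp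
  unfold idioScale
  constructor
  · rw [le_div_iff₀ hp']
    have h1 : ∑ k : Fin p, (δ - if (k : ℕ) < K then δ else 0) ≤
        ∑ k : Fin p, if (k : ℕ) < K then 0 else lam k := by
      refine Finset.sum_le_sum fun k _ => ?_
      split_ifs with h
      · simp
      · simpa using (hidio k (not_lt.1 h)).1
    rw [Finset.sum_sub_distrib, hcount] at h1
    simp only [Finset.sum_const, Finset.card_univ, Fintype.card_fin, nsmul_eq_mul] at h1
    nlinarith
  · rw [div_le_iff₀ hp']
    calc _ ≤ ∑ _k : Fin p, 1 / δ := by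
          refine Finset.sum_le_sum fun k _ => ?_
          split_ifs with h
          · positivity
          · exact (hidio k (not_lt.1 h)).2
      _ = _ := by simp [mul_comm]

theorem l2norm_le_of_abs_le {v : Fin p → ℝ} {c : ℝ} (hc : 0 ≤ c) (h : ∀ i, |v i| ≤ c) :
    l2norm v ≤ √p * c := by
  refine le_of_pow_le_pow_left₀ two_ne_zero (by positivity) ?_
  rw [l2norm_sq, mul_pow, Real.sq_sqrt (Nat.cast_nonneg p)]
  exact dotProduct_self_le_of_abs_le h

/-- The projected length of a noise vector with a small shift concentrates at `√κ`. -/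
theorem abs_l2norm_proj_div_sub_le (hK : K ≤ p) (hp : 0 < p) (hA : IsEigenDecomp A Γ lam)
    (h0 : ∀ i, 0 ≤ lam i) {Pr : Matrix (Fin (p - K)) (Fin p) ℝ} (hPr : Pr * Prᵀ = 1)
    (hG : Gᵀ * G = 1) (hnull : Pr * leadCols hK G = 0) {θ₀ θ : ℝ} (hθ0 : 0 ≤ θ)
    (hθ : K * θ₀ ^ 2 ≤ θ ^ 2)
    (htrail : ∀ k : Fin p, (k : ℕ) < K →
      ∑ j : Fin p, (if (j : ℕ) < K then 0 else (Γ.col j ⬝ᵥ G.col k) ^ 2) ≤ θ₀ ^ 2)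
    {w : EuclideanSpace ℝ (Fin p)} (hw : ‖w‖ = 1) {d : Fin p → ℝ} {r β b : ℝ} (hr : 0 ≤ r)
    (hr1 : r ≤ 1) (hd : ∀ i, |d i| ≤ r) (hθr : θ ≤ r)
    (hθw : ∀ k : Fin p, (k : ℕ) < K → θ * (√(lam k) * |w k|) ≤ r)
    (hβ : 0 < β) (hβκ : β ^ 2 = idioScale K lam)
    (hq : |∑ k : Fin p, ((if (k : ℕ) < K then 0 else lam k) - idioScale K lam) * w k ^ 2| ≤ r)
    (hβb : β ≤ b) (hb : 1 ≤ b * β) :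
    |l2norm (Pr *ᵥ (noise Γ lam w + d)) / √p - β| ≤ (3 * b + 2 + 2 * K) * r := by
  have hp' : (0 : ℝ) < p := by exact_mod_cast hp
  have hsp : 0 < √(p : ℝ) := Real.sqrt_pos.2 hp'
  have hb0 : 0 < b := lt_of_lt_of_le hβ hβb
  set a := noise Γ lam w with ha
  have hcol : ∀ k, Γ.col k ⬝ᵥ a = √p * (√(lam k) * w k) := fun k => transpose_mulVec_noise hA w k
  -- the trailing part of the pure noise
  set q := l2norm (trailPart hK Γ a) / √p with hqdef
  have hq0 : 0 ≤ q := div_nonneg (l2norm_nonneg _) hsp.le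
  have hq2 : q ^ 2 - β ^ 2 =
      ∑ k : Fin p, ((if (k : ℕ) < K then 0 else lam k) - idioScale K lam) * w k ^ 2 := by
    have h1 : ∑ k, w k ^ 2 = 1 := by rw [← EuclideanSpace.real_norm_sq_eq, hw, one_pow]
    rw [hqdef, div_pow, Real.sq_sqrt hp'.le, l2norm_trailPart_sq hK hA, hβκ]
    simp only [sub_mul, Finset.sum_sub_distrib, ← Finset.mul_sum, h1, mul_one]
    congr 1
    rw [Finset.sum_div]
    refine Finset.sum_congr rfl fun k _ => ?_
    split_ifs
    · simp
    · rw [hcol, mul_pow, mul_pow, Real.sq_sqrt hp'.le, Real.sq_sqrt (h0 k)]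
      field_simp
  have hqβ : |q - β| ≤ b * r := by
    rw [← hq2] at hq
    have h1 : q ^ 2 - β ^ 2 = (q - β) * (q + β) := by ring
    rw [h1, abs_mul, abs_of_pos (show 0 < q + β by linarith)] at hq
    have h2 : |q - β| * β ≤ r := by nlinarith [abs_nonneg (q - β)]
    calc |q - β| ≤ |q - β| * (b * β) := le_mul_of_one_le_right (abs_nonneg _) hb
      _ = b * (|q - β| * β) := by ring
      _ ≤ _ := mul_le_mul_of_nonneg_left h2 hb0.le
  have hdn : l2norm d / √p ≤ r := by
    rw [div_le_iff₀ hsp, mul_comm]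
    exact l2norm_le_of_abs_le hr hd
  set q' := l2norm (trailPart hK Γ (a + d)) / √p with hq'
  have hq'q : |q' - q| ≤ r := by
    rw [hq', hqdef, ← sub_div, abs_div, abs_of_pos hsp, trailPart_add]
    refine le_trans ?_ hdn
    refine div_le_div_of_nonneg_right ?_ hsp.le
    exact (abs_l2norm_add_sub_le _ _).trans (l2norm_trailPart_le hK hA d)
  have hproj := abs_l2norm_proj_sub_le hK hA hPr hG hnull hθ0 (hθr.trans hr1) hθ htrail (a + d)
  set s := l2norm (Pr *ᵥ (a + d)) / √p with hs
  have hθk : ∀ k : Fin K, θ * |Γ.col (Fin.castLE hK k) ⬝ᵥ (a + d)| ≤ 2 * r * √p := fun k => by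
    have h1 : |Γ.col (Fin.castLE hK k) ⬝ᵥ (a + d)| ≤
        √p * (√(lam (Fin.castLE hK k)) * |w (Fin.castLE hK k)|) + √p * r := by
      rw [dotProduct_add]
      refine (abs_add_le _ _).trans (add_le_add (le_of_eq ?_) ?_)
      · rw [hcol, abs_mul, abs_mul, abs_of_pos hsp, abs_of_nonneg (Real.sqrt_nonneg _)]
      · refine (abs_dotProduct_le zero_le_one (l2norm_nonneg d) ?_ (l2norm_sq d).ge).trans ?_
        · rw [one_pow]
          exact hA.col_dotProduct_le_one _
        · rw [one_mul]
          exact l2norm_le_of_abs_le hr hd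
    have h2 := hθw (Fin.castLE hK k) k.2
    have h3 : θ * r ≤ r := by nlinarith
    calc _ ≤ θ * (√p * (√(lam (Fin.castLE hK k)) * |w (Fin.castLE hK k)|) + √p * r) :=
          mul_le_mul_of_nonneg_left h1 hθ0
      _ = (θ * (√(lam (Fin.castLE hK k)) * |w (Fin.castLE hK k)|) + θ * r) * √p := by ring
      _ ≤ (r + r) * √p := by gcongr
      _ = _ := by ring
  have hsq' : |s - q'| ≤ θ * q' + 2 * K * r := by
    have h1 : θ * ∑ k : Fin K, |Γ.col (Fin.castLE hK k) ⬝ᵥ (a + d)| ≤ 2 * K * r * √p := by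
      rw [Finset.mul_sum]
      calc _ ≤ ∑ _k : Fin K, 2 * r * √p := Finset.sum_le_sum fun k _ => hθk k
        _ = _ := by simp; ring
    rw [hs, hq', ← sub_div, abs_div, abs_of_pos hsp, div_le_iff₀ hsp]
    refine (hproj.trans (add_le_add le_rfl h1)).trans (le_of_eq ?_)
    field_simp
  have hq'b : q' ≤ 2 * b + 1 := by
    have h1 := (abs_le.1 hqβ).2
    have h2 := (abs_le.1 hq'q).2
    nlinarith
  have hq'0 : 0 ≤ q' := div_nonneg (l2norm_nonneg _) hsp.le
  have h1 : θ * q' ≤ r * (2 * b + 1) := mul_le_mul hθr hq'b hq'0 hr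
  have h2 := abs_add_le (s - q') (q' - q)
  have h3 := abs_add_le (s - q' + (q' - q)) (q - β)
  rw [sub_add_sub_cancel] at h2 h3
  rw [sub_add_sub_cancel] at h3
  linarith

/-- The deterministic core of the entrywise bound: the pilot scatter matrix is within a multiple of
`r` of `A` as soon as the location, projection and noise errors are all at most `r`. -/
theorem abs_pilot_scatter_sub_le (hK : K ≤ p) (hp : 0 < p) (hn : 0 < n) (hA : IsEigenDecomp A Γ lam)
    (h0 : ∀ i, 0 ≤ lam i) (htr : A.trace = p) {C : ℝ} (hC : 1 ≤ C) (hAC : ∀ i, A i i ≤ C)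
    {Pr : Matrix (Fin (p - K)) (Fin p) ℝ} (hPr : Pr * Prᵀ = 1)
    (hG : Gᵀ * G = 1) (hnull : Pr * leadCols hK G = 0) {θ₀ θ : ℝ} (hθ0 : 0 ≤ θ)
    (hθ : K * θ₀ ^ 2 ≤ θ ^ 2)
    (htrail : ∀ k : Fin p, (k : ℕ) < K →
      ∑ j : Fin p, (if (j : ℕ) < K then 0 else (Γ.col j ⬝ᵥ G.col k) ^ 2) ≤ θ₀ ^ 2)
    {μ m : Fin p → ℝ} {ξ : Fin n → ℝ} (hξ : ∀ t, 0 < ξ t) {u : Fin n → EuclideanSpace ℝ (Fin p)}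
    {w : Fin n → EuclideanSpace ℝ (Fin p)} (hwu : ∀ t, w t = transposeIsometry hA (u t))
    (hw : ∀ t, ‖w t‖ = 1) {r β b : ℝ} (hr : 0 ≤ r)
    (hr1 : 22 * C * (10 * b * (3 * b + 2 + 2 * K) * r) ≤ 1)
    (hd : ∀ t i, |(μ i - m i) / ξ t| ≤ r) (hθr : θ ≤ r)
    (hθw : ∀ t, ∀ k : Fin p, (k : ℕ) < K → θ * (√(lam k) * |w t k|) ≤ r)
    (hβ : 0 < β) (hβκ : β ^ 2 = idioScale K lam)
    (hq : ∀ t, |∑ k : Fin p, ((if (k : ℕ) < K then 0 else lam k) - idioScale K lam) * w t k ^ 2| ≤ r)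
    (hβb : β ≤ b) (hb : 1 ≤ b * β)
    (hS : ∀ i j, |1 / (n : ℝ) * ∑ t, p * (inner ℝ (loading Γ lam i) (w t) *
      inner ℝ (loading Γ lam j) (w t)) - inner ℝ (loading Γ lam i) (loading Γ lam j)| ≤ r)
    (i j : Fin p) :
    |(traceNormalized (fun t => selfNormalized Pr m (ellipticalObs μ A ξ u t)) - A) i j| ≤
      55 * C ^ 2 * (10 * b * (3 * b + 2 + 2 * K) * r) := by
  have hp' : (0 : ℝ) < p := by exact_mod_cast hp
  have hsp : 0 < √(p : ℝ) := Real.sqrt_pos.2 hp'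
  have hb0 : 0 < b := lt_of_lt_of_le hβ hβb
  have hb1 : 1 ≤ b := by nlinarith
  set c : ℝ := 3 * b + 2 + 2 * K with hc
  have hc5 : 5 ≤ c := by
    have : (0 : ℝ) ≤ K := Nat.cast_nonneg K
    linarith
  have hrc : r ≤ 10 * b * c * r := by
    have : 1 ≤ 10 * b * c := by nlinarith
    exact le_mul_of_one_le_left hr this
  set r₁ := 10 * b * c * r with hr₁
  have hr₁0 : 0 ≤ r₁ := hr.trans hrc
  have hr₁1 : 22 * r₁ ≤ 1 := by nlinarith
  set d : Fin n → Fin p → ℝ := fun t i => (μ i - m i) / ξ t with hddef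
  set s : Fin n → ℝ := fun t => l2norm (Pr *ᵥ (noise Γ lam (w t) + d t)) / √p with hs
  have hsβ : ∀ t, |s t - β| ≤ c * r := fun t =>
    abs_l2norm_proj_div_sub_le hK hp hA h0 hPr hG hnull hθ0 hθ htrail (hw t) hr
      (by linarith) (hd t) hθr (hθw t) hβ hβκ (hq t) hβb hb
  have hcr : c * r ≤ β / 2 := by
    have h1 : b * (c * r) ≤ 1 / 220 := by
      have : r₁ = 10 * (b * (c * r)) := by rw [hr₁]; ring
      linarith
    have h2 : b * (c * r) ≤ b * (β / 2) := by linarith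
    exact le_of_mul_le_mul_left h2 hb0
  have hcov : ∀ i j, A i j = inner ℝ (loading Γ lam i) (loading Γ lam j) := fun i j =>
    (inner_loading hA h0 i j).symm
  refine abs_traceNormalized_sub_le hn (κ := β ^ 2) (by positivity)
    (a := fun t => noise Γ lam (w t)) (d := d) (D := fun t => s t ^ 2) (fun t i j => ?_) hC hr₁0
    (by linarith) (fun t => ?_) (fun t i => (hd t i).trans hrc) (fun i j => ?_) (fun i j => ?_) htr i j
  · have hy : ellipticalObs μ A ξ u t - m = ξ t • (noise Γ lam (w t) + d t) := by
      rw [ellipticalObs_eq hA h0, ← hwu]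
      funext i
      have := (hξ t).ne'
      simp only [hddef, Pi.sub_apply, Pi.add_apply, Pi.smul_apply, smul_eq_mul]
      field_simp
      ring
    have hx : ∀ i, selfNormalized Pr m (ellipticalObs μ A ξ u t) i =
        (s t)⁻¹ * (noise Γ lam (w t) i + d t i) := fun i => by
      rw [selfNormalized, hy, Matrix.mulVec_smul, l2norm_smul, abs_of_pos (hξ t)]
      simp only [hs, Pi.add_apply, Pi.smul_apply, smul_eq_mul]
      rw [inv_div, div_mul_eq_div_div, ← mul_assoc]
      congr 1
      have := (hξ t).ne'
      rw [div_right_comm, div_mul_cancel₀ _ this]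
    simp only [hx]
    rw [sq, mul_inv]
    ring
  · refine (abs_div_sq_sub_one_le hβ (hsβ t) hcr).trans ?_
    rw [div_le_iff₀ hβ, hr₁]
    have h1 : 10 * (c * r) * 1 ≤ 10 * (c * r) * (b * β) :=
      mul_le_mul_of_nonneg_left hb (by positivity)
    linarith
  · refine le_trans (le_of_eq ?_) ((hS i j).trans hrc)
    rw [hcov]
    congr 3
    refine Finset.sum_congr rfl fun t _ => ?_
    simp only [noise]
    rw [← Real.mul_self_sqrt hp'.le]
    simp only [Real.sqrt_mul_self hsp.le]
    ring
  · have hl : ∀ i, ‖loading Γ lam i‖ ≤ √C := fun i =>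
      Real.le_sqrt_of_sq_le (by rw [norm_loading_sq hA h0]; exact hAC i)
    rw [hcov]
    calc _ ≤ ‖loading Γ lam i‖ * ‖loading Γ lam j‖ := abs_real_inner_le_norm _ _
      _ ≤ √C * √C := mul_le_mul (hl i) (hl j) (norm_nonneg _) (Real.sqrt_nonneg _)
      _ = C := Real.mul_self_sqrt (by linarith)

end Pilot

/-! ### Joint law of radii and directions -/

section Design

variable {Ω : Type*} [MeasurableSpace Ω] {P : Measure Ω} [IsProbabilityMeasure P] {n p : ℕ}

/-- A Huber location estimate lies within `ρ` of the centre once the score changes sign there. -/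
theorem abs_location_sub_le {H ρ μ m : ℝ} {x : Fin n → ℝ}
    (h0 : ∑ t, huberPsi H (μ + x t - m) = 0) (hpos : 0 < ∑ t, huberPsi H (x t + ρ))
    (hneg : ∑ t, huberPsi H (x t - ρ) < 0) : |μ - m| ≤ ρ := by
  rw [abs_le]
  constructor
  · by_contra! hlt
    have : ∑ t, huberPsi H (μ + x t - m) ≤ ∑ t, huberPsi H (x t - ρ) :=
      Finset.sum_le_sum fun t _ => huberPsi_mono H (by linarith)
    linarith
  · by_contra! hlt
    have : ∑ t, huberPsi H (x t + ρ) ≤ ∑ t, huberPsi H (μ + x t - m) :=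
      Finset.sum_le_sum fun t _ => huberPsi_mono H (by linarith)
    linarith

/-- Conditioning on the radii: a joint event of radii and directions is bounded through its
sections at radii in a set `S`. -/
theorem measure_joint_le (hp : 0 < p) {ξ : Fin n → Ω → ℝ}
    {w : Fin n → Ω → EuclideanSpace ℝ (Fin p)} (hξ : ∀ t, Measurable (ξ t))
    (hm : ∀ t, Measurable (w t)) (hw : ∀ t, P.map (w t) = sphereUniform p) (hind : iIndepFun w P)
    (hξw : IndepFun (fun ω t => ξ t ω) (fun ω t => w t ω) P)
    {B : Set ((Fin n → ℝ) × (Fin n → EuclideanSpace ℝ (Fin p)))} (hB : MeasurableSet B)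
    {S : Set (Fin n → ℝ)} (hS : MeasurableSet S) {e : ENNReal}
    (hsec : ∀ x ∈ S, (Measure.pi fun _ : Fin n => sphereUniform p) {v | (x, v) ∈ B} ≤ e) :
    P {ω | ((fun t => ξ t ω), fun t => w t ω) ∈ B} ≤ P {ω | (fun t => ξ t ω) ∉ S} + e := by
  have := isProbabilityMeasure_sphereUniform hp
  have hξm : Measurable fun ω t => ξ t ω := measurable_pi_lambda _ hξ
  have hwm : Measurable fun ω t => w t ω := measurable_pi_lambda _ hm
  have := Measure.isProbabilityMeasure_map (μ := P) hξm.aemeasurable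
  have hlaw : P.map (fun ω t => w t ω) = Measure.pi fun _ : Fin n => sphereUniform p := by
    rw [(iIndepFun_iff_map_fun_eq_pi_map fun t => (hm t).aemeasurable).1 hind]
    simp only [hw]
  have hjoint := (indepFun_iff_map_prod_eq_prod_map_map hξm.aemeasurable hwm.aemeasurable).1 hξw
  rw [hlaw] at hjoint
  have h1 : P {ω | ((fun t => ξ t ω), fun t => w t ω) ∈ B} =
      ∫⁻ x, (Measure.pi fun _ : Fin n => sphereUniform p) (Prod.mk x ⁻¹' B)
        ∂(P.map fun ω t => ξ t ω) := by
    rw [← Measure.prod_apply hB, ← hjoint, Measure.map_apply (hξm.prodMk hwm) hB]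
    rfl
  rw [h1]
  calc _ ≤ ∫⁻ x, (Sᶜ.indicator 1 x + e) ∂(P.map fun ω t => ξ t ω) := by
        refine lintegral_mono fun x => ?_
        by_cases hx : x ∈ S
        · exact (hsec x hx).trans le_add_self
        · rw [Set.indicator_of_mem (by exact hx)]
          exact prob_le_one.trans le_self_add
    _ = _ := by
        rw [lintegral_add_right _ measurable_const, lintegral_indicator_one hS.compl,
          Measure.map_apply hξm hS.compl, lintegral_const, measure_univ, mul_one]
        rfl

/-- Truncation by Markov's inequality: only second moments of the radii are needed. -/
theorem measure_sum_sq_gt_le (hn : 0 < n) {ξ : Fin n → Ω → ℝ} (hξ : ∀ t, Measurable (ξ t))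
    {ε C₁ : ℝ} (hε : 0 < ε) (hmoment : ∀ t, Integrable (fun ω => |ξ t ω| ^ (2 + ε)) P ∧
      ∫ ω, |ξ t ω| ^ (2 + ε) ∂P < C₁) {M : ℝ} (hM : 0 < M) :
    P {ω | n * M < ∑ t, ξ t ω ^ 2} ≤ ENNReal.ofReal ((1 + C₁) / M) := by
  have hn' : (0 : ℝ) < n := by exact_mod_cast hn
  have hle : ∀ x : ℝ, x ^ 2 ≤ 1 + |x| ^ (2 + ε) := fun x => by
    rcases le_total |x| 1 with h | h
    · have h1 : x ^ 2 ≤ 1 := by rwa [sq_le_one_iff_abs_le_one]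
      have h2 : (0 : ℝ) ≤ |x| ^ (2 + ε) := Real.rpow_nonneg (abs_nonneg _) _
      linarith
    · have h1 : |x| ^ (2 : ℝ) ≤ |x| ^ (2 + ε) := Real.rpow_le_rpow_of_exponent_le h (by linarith)
      rw [Real.rpow_two, sq_abs] at h1
      linarith
  have hint : ∀ t, Integrable (fun ω => ξ t ω ^ 2) P := fun t => by
    refine Integrable.mono' ((integrable_const (1 : ℝ)).add (hmoment t).1)
      ((hξ t).pow_const 2).aestronglyMeasurable (ae_of_all _ fun ω => ?_)
    rw [Real.norm_eq_abs, abs_of_nonneg (sq_nonneg _)]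
    exact hle _
  have hexp : ∀ t, ∫ ω, ξ t ω ^ 2 ∂P ≤ 1 + C₁ := fun t => by
    have h1 : ∫ ω, ξ t ω ^ 2 ∂P ≤ ∫ ω, (1 + |ξ t ω| ^ (2 + ε)) ∂P :=
      integral_mono (hint t) ((integrable_const (1 : ℝ)).add (hmoment t).1) fun ω => hle _
    have h2 : ∫ ω, (1 + |ξ t ω| ^ (2 + ε)) ∂P = 1 + ∫ ω, |ξ t ω| ^ (2 + ε) ∂P := by
      rw [integral_add (integrable_const (1 : ℝ)) (hmoment t).1]
      simp
    linarith [(hmoment t).2]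
  have h := measure_gt_le_of_integral_le (P := P) (f := fun ω => ∑ t, ξ t ω ^ 2)
    (integrable_finsetSum _ fun t _ => hint t)
    (ae_of_all _ fun ω => Finset.sum_nonneg fun _ _ => sq_nonneg _)
    (c := n * M) (A := n * (1 + C₁)) (by positivity) (by
      rw [integral_finsetSum _ fun t _ => hint t]
      calc _ ≤ ∑ _t : Fin n, (1 + C₁) := Finset.sum_le_sum fun t _ => hexp t
        _ = _ := by simp; ring)
  rwa [mul_div_mul_left _ _ hn'.ne'] at h

section Transformed

variable {A Γ : Matrix (Fin p) (Fin p) ℝ} {lam : Fin p → ℝ} {ξ : Fin n → Ω → ℝ}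
  {u : Fin n → Ω → EuclideanSpace ℝ (Fin p)}

theorem measurable_transposeIsometry (hA : IsEigenDecomp A Γ lam) :
    Measurable (transposeIsometry hA) := (transposeIsometry hA).continuous.measurable

omit [IsProbabilityMeasure P] in
theorem map_transposeIsometry (hp : 0 < p) (hA : IsEigenDecomp A Γ lam)
    (hd : IsEllipticalDesign P ξ u) (t : Fin n) :
    P.map (fun ω => transposeIsometry hA (u t ω)) = sphereUniform p := by
  have h := Measure.map_map (μ := P) (measurable_transposeIsometry hA) (hd.measurable_u t)
  rw [hd.law_u, map_sphereUniform hp] at h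
  exact h.symm

omit [IsProbabilityMeasure P] in
theorem iIndepFun_transposeIsometry (hA : IsEigenDecomp A Γ lam)
    (hd : IsEllipticalDesign P ξ u) :
    iIndepFun (fun t ω => transposeIsometry hA (u t ω)) P :=
  iIndepFun.comp hd.indep_u (fun _ => transposeIsometry hA) fun _ => measurable_transposeIsometry hA

omit [IsProbabilityMeasure P] in
theorem indepFun_transposeIsometry (hA : IsEigenDecomp A Γ lam)
    (hd : IsEllipticalDesign P ξ u) :
    IndepFun (fun ω t => ξ t ω) (fun ω t => transposeIsometry hA (u t ω)) P := by
  have hO := measurable_transposeIsometry hA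
  generalize transposeIsometry hA = O at hO
  have h : Measurable fun (v : Fin n → EuclideanSpace ℝ (Fin p)) t => O (v t) :=
    measurable_pi_lambda _ fun t => hO.comp (measurable_pi_apply t)
  exact IndepFun.comp hd.indep_xi_u measurable_id h

omit [IsProbabilityMeasure P] in
theorem ae_norm_transposeIsometry (hp : 0 < p) (hA : IsEigenDecomp A Γ lam)
    (hd : IsEllipticalDesign P ξ u) : ∀ᵐ ω ∂P, ∀ t, ‖transposeIsometry hA (u t ω)‖ = 1 := by
  rw [ae_all_iff]
  intro t
  have h := ae_norm_sphereUniform p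
  rw [← map_transposeIsometry hp hA hd t] at h
  exact ae_of_ae_map ((measurable_transposeIsometry hA).comp (hd.measurable_u t)).aemeasurable h

end Transformed

end Design

/-! ### Non-asymptotic tail bound for the pilot scatter matrix -/

section TailBound

variable {Ω : Type*} [MeasurableSpace Ω] {P : Measure Ω} [IsProbabilityMeasure P] {n p K : ℕ}
  {A Γ : Matrix (Fin p) (Fin p) ℝ} {lam : Fin p → ℝ} {ξ : Fin n → Ω → ℝ}
  {u : Fin n → Ω → EuclideanSpace ℝ (Fin p)}

/-- The concentration of Kendall's tau, with random radii. -/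
theorem measure_kendallSum_design_gt_le (hp : 0 < p) (hn : 0 < n) (hA : IsEigenDecomp A Γ lam)
    (h0 : ∀ i, 0 ≤ lam i) (hdes : IsEllipticalDesign P ξ u) {M : ℝ} (hM : 0 < M) :
    P {ω | M * n ^ 3 < ∑ kl : Fin p × Fin p,
      (kendallSum lam (fun t => ξ t ω) (fun t => transposeIsometry hA (u t ω)) kl.1 kl.2 -
        kendallMean lam (fun t => ξ t ω) kl.1 kl.2) ^ 2} ≤ ENNReal.ofReal (4 / M) := by
  have hB : MeasurableSet {z : (Fin n → ℝ) × (Fin n → EuclideanSpace ℝ (Fin p)) |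
      M * n ^ 3 < ∑ kl : Fin p × Fin p,
        (kendallSum lam z.1 z.2 kl.1 kl.2 - kendallMean lam z.1 kl.1 kl.2) ^ 2} := by
    refine measurableSet_lt measurable_const (Finset.measurable_fun_sum _ fun kl _ => ?_)
    exact ((measurable_kendallSum lam kl.1 kl.2).sub
      ((measurable_kendallMean hp lam kl.1 kl.2).comp measurable_fst)).pow_const 2
  have h := measure_joint_le hp hdes.measurable_xi
    (fun t => (measurable_transposeIsometry hA).comp (hdes.measurable_u t))
    (map_transposeIsometry hp hA hdes) (iIndepFun_transposeIsometry hA hdes)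
    (indepFun_transposeIsometry hA hdes) hB (S := Set.univ) MeasurableSet.univ
    (fun x _ => measure_kendallSum_gt_le hp hn h0 x hM)
  simpa using h

/-- The sign change of the Huber score, with random radii: either `∑ ξ_t²` exceeds `n M`, or the bound
for fixed radii applies. -/
theorem measure_huber_design_le (hp : 0 < p) (hn : 0 < n) (hA : IsEigenDecomp A Γ lam)
    (h0 : ∀ i, 0 ≤ lam i) (hdes : IsEllipticalDesign P ξ u) {ε C₁ : ℝ} (hε : 0 < ε)
    (hmoment : ∀ t, Integrable (fun ω => |ξ t ω| ^ (2 + ε)) P ∧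
      ∫ ω, |ξ t ω| ^ (2 + ε) ∂P < C₁) {C M H ρ τ : ℝ} (hC : 0 ≤ C) (hAC : ∀ i, A i i ≤ C)
    (hM : 0 < M) (hρ : 0 ≤ ρ) (hρH : ρ < H) (hτ : 0 ≤ τ) (hτH : τ * H ≤ 1)
    (hHbig : 2 * (C * M) ≤ (H - ρ) ^ 2) :
    P {ω | ∃ i, ∑ t, huberPsi H (ξ t ω * noise Γ lam (transposeIsometry hA (u t ω)) i + ρ) ≤ 0 ∨
        0 ≤ ∑ t, huberPsi H (ξ t ω * noise Γ lam (transposeIsometry hA (u t ω)) i - ρ)} ≤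
      ENNReal.ofReal ((1 + C₁) / M) + ENNReal.ofReal (p * (2 * Real.exp
        (n * (-(τ * ρ / 2) + τ ^ 2 * (2 * (C * M) + 2 * ρ ^ 2))))) := by
  have := isProbabilityMeasure_sphereUniform hp
  have hcont := continuous_huberPsi H
  have hB : MeasurableSet {z : (Fin n → ℝ) × (Fin n → EuclideanSpace ℝ (Fin p)) |
      ∃ i, ∑ t, huberPsi H (z.1 t * (√p * inner ℝ (loading Γ lam i) (z.2 t)) + ρ) ≤ 0 ∨
        0 ≤ ∑ t, huberPsi H (z.1 t * (√p * inner ℝ (loading Γ lam i) (z.2 t)) - ρ)} := by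
    have hf : ∀ (i : Fin p) (t : Fin n) (c : ℝ), Measurable
        fun z : (Fin n → ℝ) × (Fin n → EuclideanSpace ℝ (Fin p)) =>
          huberPsi H (z.1 t * (√p * inner ℝ (loading Γ lam i) (z.2 t)) + c) := fun i t c =>
      hcont.measurable.comp (by fun_prop)
    have hg : ∀ (i : Fin p) (c : ℝ), Measurable
        fun z : (Fin n → ℝ) × (Fin n → EuclideanSpace ℝ (Fin p)) =>
          ∑ t, huberPsi H (z.1 t * (√p * inner ℝ (loading Γ lam i) (z.2 t)) + c) := fun i c =>
      Finset.measurable_fun_sum _ fun t _ => hf i t c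
    simp only [sub_eq_add_neg]
    rw [Set.ofPred_exists]
    exact MeasurableSet.iUnion fun i => MeasurableSet.union
      (measurableSet_le (hg i ρ) measurable_const) (measurableSet_le measurable_const (hg i (-ρ)))
  have hS : MeasurableSet {x : Fin n → ℝ | ∑ t, x t ^ 2 ≤ n * M} :=
    measurableSet_le (by fun_prop) measurable_const
  have h := measure_joint_le hp hdes.measurable_xi
    (fun t => (measurable_transposeIsometry hA).comp (hdes.measurable_u t))
    (map_transposeIsometry hp hA hdes) (iIndepFun_transposeIsometry hA hdes)
    (indepFun_transposeIsometry hA hdes) hB hS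
    (fun x hx => measure_huber_sign_le hp (fun t => measurable_pi_apply t) (map_eval_pi hp)
      (iIndepFun_eval hp) hC (fun i => (norm_loading_sq hA h0 i).le.trans (hAC i)) x hx hρ hρH hτ hτH
      hHbig)
  refine h.trans (add_le_add (le_trans (le_of_eq ?_)
    (measure_sum_sq_gt_le hn hdes.measurable_xi hε hmoment hM)) le_rfl)
  simp only [Set.mem_ofPred_eq, not_le]

theorem sum_idio_sub_idioScale (hp : 0 < p) :
    ∑ k : Fin p, ((if (k : ℕ) < K then 0 else lam k) - idioScale K lam) = 0 := by
  have hp' : (p : ℝ) ≠ 0 := by exact_mod_cast hp.ne'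
  rw [Finset.sum_sub_distrib, idioScale]
  simp only [Finset.sum_const, Finset.card_univ, Fintype.card_fin, nsmul_eq_mul]
  rw [mul_div_cancel₀ _ hp', sub_self]

/-- The tail bound for the pilot scatter matrix. The free parameters are the thresholds `s₁`, `s₂`, `s₃`
for the coordinates, the quadratic form and the second moments, the location error `ρ` with its
Chernoff parameter `τ`, and the truncation levels `M` for the radii and `N` for Kendall's tau; `r`
dominates all resulting errors. -/
theorem measure_scatter_gt_le (hK : K ≤ p) (hp : 0 < p) (hKp : 2 * K ≤ p) (hn : 2 ≤ n)
    (hdes : IsEllipticalDesign P ξ u) (hA : IsEigenDecomp A Γ lam) (htr : A.trace = p)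
    {ε c₁ C₁ : ℝ} (hε : 0 < ε) (hmoment : ∀ t, Integrable (fun ω => |ξ t ω| ^ (2 + ε)) P ∧
      ∫ ω, |ξ t ω| ^ (2 + ε) ∂P < C₁) (hc₁ : 0 < c₁) (hlower : ∀ t, ∀ᵐ ω ∂P, c₁ < |ξ t ω|)
    {C : ℝ} (hC : 1 ≤ C) (hAC : ∀ i, A i i ≤ C) {δ : ℝ} (hδ : 0 < δ)
    (hlead : ∀ i : Fin p, (i : ℕ) < K → δ * p ≤ lam i ∧ lam i ≤ p / δ)
    (hidio : ∀ i : Fin p, K ≤ (i : ℕ) → δ ≤ lam i ∧ lam i ≤ 1 / δ)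
    {μ : Fin p → ℝ} {H : ℝ} {muHat : Ω → Fin p → ℝ} {Pr : Ω → Matrix (Fin (p - K)) (Fin p) ℝ}
    {SigHat GamHat : Ω → Matrix (Fin p) (Fin p) ℝ} {lamHat : Ω → Fin p → ℝ}
    (hpilot : ∀ ω, IsPilot K hK H (ellipticalObs μ A (fun t => ξ t ω) (fun t => u t ω))
      (muHat ω) (Pr ω) (SigHat ω) (GamHat ω) (lamHat ω))
    {s₁ s₂ s₃ ρ τ M N r : ℝ} (hs₂ : 0 ≤ s₂) (hs₂' : s₂ ≤ 2 * (1 / δ)) (hs₃ : 0 ≤ s₃)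
    (hs₃' : s₃ ≤ 64 * C) (hM : 0 < M) (hρ : 0 ≤ ρ) (hρH : ρ < H) (hτ : 0 ≤ τ) (hτH : τ * H ≤ 1)
    (hHbig : 2 * (C * M) ≤ (H - ρ) ^ 2) (hN : 0 < N)
    (hsmall : 2 / (δ ^ 2 * p) + 2 * √(N / n) ≤ δ ^ 3 / 24)
    (hr₂ : s₂ ≤ r) (hr₃ : s₃ ≤ r) (hrρ : ρ / c₁ ≤ r) (hrθ : K * (48 / δ ^ 3 * √(N / n)) ≤ r)
    (hrθ₁ : K * (48 / δ ^ 3 * √(N / n)) * √(s₁ / δ) ≤ r)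
    (hr : 22 * C * (10 * √(2 / δ) * (3 * √(2 / δ) + 2 + 2 * K) * r) ≤ 1) :
    P {ω | 55 * C ^ 2 * (10 * √(2 / δ) * (3 * √(2 / δ) + 2 + 2 * K) * r) <
        |maxNorm (SigHat ω - A)|} ≤
      ENNReal.ofReal (n * p * (√2 * Real.exp (-(s₁ / 4)))) +
      ENNReal.ofReal (n * (2 * Real.exp (-(s₂ ^ 2 * p / (16 * (1 / δ) ^ 2))))) +
      ENNReal.ofReal (p * p * (2 * Real.exp (-(n * s₃ ^ 2 / (1024 * C ^ 2))))) +
      (ENNReal.ofReal ((1 + C₁) / M) + ENNReal.ofReal (p * (2 * Real.exp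
        (n * (-(τ * ρ / 2) + τ ^ 2 * (2 * (C * M) + 2 * ρ ^ 2)))))) +
      ENNReal.ofReal (4 / N) := by
  have hp' : (0 : ℝ) < p := by exact_mod_cast hp
  have hp1 : (1 : ℝ) ≤ p := by exact_mod_cast hp
  have hn0 : 0 < n := by omega
  have h0 : ∀ i, 0 ≤ lam i := fun i => by
    rcases lt_or_ge (i : ℕ) K with h | h
    · exact le_trans (by positivity) (hlead i h).1
    · exact hδ.le.trans (hidio i h).1
  have hr0 : 0 ≤ r := hs₂.trans hr₂
  obtain ⟨hκ1, hκ2⟩ := idioScale_mem hp hKp hδ hidio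
  set κ := idioScale K lam with hκ
  have hκpos : 0 < κ := lt_of_lt_of_le (by positivity) hκ1
  have hm := fun t => (measurable_transposeIsometry hA).comp (hdes.measurable_u t)
  have hw := map_transposeIsometry hp hA hdes
  have hind := iIndepFun_transposeIsometry hA hdes
  -- the five exceptional events
  have g₁ := measure_coord_sq_gt_le hp hm hw s₁
  have g₂ := measure_quadratic_gt_le hp hm hw (B := 1 / δ)
    (b := fun k : Fin p => (if (k : ℕ) < K then 0 else lam k) - κ) (by positivity)
    (fun k => by
      have : 0 ≤ (if (k : ℕ) < K then 0 else lam k) ∧ (if (k : ℕ) < K then 0 else lam k) ≤ 1 / δ := by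
        split_ifs with h
        · exact ⟨le_rfl, by positivity⟩
        · exact ⟨h0 k, (hidio k (not_lt.1 h)).2⟩
      rw [abs_le]
      constructor <;> linarith [this.1, this.2])
    (sum_idio_sub_idioScale hp) hs₂ hs₂'
  have g₃ := measure_secondMoment_gt_le hp hn0 hm hw hind (b := loading Γ lam)
    (show (0 : ℝ) < C by linarith) (fun i => (norm_loading_sq hA h0 i).le.trans (hAC i)) hs₃ hs₃'
  have g₄ := measure_huber_design_le hp hn0 hA h0 hdes hε hmoment (by linarith) hAC hM hρ hρH hτ hτH
    hHbig
  have g₅ := measure_kendallSum_design_gt_le hp hn0 hA h0 hdes hN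
  refine le_trans ?_ (add_le_add (add_le_add (add_le_add (add_le_add g₁ g₂) g₃) g₄) g₅)
  refine le_trans ?_ (add_le_add_left ((measure_union_le _ _).trans (add_le_add_left
    ((measure_union_le _ _).trans (add_le_add_left (measure_union_le _ _) _)) _)) _)
  refine le_trans (measure_mono_ae ?_) (measure_union_le _ _)
  filter_upwards [ae_norm_transposeIsometry hp hA hdes, ae_all_iff.2 hlower,
    ae_all_iff.2 hdes.nonneg_xi] with ω hnorm hlow hnonneg hbad
  by_contra hcon
  change ¬(ω ∈ (_ : Set Ω) ∪ _ ∪ _ ∪ _ ∪ _) at hcon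
  simp only [Set.mem_union, Set.mem_ofPred_eq, not_or, not_exists, not_lt, not_le,
    Function.comp_apply] at hcon
  obtain ⟨⟨⟨⟨e₁, e₂⟩, e₃⟩, e₄⟩, e₅⟩ := hcon
  have hξc : ∀ t, c₁ < ξ t ω := fun t => by
    have := hlow t
    rwa [abs_of_nonneg (hnonneg t)] at this
  have hξ : ∀ t, 0 < ξ t ω := fun t => hc₁.trans (hξc t)
  obtain ⟨G, L, hG, hnull⟩ := (hpilot ω).proj_null
  have hloc : ∀ i, |μ i - muHat ω i| ≤ ρ := fun i => by
    refine abs_location_sub_le (x := fun t => ξ t ω * noise Γ lam (transposeIsometry hA (u t ω)) i)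
      ?_ (e₄ i).1 (e₄ i).2
    have := (hpilot ω).huber i
    simp only [ellipticalObs_eq hA h0] at this
    exact this
  have hmain := abs_pilot_scatter_sub_le hK hp hn0 hA h0 htr hC hAC (hpilot ω).proj_orth hG.orth hnull
    (θ₀ := 48 / δ ^ 3 * √(N / n)) (θ := K * (48 / δ ^ 3 * √(N / n))) (by positivity)
    (by
      have hKK : (K : ℝ) ≤ K ^ 2 := by exact_mod_cast Nat.le_self_pow two_ne_zero K
      rw [mul_pow (K : ℝ)]
      exact mul_le_mul_of_nonneg_right hKK (sq_nonneg _))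
    (fun k hk => sum_trailing_sq_le_of_kendallSum hK hA htr hδ hlead hidio hn μ hξ
      (fun t => u t ω) hN.le e₅ hsmall hG hk)
    (μ := μ) (m := muHat ω) hξ (w := fun t => transposeIsometry hA (u t ω)) (fun t => rfl) hnorm hr0
    hr (fun t i => by
      rw [abs_div, abs_of_pos (hξ t)]
      exact (div_le_div₀ hρ (hloc i) hc₁ (hξc t).le).trans hrρ) hrθ
    (fun t k hk => by
      refine le_trans (mul_le_mul_of_nonneg_left ?_ (by positivity)) hrθ₁
      rw [← Real.sqrt_sq_eq_abs, ← Real.sqrt_mul (h0 k)]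
      refine Real.sqrt_le_sqrt ?_
      calc _ ≤ p / δ * (transposeIsometry hA (u t ω)) k ^ 2 :=
            mul_le_mul_of_nonneg_right (hlead k hk).2 (sq_nonneg _)
        _ = p * (transposeIsometry hA (u t ω)) k ^ 2 / δ := by ring
        _ ≤ _ := div_le_div_of_nonneg_right (e₁ (t, k)) hδ.le)
    (β := √κ) (Real.sqrt_pos.2 hκpos) (Real.sq_sqrt hκpos.le) (fun t => (e₂ t).trans hr₂)
    (Real.sqrt_le_sqrt (hκ2.trans (by gcongr; norm_num)))
    (by
      rw [← Real.sqrt_mul (by positivity), Real.one_le_sqrt, div_mul_eq_mul_div, le_div_iff₀ hδ]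
      linarith)
    (fun i j => (e₃ (i, j)).trans hr₃)
  have hle : maxNorm (SigHat ω - A) ≤
      55 * C ^ 2 * (10 * √(2 / δ) * (3 * √(2 / δ) + 2 + 2 * K) * r) := by
    refine maxNorm_le (by positivity) fun i j => ?_
    rw [(hpilot ω).scatter]
    exact hmain i j
  have hbad' : 55 * C ^ 2 * (10 * √(2 / δ) * (3 * √(2 / δ) + 2 + 2 * K) * r) <
        |maxNorm (SigHat ω - A)| := hbad
  rw [abs_of_nonneg (maxNorm_nonneg _)] at hbad'
  linarith

end TailBound

/-! ### Rates along the asymptotic sequence -/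

section Rates

variable {n p : ℕ → ℕ}

theorem tendsto_natCast_real (hp : Tendsto p atTop atTop) :
    Tendsto (fun m => (p m : ℝ)) atTop atTop := tendsto_natCast_atTop_atTop.comp hp

theorem tendsto_log_natCast (hp : Tendsto p atTop atTop) :
    Tendsto (fun m => Real.log (p m)) atTop atTop :=
  Real.tendsto_log_atTop.comp (tendsto_natCast_real hp)

theorem tendsto_log_div_self (hp : Tendsto p atTop atTop) :
    Tendsto (fun m => Real.log (p m) / p m) atTop (𝓝 0) :=
  Real.isLittleO_log_id_atTop.tendsto_div_nhds_zero.comp (tendsto_natCast_real hp)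

theorem tendsto_log_div_of_isLittleO (hp : Tendsto p atTop atTop) {γ : ℝ} (hγ : 0 < γ)
    (hlogp : (fun m => Real.log (p m) ^ (2 + γ)) =o[atTop] fun m => (n m : ℝ)) :
    Tendsto (fun m => Real.log (p m) / n m) atTop (𝓝 0) := by
  refine IsLittleO.tendsto_div_nhds_zero (IsBigO.trans_isLittleO ?_ hlogp)
  refine IsBigO.of_bound 1 ?_
  filter_upwards [(tendsto_log_natCast hp).eventually_ge_atTop 1] with m hm
  rw [one_mul, Real.norm_eq_abs, Real.norm_eq_abs, abs_of_nonneg (by linarith),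
    abs_of_nonneg (by positivity)]
  calc Real.log (p m) = Real.log (p m) ^ (1 : ℝ) := (Real.rpow_one _).symm
    _ ≤ _ := Real.rpow_le_rpow_of_exponent_le hm (by linarith)

theorem tendsto_rate (hp : Tendsto p atTop atTop) {γ : ℝ} (hγ : 0 < γ)
    (hlogp : (fun m => Real.log (p m) ^ (2 + γ)) =o[atTop] fun m => (n m : ℝ)) :
    Tendsto (fun m => √(Real.log (p m) / p m) + √(Real.log (p m) / n m)) atTop (𝓝 0) := by
  have h1 := (tendsto_log_div_self hp).sqrt
  have h2 := (tendsto_log_div_of_isLittleO hp hγ hlogp).sqrt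
  simpa using h1.add h2

end Rates

/-- The entrywise rate of the pilot scatter matrix. -/
theorem isBigOp_scatter {Ω : ℕ → Type*} [∀ m, MeasurableSpace (Ω m)]
    (P : ∀ m, Measure (Ω m)) [∀ m, IsProbabilityMeasure (P m)]
    (n p : ℕ → ℕ) (K : ℕ) (hK : ∀ m, K ≤ p m)
    (hn : Tendsto n atTop atTop) (hp : Tendsto p atTop atTop)
    (ξ : ∀ m, Fin (n m) → Ω m → ℝ)
    (u : ∀ m, Fin (n m) → Ω m → EuclideanSpace ℝ (Fin (p m)))
    (hdesign : ∀ m, IsEllipticalDesign (P m) (ξ m) (u m))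
    (μ : ∀ m, Fin (p m) → ℝ)
    (Sig0 : ∀ m, Matrix (Fin (p m)) (Fin (p m)) ℝ)
    (htrace : ∀ m, (Sig0 m).trace = (p m : ℝ))
    (ε c₁ C₁ : ℝ) (hε : 0 < ε) (hc₁ : 0 < c₁)
    (hmoment : ∀ m t, Integrable (fun ω => |ξ m t ω| ^ (2 + ε)) (P m) ∧
      ∫ ω, |ξ m t ω| ^ (2 + ε) ∂(P m) < C₁)
    (hlower : ∀ m t, ∀ᵐ ω ∂(P m), c₁ < |ξ m t ω|)
    (C₂ : ℝ) (hdiag : ∀ m i, Sig0 m i i < C₂)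
    (Gam : ∀ m, Matrix (Fin (p m)) (Fin (p m)) ℝ) (lam : ∀ m, Fin (p m) → ℝ)
    (heig : ∀ m, IsEigenDecomp (Sig0 m) (Gam m) (lam m))
    (δ : ℝ) (hδ : 0 < δ)
    (hfactor : ∀ m (i : Fin (p m)), (i : ℕ) < K → δ * p m ≤ lam m i ∧ lam m i ≤ p m / δ)
    (hidio : ∀ m (i : Fin (p m)), K ≤ (i : ℕ) → δ ≤ lam m i ∧ lam m i ≤ 1 / δ)
    (γ : ℝ) (hγ : 0 < γ)
    (hlogp : (fun m => Real.log (p m) ^ (2 + γ)) =o[atTop] fun m => (n m : ℝ))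
    (hlogn : (fun m => Real.log (n m)) =O[atTop] fun m => Real.log (p m))
    (H : ℕ → ℝ) (hHtop : Tendsto H atTop atTop)
    (hH : H =O[atTop] fun m => √((n m : ℝ) / Real.log (p m)))
    (muHat : ∀ m, Ω m → Fin (p m) → ℝ)
    (Pr : ∀ m, Ω m → Matrix (Fin (p m - K)) (Fin (p m)) ℝ)
    (SigHat GamHat : ∀ m, Ω m → Matrix (Fin (p m)) (Fin (p m)) ℝ)
    (lamHat : ∀ m, Ω m → Fin (p m) → ℝ)
    (hpilot : ∀ m ω, IsPilot K (hK m) (H m)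
      (ellipticalObs (μ m) (Sig0 m) (fun t => ξ m t ω) (fun t => u m t ω))
      (muHat m ω) (Pr m ω) (SigHat m ω) (GamHat m ω) (lamHat m ω)) :
    IsBigOp P (fun m ω => maxNorm (SigHat m ω - Sig0 m))
        (fun m => √(Real.log (p m) / p m) + √(Real.log (p m) / n m)) := by
  intro η hη
  obtain ⟨cn, hcn, hcnb⟩ := hlogn.exists_pos
  obtain ⟨cH, hcH, hcHb⟩ := hH.exists_pos
  set C := max C₂ 1 with hCdef
  have hC : 1 ≤ C := le_max_right _ _
  have hC0 : 0 < C := by linarith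
  -- truncation levels for the radii and for the Kendall matrix
  set M : ℝ := 6 * (1 + |C₁|) / η with hMdef
  have hM : 0 < M := by positivity
  set N : ℝ := 24 / η with hNdef
  have hN : 0 < N := by positivity
  -- coefficients of the rate in each of the error bounds
  set k₂ : ℝ := 4 * √(cn + 1) / δ with hk₂
  set k₃ : ℝ := √3072 * C with hk₃
  set t : ℝ := 1 / cH with ht
  have ht0 : 0 < t := by positivity
  set kρ : ℝ := 2 * (2 + t ^ 2 * (2 * (C * M) + 2)) / t with hkρ
  have hkρ0 : 0 < kρ := by positivity
  set k₅ : ℝ := K * (48 / δ ^ 3 * √N) with hk₅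
  have hk₅0 : 0 ≤ k₅ := by positivity
  set k₆ : ℝ := k₅ * √(4 * (cn + 2) / δ) with hk₆
  have hk₆0 : 0 ≤ k₆ := by positivity
  have hk₂0 : 0 < k₂ := by positivity
  have hk₃0 : 0 < k₃ := by positivity
  set k : ℝ := k₂ + k₃ + kρ / c₁ + k₅ + k₆ with hk
  have hkc0 : 0 ≤ kρ / c₁ := by positivity
  have hk0 : 0 < k := by linarith
  set D : ℝ := 10 * √(2 / δ) * (3 * √(2 / δ) + 2 + 2 * K) with hD
  have hD0 : 0 < D := by positivity
  refine ⟨55 * C ^ 2 * (D * k), by positivity, ?_⟩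
  have hpr := tendsto_natCast_real hp
  have hnr := tendsto_natCast_real hn
  have hℓ := tendsto_log_natCast hp
  have hx := (tendsto_log_div_self hp).sqrt
  have hy := (tendsto_log_div_of_isLittleO (n := n) hp hγ hlogp).sqrt
  have hR := tendsto_rate (n := n) hp hγ hlogp
  rw [Real.sqrt_zero] at hx hy
  have ev_s₂ : ∀ᶠ m in atTop, k₂ * √(Real.log (p m) / p m) < 2 * (1 / δ) := by
    have := hx.const_mul k₂
    rw [mul_zero] at this
    exact this.eventually_lt_const (by positivity)
  have ev_s₃ : ∀ᶠ m in atTop, k₃ * √(Real.log (p m) / n m) < 64 * C := by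
    have := hy.const_mul k₃
    rw [mul_zero] at this
    exact this.eventually_lt_const (by positivity)
  have ev_ρ : ∀ᶠ m in atTop, kρ * √(Real.log (p m) / n m) < 1 := by
    have := hy.const_mul kρ
    rw [mul_zero] at this
    exact this.eventually_lt_const one_pos
  have ev_small : ∀ᶠ m in atTop, 2 / (δ ^ 2 * p m) + 2 * √(N / n m) < δ ^ 3 / 24 := by
    have h1 : Tendsto (fun m => 2 / (δ ^ 2 * (p m : ℝ))) atTop (𝓝 0) :=
      (hpr.const_mul_atTop (by positivity)).const_div_atTop 2
    have h2 : Tendsto (fun m => N / (n m : ℝ)) atTop (𝓝 0) := hnr.const_div_atTop N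
    have h3 := h1.add (h2.sqrt.const_mul 2)
    rw [Real.sqrt_zero, mul_zero, add_zero] at h3
    exact h3.eventually_lt_const (by positivity)
  have ev_r : ∀ᶠ m in atTop,
      22 * C * (D * k) * (√(Real.log (p m) / p m) + √(Real.log (p m) / n m)) < 1 := by
    have := hR.const_mul (22 * C * (D * k))
    rw [mul_zero] at this
    exact this.eventually_lt_const one_pos
  have ev_exp : ∀ᶠ m in atTop, 2 * Real.exp (-Real.log (p m)) < η / 6 := by
    have := (Real.tendsto_exp_atBot.comp (tendsto_neg_atTop_atBot.comp hℓ)).const_mul 2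
    rw [mul_zero] at this
    exact this.eventually_lt_const (by positivity)
  filter_upwards [ev_s₂, ev_s₃, ev_ρ, ev_small, ev_r, ev_exp, hcnb.bound, hcHb.bound,
    hp.eventually_ge_atTop (2 * K + 1), hn.eventually_ge_atTop 2, hℓ.eventually_ge_atTop 1,
    hHtop.eventually_ge_atTop (√(2 * (C * M)) + 2)]
    with m es₂ es₃ eρ esmall er eexp en eH ep2 en2 eℓ eHbig
  set ℓ := Real.log (p m) with hℓdef
  have hp0 : 0 < p m := by omega
  have hpR : (0 : ℝ) < p m := by exact_mod_cast hp0
  have hnR : (0 : ℝ) < n m := by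
    have : 0 < n m := by omega
    exact_mod_cast this
  have hℓ0 : 0 < ℓ := by linarith
  have hexpp : (p m : ℝ) = Real.exp ℓ := (Real.exp_log hpR).symm
  have hexpn : (n m : ℝ) ≤ Real.exp (cn * ℓ) := by
    rw [← Real.log_le_iff_le_exp hnR]
    refine (le_abs_self _).trans (en.trans (le_of_eq ?_))
    rw [Real.norm_eq_abs, abs_of_pos hℓ0]
  set x := √(ℓ / p m) with hxdef
  set y := √(ℓ / n m) with hydef
  have hx0 : 0 ≤ x := Real.sqrt_nonneg _
  have hy0 : 0 < y := Real.sqrt_pos.2 (by positivity)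
  have hx2 : x ^ 2 * p m = ℓ := by
    rw [hxdef, Real.sq_sqrt (by positivity), div_mul_cancel₀ _ hpR.ne']
  have hy2 : n m * y ^ 2 = ℓ := by
    rw [hydef, Real.sq_sqrt (by positivity), mul_div_cancel₀ _ hnR.ne']
  have hsqrtn : √(N / n m) ≤ √N * y := by
    rw [hydef, ← Real.sqrt_mul hN.le]
    refine Real.sqrt_le_sqrt ?_
    rw [mul_div_assoc', div_le_div_iff_of_pos_right hnR]
    exact le_mul_of_one_le_right hN.le eℓ
  have hsHb : √(2 * (C * M)) ≥ 0 := Real.sqrt_nonneg _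
  have hkx : k₂ * x ≤ k * (x + y) := by
    have : k₂ ≤ k := by rw [hk]; linarith
    exact mul_le_mul this (by linarith) hx0 hk0.le
  have hky : ∀ c, c ≤ k → c * y ≤ k * (x + y) := fun c hc =>
    mul_le_mul hc (by linarith) hy0.le hk0.le
  have hmain := measure_scatter_gt_le (P := P m) (hK m) hp0 (by omega) en2 (hdesign m) (heig m)
    (htrace m) hε (hmoment m) hc₁ (hlower m) hC (fun i => (hdiag m i).le.trans (le_max_left _ _)) hδ
    (hfactor m) (hidio m) (hpilot m) (s₁ := 4 * (cn + 2) * ℓ) (s₂ := k₂ * x) (s₃ := k₃ * y)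
    (ρ := kρ * y) (τ := t * y) (M := M) (N := N) (r := k * (x + y))
    (by positivity) es₂.le (by positivity) es₃.le hM (by positivity) (by linarith) (by positivity)
    (by
      -- `y` and the bound on `H` are reciprocal
      have h1 : H m ≤ cH * √(n m / ℓ) := by
        refine (le_abs_self _).trans (eH.trans (le_of_eq ?_))
        rw [Real.norm_eq_abs, abs_of_nonneg (Real.sqrt_nonneg _)]
      have h2 : y * √(n m / ℓ) = 1 := by
        rw [hydef, ← Real.sqrt_mul (by positivity), div_mul_div_cancel₀ hnR.ne', div_self hℓ0.ne',
          Real.sqrt_one]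
      calc t * y * H m ≤ t * y * (cH * √(n m / ℓ)) := mul_le_mul_of_nonneg_left h1 (by positivity)
        _ = (t * cH) * (y * √(n m / ℓ)) := by ring
        _ = 1 := by rw [h2, ht, one_div_mul_cancel hcH.ne', mul_one]
        _ ≤ 1 := le_rfl)
    (by
      have h1 : √(2 * (C * M)) ≤ H m - kρ * y := by linarith
      calc 2 * (C * M) = √(2 * (C * M)) ^ 2 := (Real.sq_sqrt (by positivity)).symm
        _ ≤ _ := pow_le_pow_left₀ hsHb h1 2)
    hN esmall.le hkx (hky k₃ (by rw [hk]; linarith))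
    (by
      rw [mul_div_right_comm]
      exact hky _ (by rw [hk]; linarith))
    (by
      refine le_trans ?_ (hky k₅ (by rw [hk]; linarith))
      calc K * (48 / δ ^ 3 * √(N / n m)) ≤ K * (48 / δ ^ 3 * (√N * y)) := by gcongr
        _ = _ := by rw [hk₅]; ring)
    (by
      refine le_trans (le_of_eq ?_) (hky k₆ (by rw [hk]; linarith))
      rw [hk₆, hk₅, Real.sqrt_div hN.le, mul_div_right_comm _ ℓ, Real.sqrt_mul (by positivity),
        hydef, Real.sqrt_div hℓ0.le]
      ring)
    (by
      have : 22 * C * (D * (k * (x + y))) = 22 * C * (D * k) * (x + y) := by ring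
      rw [this]
      exact er.le)
  have hset : 55 * C ^ 2 * (D * k) * (x + y) = 55 * C ^ 2 * (D * (k * (x + y))) := by ring
  simp only [hset]
  refine hmain.trans ?_
  have t₁ : (n m : ℝ) * p m * (√2 * Real.exp (-(4 * (cn + 2) * ℓ / 4))) ≤ η / 6 := by
    have h2 : √(2 : ℝ) ≤ 2 := Real.sqrt_le_iff.2 ⟨by norm_num, by norm_num⟩
    refine le_trans ?_ eexp.le
    calc _ ≤ Real.exp (cn * ℓ) * Real.exp ℓ * (2 * Real.exp (-(4 * (cn + 2) * ℓ / 4))) := by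
          rw [← hexpp]
          gcongr
      _ = 2 * Real.exp (cn * ℓ + ℓ + -(4 * (cn + 2) * ℓ / 4)) := by
          rw [Real.exp_add, Real.exp_add]
          ring
      _ = _ := by
          congr 2
          ring
  have t₂ : (n m : ℝ) * (2 * Real.exp (-((k₂ * x) ^ 2 * p m / (16 * (1 / δ) ^ 2)))) ≤ η / 6 := by
    refine le_trans ?_ eexp.le
    have h1 : (k₂ * x) ^ 2 * p m / (16 * (1 / δ) ^ 2) = (cn + 1) * ℓ := by
      rw [mul_pow, mul_assoc, hx2, hk₂, div_pow, mul_pow, Real.sq_sqrt (by positivity)]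
      field_simp
      ring
    rw [h1]
    calc _ ≤ Real.exp (cn * ℓ) * (2 * Real.exp (-((cn + 1) * ℓ))) := by gcongr
      _ = 2 * Real.exp (cn * ℓ + -((cn + 1) * ℓ)) := by
          rw [Real.exp_add]
          ring
      _ = _ := by
          congr 2
          ring
  have t₃ : (p m : ℝ) * p m * (2 * Real.exp (-(n m * (k₃ * y) ^ 2 / (1024 * C ^ 2)))) ≤ η / 6 := by
    refine le_trans (le_of_eq ?_) eexp.le
    have h1 : n m * (k₃ * y) ^ 2 / (1024 * C ^ 2) = 3 * ℓ := by
      rw [mul_pow, mul_left_comm, hy2, hk₃, mul_pow, Real.sq_sqrt (by norm_num)]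
      field_simp
      norm_num
    rw [h1]
    calc _ = Real.exp ℓ * Real.exp ℓ * (2 * Real.exp (-(3 * ℓ))) := by rw [← hexpp]
      _ = 2 * Real.exp (ℓ + ℓ + -(3 * ℓ)) := by
          rw [Real.exp_add, Real.exp_add]
          ring
      _ = _ := by
          congr 2
          ring
  have t₄ : (1 + C₁) / M ≤ η / 6 := by
    rw [div_le_iff₀ hM, hMdef]
    have : η / 6 * (6 * (1 + |C₁|) / η) = 1 + |C₁| := by field_simp
    rw [this]
    linarith [le_abs_self C₁]
  have t₅ : (p m : ℝ) * (2 * Real.exp (n m * (-(t * y * (kρ * y) / 2) +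
      (t * y) ^ 2 * (2 * (C * M) + 2 * (kρ * y) ^ 2)))) ≤ η / 6 := by
    refine le_trans ?_ eexp.le
    have h1 : (kρ * y) ^ 2 ≤ 1 := by
      rw [sq_le_one_iff₀ (by positivity)]
      exact eρ.le
    have h2 : n m * (-(t * y * (kρ * y) / 2) +
        (t * y) ^ 2 * (2 * (C * M) + 2 * (kρ * y) ^ 2)) =
        ℓ * (-(t * kρ / 2) + t ^ 2 * (2 * (C * M) + 2 * (kρ * y) ^ 2)) := by
      rw [← hy2]
      ring
    have h3 : t * kρ / 2 = 2 + t ^ 2 * (2 * (C * M) + 2) := by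
      rw [hkρ]
      field_simp
    have h4 : ℓ * (-(t * kρ / 2) + t ^ 2 * (2 * (C * M) + 2 * (kρ * y) ^ 2)) ≤ ℓ * (-2) := by
      refine mul_le_mul_of_nonneg_left ?_ hℓ0.le
      rw [h3]
      have : t ^ 2 * (2 * (C * M) + 2 * (kρ * y) ^ 2) ≤ t ^ 2 * (2 * (C * M) + 2) :=
        mul_le_mul_of_nonneg_left (by linarith) (sq_nonneg _)
      linarith
    rw [h2]
    calc _ ≤ Real.exp ℓ * (2 * Real.exp (ℓ * (-2))) := by
          rw [← hexpp]
          gcongr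
      _ = 2 * Real.exp (ℓ + ℓ * (-2)) := by
          rw [Real.exp_add]
          ring
      _ = _ := by
          congr 2
          ring
  have t₆ : 4 / N ≤ η / 6 := by
    rw [hNdef]
    refine le_of_eq ?_
    field_simp
    norm_num
  have hη6 : 0 ≤ η / 6 := by positivity
  calc _ ≤ ENNReal.ofReal (η / 6) + ENNReal.ofReal (η / 6) + ENNReal.ofReal (η / 6) +
        (ENNReal.ofReal (η / 6) + ENNReal.ofReal (η / 6)) + ENNReal.ofReal (η / 6) := by
        gcongr
    _ = ENNReal.ofReal η := by
        rw [← ENNReal.ofReal_add hη6 hη6, ← ENNReal.ofReal_add (by positivity) hη6,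
          ← ENNReal.ofReal_add (by positivity) (by positivity),
          ← ENNReal.ofReal_add (by positivity) hη6]
        congr 1
        ring

/-! ### Eigenvalue and eigenvector rates -/

/-- Transfer of an `O_p` bound through an eventually valid deterministic implication. -/
theorem IsBigOp.of_imp {Ω : ℕ → Type*} [∀ m, MeasurableSpace (Ω m)] {P : ∀ m, Measure (Ω m)}
    {X Y : ∀ m, Ω m → ℝ} {r r' : ℕ → ℝ} (hX : IsBigOp P X r)
    (h : ∀ M : ℝ, 0 < M → ∃ M' : ℝ, 0 < M' ∧
      ∀ᶠ m in atTop, ∀ ω, |X m ω| ≤ M * r m → |Y m ω| ≤ M' * r' m) : IsBigOp P Y r' := by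
  intro η hη
  obtain ⟨M, hM, hXM⟩ := hX η hη
  obtain ⟨M', hM', hY⟩ := h M hM
  refine ⟨M', hM', ?_⟩
  filter_upwards [hXM, hY] with m h1 h2
  refine (measure_mono fun ω hω => ?_).trans h1
  rw [Set.mem_ofPred_eq] at hω ⊢
  by_contra hcon
  exact absurd (h2 ω (not_lt.1 hcon)) (not_le.2 hω)

section EigenRates

variable {p K : ℕ} {A Γ S G : Matrix (Fin p) (Fin p) ℝ} {lam L : Fin p → ℝ}

/-- The polar factor of `alignMatrix`, an orthogonal matrix close to it when it is nearly
orthogonal. -/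
noncomputable def alignRotation (hK : K ≤ p) (Γ : Matrix (Fin p) (Fin p) ℝ) (lam : Fin p → ℝ)
    (G : Matrix (Fin p) (Fin p) ℝ) (L : Fin p → ℝ) : Matrix (Fin K) (Fin K) ℝ :=
  (exists_orthogonal_near (alignMatrix hK Γ lam G L)).choose

theorem alignRotation_orth (hK : K ≤ p) (Γ : Matrix (Fin p) (Fin p) ℝ) (lam : Fin p → ℝ)
    (G : Matrix (Fin p) (Fin p) ℝ) (L : Fin p → ℝ) :
    (alignRotation hK Γ lam G L)ᵀ * alignRotation hK Γ lam G L = 1 :=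
  (exists_orthogonal_near (alignMatrix hK Γ lam G L)).choose_spec.1

/-- The signs of the diagonal of `alignMatrix`. -/
noncomputable def alignSign (hK : K ≤ p) (Γ : Matrix (Fin p) (Fin p) ℝ) (lam : Fin p → ℝ)
    (G : Matrix (Fin p) (Fin p) ℝ) (L : Fin p → ℝ) (k : Fin K) : ℝ :=
  if 0 ≤ alignMatrix hK Γ lam G L k k then 1 else -1

/-- Entrywise error of the leading eigenvectors after the rotation `alignRotation`. -/
theorem maxNorm_leadCols_sub_rotation_le (hK : K ≤ p) (hp : 0 < p) (hA : IsEigenDecomp A Γ lam)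
    (hS : IsEigenDecomp S G L) {M r δ C T : ℝ} (hM : 0 ≤ M) (hr : 1 / √p ≤ r)
    (hE : ∀ i j, |(S - A) i j| ≤ M * r) (hδ : 0 < δ)
    (hlead : ∀ i : Fin p, (i : ℕ) < K → δ * p ≤ lam i) (h0 : ∀ i, 0 ≤ lam i)
    (hidio : ∀ i : Fin p, K ≤ (i : ℕ) → lam i ≤ 1 / δ) (hC : ∀ i, A i i ≤ C)
    (hsδ : M * r ≤ δ / 2) (hT : T = 2 / δ * (M + 1 / δ)) (hT1 : T * r ≤ 1)
    (hT2 : K * (3 * (T * r)) ≤ 1 / 2) :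
    maxNorm (leadCols hK G - leadCols hK Γ * alignRotation hK Γ lam G L) ≤
      (T + K * √(C / δ) * (K * (3 * T))) * (r / √p) := by
  have hp' : (0 : ℝ) < p := by exact_mod_cast hp
  have hsp : 0 < √(p : ℝ) := Real.sqrt_pos.2 hp'
  have hr0 : 0 ≤ r := le_trans (by positivity) hr
  have hT0 : 0 ≤ T := by rw [hT]; positivity
  have hres := abs_leadCols_sub_mul_le hK hA hS hM hr hE hδ hlead h0 hidio hC hsδ
  rw [← hT] at hres
  have hsT : √p * (T * (r / √p)) = T * r := by field_simp
  have hgram := abs_gram_sub_one_le (leadCols_orth hK hS.orth) (leadCols_orth hK hA.orth)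
    (B := alignMatrix hK Γ lam G L) (τ := T * (r / √p)) (by positivity) (fun i k => (hres i k).1)
    (by rw [hsT]; exact hT1)
  rw [hsT] at hgram
  have hQ := (exists_orthogonal_near (alignMatrix hK Γ lam G L)).choose_spec.2 (3 * (T * r))
    (by positivity) hT2 hgram
  refine maxNorm_le (by positivity) fun i k => ?_
  rw [Matrix.sub_apply]
  refine ((hres i k).2 (alignRotation hK Γ lam G L) _ hQ).trans (le_of_eq ?_)
  field_simp

/-- Entrywise error of the leading eigenvectors after matching signs, for separated eigenvalues. -/
theorem maxNorm_leadCols_sub_sign_le (hK : K ≤ p) (hp : 0 < p) (hA : IsEigenDecomp A Γ lam)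
    (hS : IsEigenDecomp S G L) {M r δ δ' C T U : ℝ} (hM : 0 ≤ M) (hr : 1 / √p ≤ r)
    (hE : ∀ i j, |(S - A) i j| ≤ M * r) (hδ : 0 < δ) (hδ' : 0 < δ')
    (hlead : ∀ i : Fin p, (i : ℕ) < K → δ * p ≤ lam i ∧ lam i ≤ p / δ) (h0 : ∀ i, 0 ≤ lam i)
    (hidio : ∀ i : Fin p, K ≤ (i : ℕ) → lam i ≤ 1 / δ) (hC : ∀ i, A i i ≤ C)
    (hsep : ∀ i j : Fin p, i < j → (j : ℕ) < K → δ' * p ≤ lam i - lam j)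
    (hsδ : M * r ≤ δ / 2) (hsδ' : M * r ≤ δ' / 2) (hT : T = 2 / δ * (M + 1 / δ))
    (hU : U = 4 / (δ ^ 2 * δ') * M) (hT1 : T * r ≤ 1) (hU1 : U * r ≤ 1) :
    maxNorm (leadCols hK G - leadCols hK Γ * Matrix.diagonal (alignSign hK Γ lam G L)) ≤
      (T + K * √(C / δ) * (3 * T + (K + 1) * U)) * (r / √p) := by
  have hp' : (0 : ℝ) < p := by exact_mod_cast hp
  have hsp : 0 < √(p : ℝ) := Real.sqrt_pos.2 hp'
  have hr0 : 0 ≤ r := le_trans (by positivity) hr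
  have hT0 : 0 ≤ T := by rw [hT]; positivity
  have hU0 : 0 ≤ U := by rw [hU]; positivity
  have hres := abs_leadCols_sub_mul_le hK hA hS hM hr hE hδ (fun i hi => (hlead i hi).1) h0 hidio hC
    hsδ
  rw [← hT] at hres
  have hsT : √p * (T * (r / √p)) = T * r := by field_simp
  have hgram := abs_gram_sub_one_le (leadCols_orth hK hS.orth) (leadCols_orth hK hA.orth)
    (B := alignMatrix hK Γ lam G L) (τ := T * (r / √p)) (by positivity) (fun i k => (hres i k).1)
    (by rw [hsT]; exact hT1)
  rw [hsT] at hgram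
  have hoff : ∀ l k : Fin K, l ≠ k → |alignMatrix hK Γ lam G L l k| ≤ U * r := fun l k hlk => by
    have := abs_alignMatrix_offDiag_le hK hA hS (by positivity) hE hδ hδ' hlead hsep hsδ hsδ' hlk
    rw [hU, mul_assoc]
    exact this
  have hQ := abs_sub_diagonal_sign_le (show 0 ≤ 3 * (T * r) by positivity) (by positivity) hU1
    (fun k => hgram k k) hoff
  refine maxNorm_le (by positivity) fun i k => ?_
  rw [Matrix.sub_apply]
  refine ((hres i k).2 (Matrix.diagonal (alignSign hK Γ lam G L)) _ hQ).trans (le_of_eq ?_)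
  field_simp

end EigenRates

/-- The eigenvector rate is the entrywise rate divided by `√p`. -/
theorem rate_div_sqrt (ℓ : ℝ) (n p : ℕ) :
    (√(ℓ / p) + √(ℓ / n)) / √p = √(ℓ / (p : ℝ) ^ 2) + √(ℓ / (n * p)) := by
  rw [add_div, ← Real.sqrt_div' _ (Nat.cast_nonneg p), ← Real.sqrt_div' _ (Nat.cast_nonneg p),
    div_div, div_div, sq]

end IPSN

open IPSN in
theorem theorem1
    {Ω : ℕ → Type*} [∀ m, MeasurableSpace (Ω m)]
    (P : ∀ m, Measure (Ω m)) [∀ m, IsProbabilityMeasure (P m)]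
    -- sample sizes and dimensions along the asymptotic sequence, and the number of factors
    (n p : ℕ → ℕ) (K : ℕ) (hK : ∀ m, K ≤ p m)
    (hn : Tendsto n atTop atTop) (hp : Tendsto p atTop atTop)
    -- the elliptical model
    (ξ : ∀ m, Fin (n m) → Ω m → ℝ)
    (u : ∀ m, Fin (n m) → Ω m → EuclideanSpace ℝ (Fin (p m)))
    (hdesign : ∀ m, IsEllipticalDesign (P m) (ξ m) (u m))
    (μ : ∀ m, Fin (p m) → ℝ)
    (Sig0 : ∀ m, Matrix (Fin (p m)) (Fin (p m)) ℝ)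
    (hpsd : ∀ m, (Sig0 m).PosSemidef)
    (htrace : ∀ m, (Sig0 m).trace = (p m : ℝ))
    -- only `2 + ε` moments, and the scalars bounded away from zero
    (ε c₁ C₁ : ℝ) (hε : 0 < ε) (hε2 : ε < 2) (hc₁ : 0 < c₁)
    (hmoment : ∀ m t, Integrable (fun ω => |ξ m t ω| ^ (2 + ε)) (P m) ∧
      ∫ ω, |ξ m t ω| ^ (2 + ε) ∂(P m) < C₁)
    (hlower : ∀ m t, ∀ᵐ ω ∂(P m), c₁ < |ξ m t ω|)
    -- bounded diagonal
    (c₂ C₂ : ℝ) (hc₂ : 0 < c₂)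
    (hdiag : ∀ m i, c₂ < Sig0 m i i ∧ Sig0 m i i < C₂)
    -- eigen-decomposition of the scatter matrix and factor structure
    (Gam : ∀ m, Matrix (Fin (p m)) (Fin (p m)) ℝ) (lam : ∀ m, Fin (p m) → ℝ)
    (heig : ∀ m, IsEigenDecomp (Sig0 m) (Gam m) (lam m))
    (δ : ℝ) (hδ : 0 < δ)
    (hfactor : ∀ m (i : Fin (p m)), (i : ℕ) < K → δ * p m ≤ lam m i ∧ lam m i ≤ p m / δ)
    (hidio : ∀ m (i : Fin (p m)), K ≤ (i : ℕ) → δ ≤ lam m i ∧ lam m i ≤ 1 / δ)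
    -- growth conditions
    (γ : ℝ) (hγ : 0 < γ)
    (hlogp : (fun m => Real.log (p m) ^ (2 + γ)) =o[atTop] fun m => (n m : ℝ))
    (hlogn : (fun m => Real.log (n m)) =O[atTop] fun m => Real.log (p m))
    -- Huber tuning parameter
    (H : ℕ → ℝ) (hHpos : ∀ m, 0 < H m) (hHtop : Tendsto H atTop atTop)
    (hH : H =O[atTop] fun m => √((n m : ℝ) / Real.log (p m)))
    -- the estimators
    (muHat : ∀ m, Ω m → Fin (p m) → ℝ)
    (Pr : ∀ m, Ω m → Matrix (Fin (p m - K)) (Fin (p m)) ℝ)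
    (SigHat GamHat : ∀ m, Ω m → Matrix (Fin (p m)) (Fin (p m)) ℝ)
    (lamHat : ∀ m, Ω m → Fin (p m) → ℝ)
    (hpilot : ∀ m ω, IsPilot K (hK m) (H m)
      (ellipticalObs (μ m) (Sig0 m) (fun t => ξ m t ω) (fun t => u m t ω))
      (muHat m ω) (Pr m ω) (SigHat m ω) (GamHat m ω) (lamHat m ω)) :
    IsBigOp P (fun m ω => maxNorm (SigHat m ω - Sig0 m))
        (fun m => √(Real.log (p m) / p m) + √(Real.log (p m) / n m)) ∧
    IsBigOp P
        (fun m ω => maxNorm (leadDiag (hK m) (lamHat m ω) * (leadDiag (hK m) (lam m))⁻¹ - 1))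
        (fun m => √(Real.log (p m) / p m) + √(Real.log (p m) / n m)) ∧
    -- leading eigenvectors, up to a rotation of the leading eigenspace
    (∃ Q : ∀ m, Ω m → Matrix (Fin K) (Fin K) ℝ, (∀ m ω, (Q m ω)ᵀ * Q m ω = 1) ∧
      IsBigOp P
        (fun m ω => maxNorm (leadCols (hK m) (GamHat m ω) - leadCols (hK m) (Gam m) * Q m ω))
        (fun m => √(Real.log (p m) / (p m : ℝ) ^ 2) + √(Real.log (p m) / (n m * p m)))) ∧
    -- leading eigenvectors, up to signs only, when the leading eigenvalues are separated
    (∀ δ' : ℝ, 0 < δ' →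
      (∀ m (i j : Fin (p m)), i < j → (j : ℕ) < K → δ' * p m ≤ lam m i - lam m j) →
      ∃ s : ∀ m, Ω m → Fin K → ℝ, (∀ m ω k, s m ω k = 1 ∨ s m ω k = -1) ∧
        IsBigOp P
          (fun m ω => maxNorm (leadCols (hK m) (GamHat m ω) -
            leadCols (hK m) (Gam m) * Matrix.diagonal (s m ω)))
          (fun m => √(Real.log (p m) / (p m : ℝ) ^ 2) + √(Real.log (p m) / (n m * p m)))) := by
  have hlow : ∀ m i, 0 ≤ lam m i := fun m i => by
    rcases lt_or_ge (i : ℕ) K with h | h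
    · exact le_trans (by positivity) (hfactor m i h).1
    · exact hδ.le.trans (hidio m i h).1
  have hscatter := isBigOp_scatter P n p K hK hn hp ξ u hdesign μ Sig0 htrace ε c₁ C₁ hε hc₁ hmoment
    hlower C₂ (fun m i => (hdiag m i).2) Gam lam heig δ hδ hfactor hidio γ hγ hlogp hlogn H hHtop hH
    muHat Pr SigHat GamHat lamHat hpilot
  have hR := tendsto_rate (n := n) hp hγ hlogp
  set R : ℕ → ℝ := fun m => √(Real.log (p m) / p m) + √(Real.log (p m) / n m) with hRdef
  have hR0 : ∀ m, 0 ≤ R m := fun m => add_nonneg (Real.sqrt_nonneg _) (Real.sqrt_nonneg _)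
  have hRsmall : ∀ c e : ℝ, 0 < e → ∀ᶠ m in atTop, c * R m ≤ e := fun c e he => by
    have := hR.const_mul c
    rw [mul_zero] at this
    exact this.eventually_le_const he
  have hRlow : ∀ᶠ m in atTop, 0 < p m ∧ 1 / √(p m : ℝ) ≤ R m := by
    filter_upwards [(tendsto_log_natCast hp).eventually_ge_atTop 1, hp.eventually_gt_atTop 0]
      with m h1 h2
    refine ⟨h2, le_trans ?_ (le_add_of_nonneg_right (Real.sqrt_nonneg _))⟩
    rw [Real.sqrt_div (by linarith)]
    exact div_le_div_of_nonneg_right (Real.one_le_sqrt.2 h1) (Real.sqrt_nonneg _)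
  have hrate : ∀ m, √(Real.log (p m) / (p m : ℝ) ^ 2) + √(Real.log (p m) / (n m * p m)) =
      R m / √(p m : ℝ) := fun m => (rate_div_sqrt _ _ _).symm
  have hentry : ∀ {m ω} {M : ℝ}, |maxNorm (SigHat m ω - Sig0 m)| ≤ M * R m →
      ∀ i j, |(SigHat m ω - Sig0 m) i j| ≤ M * R m := fun h i j =>
    (abs_le_maxNorm _ i j).trans ((le_abs_self _).trans h)
  refine ⟨hscatter, hscatter.of_imp fun M hM => ⟨M / δ, by positivity, Eventually.of_forall
    fun m ω h => ?_⟩, ⟨fun m ω => alignRotation (hK m) (Gam m) (lam m) (GamHat m ω) (lamHat m ω),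
    fun m ω => alignRotation_orth _ _ _ _ _, hscatter.of_imp fun M hM => ?_⟩,
    fun δ' hδ' hsep => ⟨fun m ω => alignSign (hK m) (Gam m) (lam m) (GamHat m ω) (lamHat m ω),
    fun m ω k => ?_, hscatter.of_imp fun M hM => ?_⟩⟩
  · rw [abs_of_nonneg (maxNorm_nonneg _)]
    refine (maxNorm_leadDiag_le (hK m) (heig m) (hpilot m ω).eigen (mul_nonneg hM.le (hR0 m))
      (hentry h) hδ fun i hi => (hfactor m i hi).1).trans (le_of_eq ?_)
    ring
  · set T := 2 / δ * (M + 1 / δ) with hT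
    have hT0 : 0 < T := by positivity
    refine ⟨T + K * √(C₂ / δ) * (K * (3 * T)), by positivity, ?_⟩
    filter_upwards [hRlow, hRsmall M (δ / 2) (by positivity), hRsmall T 1 one_pos,
      hRsmall (K * (3 * T)) (1 / 2) (by norm_num)] with m h1 h2 h3 h4 ω h
    rw [abs_of_nonneg (maxNorm_nonneg _), hrate]
    exact maxNorm_leadCols_sub_rotation_le (hK m) h1.1 (heig m) (hpilot m ω).eigen hM.le h1.2
      (hentry h) hδ (fun i hi => (hfactor m i hi).1) (hlow m) (fun i hi => (hidio m i hi).2)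
      (fun i => (hdiag m i).2.le) h2 hT h3 (by linarith)
  · simp only [alignSign]
    split_ifs <;> simp
  · set T := 2 / δ * (M + 1 / δ) with hT
    set U := 4 / (δ ^ 2 * δ') * M with hU
    have hT0 : 0 < T := by positivity
    have hU0 : 0 < U := by positivity
    refine ⟨T + K * √(C₂ / δ) * (3 * T + (K + 1) * U), by positivity, ?_⟩
    filter_upwards [hRlow, hRsmall M (δ / 2) (by positivity), hRsmall M (δ' / 2) (by positivity),
      hRsmall T 1 one_pos, hRsmall U 1 one_pos] with m h1 h2 h2' h3 h4 ω h
    rw [abs_of_nonneg (maxNorm_nonneg _), hrate]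
    exact maxNorm_leadCols_sub_sign_le (hK m) h1.1 (heig m) (hpilot m ω).eigen hM.le h1.2
      (hentry h) hδ hδ' (hfactor m) (hlow m) (fun i hi => (hidio m i hi).2)
      (fun i => (hdiag m i).2.le) (hsep m) h2 h2' hT hU h3 h4
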